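/- **Conventions.** Graphs are finite and may have loops and parallel edges; a loop counts twice in degrees. A signed graph is a graph $G$ with a signature $\sigma:E(G)\to\{1,-1\}$. Switching at a vertex changes the sign of all non-loop edges at it; signatures related by switchings are equivalent. $G$ is balanced if some equivalent signature has no negative edge, and unbalanced otherwise. A cycle is positive (negative) if the product of the signs of its edges is $1$ ($-1$). $\delta_G(X)$ is the set of edges of $G$ with exactly one end in $X$. A theta is a 2-connected graph of maximum degree $3$ with exactly two vertices of degree $3$. A block is a maximal connected subgraph without a cut vertex of its own; a leaf-block of $G'$ is a block that contains at most one cut vertex of $G'$. A generalized cycle is a cycle or a single vertex. Let $H$ be a subgraph of a signed graph $G'$ of maximum degree at most $3$. A generalized cycle $C\subseteq H$ is *good in $H$* if it is a single vertex of degree $0$ or $1$ in $G'$, or a positive cycle with at least two vertices of degree $2$ in $H$. It is *usable in $H$* if it is good in $H$, or is a negative cycle with at most one vertex whose degree in $H$ is not $2$. *Good in $G'$* is the case $H=G'$. A *fish* is a signed graph that is the union of a theta $T$ whose branches have lengths $2$, $2$, $3$ and a path $P$ of odd length at least $3$ that is internally disjoint from $T$ and whose ends are the two adjacent vertices of degree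 $2$ of $T$, such that $T$ is balanced and $T\cup P$ is unbalanced. Its *distinguished edge* is the unique edge that lies in no edge cut of size $2$ of the fish. **Cycle Selection Algorithm.** *Input:* a signed 3-edge-connected cubic graph $G$ with two vertex-disjoint negative cycles. *Output:* a list $\mathcal C=C_1,\dots,C_t$ of subgraphs, each declared to be positive, negative ordinary, negative special, or fish. *Pre-process step.* If $G$ has vertex-disjoint negative cycles $C_1,C_2$ with $V(C_1)\cup V(C_2)=V(G)$, declare both (for some such pair) negative special and return $C_1,C_2$. Otherwise let $C_1$ be a negative cycle such that $G-V(C_1)$ contains an unbalanced theta, declare it negative special, and start the recursion with $\mathcal C=C_1$. *Recursive step*, given $\mathcal C=C_1,\dots,C_{i-1}$. Let $G'=G-\bigcup_{j<i}V(C_j)$. 1. If $G'$ is empty, return $\mathcal C$. 2. Let $H$ be a leaf-block of $G'$, chosen so that $G'-V(H)$ contains an unbalanced theta if possible. 3. If $G'$ contains no unbalanced theta, let $C_i$ be usable in $H$, declare it negative ordinary if it is a negative cycle and positive otherwise, append it to $\mathcal C$ and recurse. 4. Otherwise, if $H$ is a negative cycle, declare $C_i=H$ negative ordinary, append it and recurse.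 5. Otherwise let $C_i$ be good in $H$, chosen so that $G'-V(C_i)$ contains an unbalanced theta if possible. 6. If $G'-V(C_i)$ contains an unbalanced theta, declare $C_i$ positive, append it and recurse. 7. Otherwise discard this $C_i$ and let $k$ be the number of negative ordinary cycles of even length in $\mathcal C$. 8. (a) If $G'$ is switching equivalent to a fish: if $k$ is odd, declare $C_i=G'$ fish; if $k$ is even, let $C_i$ be good in $G'$ and declare it positive. Append $C_i$ and recurse. (b) If not, let $D_0,D_1\subseteq G'$ be cycles such that: $D_1$ is negative and $D_0$ is good in $G'$; $G'-V(D_1)$ contains no unbalanced theta; $G'-V(D_0)$ and $G'-V(D_1)$ have the same negative cycles of even length; and either $D_1$ has at least two vertices of degree $2$ in $G'$, or it has at least one such vertex and $G'-V(D_1)$ has at most two negative cycles. Let $j$ be the number of negative cycles of even length in $G'-V(D_0)$. If $k+j$ is even, let $C_i=D_1$ and declare it negative special; otherwise let $C_i=D_0$ and declare it positive. Append $C_i$ and recurse. **Orientations and preflows.** An orientation of a signed graph directs each of the two half-edges of every edge either away from or towards its end, so that the two directions of a positive edge are one away and one towards its ends and the two directions of a negative edge are both away or both towards. For an abelian group $A$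 and $\phi:E\to A$, the boundary $\partial\phi(v)$ is the sum of $\phi$ over the half-edges directed away from $v$ minus the sum over those directed towards $v$. If all degrees are at most $3$, $\phi$ is a *preflow* when, for every vertex $v$, $\partial\phi(v)\ne0$ if and only if $\deg(v)\in\{1,2\}$. **Lemma.** Let $G$ be a signed 3-edge-connected cubic graph with two vertex-disjoint negative cycles, and let $\mathcal C=C_1,\dots,C_t$ be any list returned by the Cycle Selection Algorithm on input $G$. Let $G^*$ be any orientation of a signed graph obtained from $G$ by subdividing (once) exactly one edge of every negative special cycle and of every negative ordinary cycle of even length in $\mathcal C$, where the signs of the two halves of a subdivided edge multiply to the sign of that edge. Then there is a preflow $\phi:E(G^*)\to\mathbb Z_3$ such that $\phi(e)=0$ only if $e$ lies in (the subdivision of) a negative special cycle of $\mathcal C$, or in a positive cycle of $\mathcal C$, or is the distinguished edge of a fish of $\mathcal C$. -/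

import Mathlib

open scoped Graph

namespace CycleSelection

variable {α β : Type*}

/-! ### Multigraphs -/

/-- The degree of a vertex; a loop counts twice. -/
noncomputable def degree (G : Graph α β) (v : α) : ℕ :=
  (G.incidenceSet v).ncard + (G.loopSet v).ncard

/-- `y` can be reached from `x` along edges of `G`. -/
def Reach (G : Graph α β) (x y : α) : Prop := Relation.ReflTransGen G.Adj x y

def Connected (G : Graph α β) : Prop :=
  V(G).Nonempty ∧ ∀ x ∈ V(G), ∀ y ∈ V(G), Reach G x y

def EdgeConnected (k : ℕ) (G : Graph α β) : Prop :=
  ∀ F ⊆ E(G), F.ncard < k → Connected (G.deleteEdges F)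

def Cubic (G : Graph α β) : Prop := ∀ v ∈ V(G), degree G v = 3

/-- The edge cut `δ(X)`: the edges with one end in `X` and the other end outside `X`. -/
def edgeCut (G : Graph α β) (X : Set α) : Set β :=
  {e | ∃ x y, G.IsLink e x y ∧ x ∈ X ∧ y ∉ X}

/-- A vertex that separates two other vertices of the same component. -/
def IsCutVertex (G : Graph α β) (v : α) : Prop :=
  v ∈ V(G) ∧ ∃ x ∈ V(G), ∃ y ∈ V(G), x ≠ v ∧ y ≠ v ∧ Reach G x y ∧ ¬ Reach (G.deleteVerts {v}) x y

/-- A block: a maximal connected subgraph that has no cut vertex of its own. -/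
def IsBlock (G H : Graph α β) : Prop :=
  Maximal (fun K : Graph α β => K ≤ G ∧ Connected K ∧ ∀ v, ¬ IsCutVertex K v) H

/-- A leaf-block: a block that contains at most one cut vertex of the whole graph, that is, a
node of degree at most one of the block-cut tree. -/
def IsLeafBlock (G H : Graph α β) : Prop :=
  IsBlock G H ∧ {v ∈ V(H) | IsCutVertex G v}.Subsingleton

/-- A (finite) graph that is a cycle: connected with all degrees equal to two. -/
def IsCycle (C : Graph α β) : Prop := Connected C ∧ ∀ v ∈ V(C), degree C v = 2

/-- A (finite) graph that is a path of positive length with ends `x` and `y`. -/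
def IsPath (P : Graph α β) (x y : α) : Prop :=
  Connected P ∧ x ∈ V(P) ∧ y ∈ V(P) ∧ x ≠ y ∧ degree P x = 1 ∧ degree P y = 1 ∧
    ∀ v ∈ V(P), v ≠ x → v ≠ y → degree P v = 2

/-- The length of a cycle or of a path. -/
noncomputable def length (C : Graph α β) : ℕ := E(C).ncard

/-- A theta: a 2-connected subcubic graph with exactly two vertices of degree three. -/
def IsTheta (T : Graph α β) : Prop :=
  T.Loopless ∧ Connected T ∧ (∀ v, ¬ IsCutVertex T v) ∧ (∀ v ∈ V(T), degree T v ≤ 3) ∧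
    {v ∈ V(T) | degree T v = 3}.ncard = 2

/-! ### Signed graphs

A signed graph is a graph `G` with a signature `σ : β → ℤˣ`; only the values of `σ` on the edges
of `G` matter. -/

/-- `τ` arises from `σ` by switching at the vertices `x` with `s x = -1`. -/
def SwitchEquivalent (G : Graph α β) (σ τ : β → ℤˣ) : Prop :=
  ∃ s : α → ℤˣ, ∀ e x y, G.IsLink e x y → τ e = s x * σ e * s y

/-- Some equivalent signature has no negative edge. -/
def Balanced (σ : β → ℤˣ) (G : Graph α β) : Prop :=
  ∃ τ : β → ℤˣ, SwitchEquivalent G σ τ ∧ ∀ e ∈ E(G), τ e = 1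

/-- The sign of a subgraph: the product of the signs of its edges. -/
noncomputable def sign (σ : β → ℤˣ) (C : Graph α β) : ℤˣ := ∏ᶠ e ∈ E(C), σ e

def IsPositiveCycle (σ : β → ℤˣ) (C : Graph α β) : Prop := IsCycle C ∧ sign σ C = 1

def IsNegativeCycle (σ : β → ℤˣ) (C : Graph α β) : Prop := IsCycle C ∧ sign σ C = -1

def HasUnbalancedTheta (σ : β → ℤˣ) (G : Graph α β) : Prop :=
  ∃ T ≤ G, IsTheta T ∧ ¬ Balanced σ T

/-- A theta `H` with three internally disjoint branches of lengths two, two and three, together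
with a path `P` of odd length at least three that meets `H` in its ends only, the ends being two
adjacent vertices of degree two of `H`; `H` is balanced and the whole graph is not. -/
def IsFish (σ : β → ℤˣ) (G : Graph α β) : Prop :=
  ∃ H ≤ G, ∃ P ≤ G,
    (∃ p q, ∃ B₁ ≤ H, ∃ B₂ ≤ H, ∃ B₃ ≤ H,
      IsPath B₁ p q ∧ IsPath B₂ p q ∧ IsPath B₃ p q ∧
      length B₁ = 2 ∧ length B₂ = 2 ∧ length B₃ = 3 ∧
      V(B₁) ∩ V(B₂) = {p, q} ∧ V(B₁) ∩ V(B₃) = {p, q} ∧ V(B₂) ∩ V(B₃) = {p, q} ∧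
      V(H) = V(B₁) ∪ V(B₂) ∪ V(B₃) ∧ E(H) = E(B₁) ∪ E(B₂) ∪ E(B₃)) ∧
    (∃ x y, IsPath P x y ∧ Odd (length P) ∧ 3 ≤ length P ∧ V(P) ∩ V(H) = {x, y} ∧
      degree H x = 2 ∧ degree H y = 2 ∧ H.Adj x y) ∧
    V(G) = V(H) ∪ V(P) ∧ E(G) = E(H) ∪ E(P) ∧
    Balanced σ H ∧ ¬ Balanced σ G

/-- The distinguished edge of a fish: the edge that lies in no 2-edge cut of the fish. -/
def IsDistinguishedEdge (F : Graph α β) (e : β) : Prop :=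
  e ∈ E(F) ∧ ∀ X : Set α, (edgeCut F X).ncard = 2 → e ∉ edgeCut F X

/-! ### Good and usable generalized cycles

A generalized cycle is a cycle or a single vertex. It is selected inside a subgraph `H` (a
leaf-block, or the whole graph) of `G`: the vertices of degree two on a cycle are those of degree
two in `H`, whereas a single vertex has to have degree at most one in `G`. -/

def IsGoodIn (σ : β → ℤˣ) (G H C : Graph α β) : Prop :=
  C ≤ H ∧
    ((∃ v, C = Graph.noEdge {v} β ∧ degree G v ≤ 1) ∨
      (IsPositiveCycle σ C ∧ 2 ≤ {v ∈ V(C) | degree H v = 2}.ncard))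

def IsUsableIn (σ : β → ℤˣ) (G H C : Graph α β) : Prop :=
  IsGoodIn σ G H C ∨
    (C ≤ H ∧ IsNegativeCycle σ C ∧ {v ∈ V(C) | degree H v ≠ 2}.ncard ≤ 1)

/-- Good generalized cycles of a graph. -/
def IsGood (σ : β → ℤˣ) (G C : Graph α β) : Prop := IsGoodIn σ G G C

/-! ### The Cycle Selection Algorithm -/

inductive CycleType
  | positive
  | negativeOrdinary
  | negativeSpecial
  | fish

/-- The negative cycles of even length of `G`. -/
def evenNegativeCycles (σ : β → ℤˣ) (G : Graph α β) : Set (Graph α β) :=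
  {N | N ≤ G ∧ IsNegativeCycle σ N ∧ Even (length N)}

/-- The requirements on the pair of cycles `C₀, C₁` between which the algorithm decides according
to parity. -/
def IsParityPair (σ : β → ℤˣ) (G C₀ C₁ : Graph α β) : Prop :=
  (C₁ ≤ G ∧ IsNegativeCycle σ C₁) ∧ (IsCycle C₀ ∧ IsGood σ G C₀) ∧
  ¬ HasUnbalancedTheta σ (G.deleteVerts V(C₁)) ∧
  evenNegativeCycles σ (G.deleteVerts V(C₀)) = evenNegativeCycles σ (G.deleteVerts V(C₁)) ∧
  (2 ≤ {v ∈ V(C₁) | degree G v = 2}.ncard ∨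
    (1 ≤ {v ∈ V(C₁) | degree G v = 2}.ncard ∧
      {N | N ≤ G.deleteVerts V(C₁) ∧ IsNegativeCycle σ N}.ncard ≤ 2))

/-- The last step of a round, reached when `G` has an unbalanced theta but no choice of a good
cycle leaves one: `C` may be selected with type `t`, where `k` is the number of negative ordinary
cycles of even length selected so far. -/
inductive FinalStep (σ : β → ℤˣ) (G : Graph α β) (k : ℕ) : Graph α β → CycleType → Prop
  | fishOdd : (∃ τ, SwitchEquivalent G σ τ ∧ IsFish τ G) → Odd k →
      FinalStep σ G k G .fish
  | fishEven (C : Graph α β) : (∃ τ, SwitchEquivalent G σ τ ∧ IsFish τ G) → Even k →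
      IsGood σ G C → FinalStep σ G k C .positive
  | special (C₀ C₁ : Graph α β) : (¬ ∃ τ, SwitchEquivalent G σ τ ∧ IsFish τ G) →
      IsParityPair σ G C₀ C₁ →
      Even (k + (evenNegativeCycles σ (G.deleteVerts V(C₀))).ncard) →
      FinalStep σ G k C₁ .negativeSpecial
  | positive (C₀ C₁ : Graph α β) : (¬ ∃ τ, SwitchEquivalent G σ τ ∧ IsFish τ G) →
      IsParityPair σ G C₀ C₁ →
      Odd (k + (evenNegativeCycles σ (G.deleteVerts V(C₀))).ncard) →
      FinalStep σ G k C₀ .positive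

/-- A leaf-block whose removal leaves an unbalanced theta, if there is such a leaf-block, and any
leaf-block otherwise. -/
def IsChosenLeafBlock (σ : β → ℤˣ) (G H : Graph α β) : Prop :=
  IsLeafBlock G H ∧
    ((∃ H', IsLeafBlock G H' ∧ HasUnbalancedTheta σ (G.deleteVerts V(H'))) →
      HasUnbalancedTheta σ (G.deleteVerts V(H)))

/-- A good cycle in `H` whose removal from `G` leaves an unbalanced theta, if there is such a good
cycle, and any good cycle in `H` otherwise. -/
def IsChosenGoodCycle (σ : β → ℤˣ) (G H C : Graph α β) : Prop :=
  IsGoodIn σ G H C ∧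
    ((∃ C', IsGoodIn σ G H C' ∧ HasUnbalancedTheta σ (G.deleteVerts V(C'))) →
      HasUnbalancedTheta σ (G.deleteVerts V(C)))

/-- One round of the recursion on the remaining graph `G`: `C` may be selected with type `t`. -/
inductive Round (σ : β → ℤˣ) (G : Graph α β) (k : ℕ) : Graph α β → CycleType → Prop
  | usableNegative (H C : Graph α β) : IsChosenLeafBlock σ G H → ¬ HasUnbalancedTheta σ G →
      IsUsableIn σ G H C → IsNegativeCycle σ C → Round σ G k C .negativeOrdinary
  | usablePositive (H C : Graph α β) : IsChosenLeafBlock σ G H → ¬ HasUnbalancedTheta σ G →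
      IsUsableIn σ G H C → ¬ IsNegativeCycle σ C → Round σ G k C .positive
  | negativeBlock (H : Graph α β) : IsChosenLeafBlock σ G H → HasUnbalancedTheta σ G →
      IsNegativeCycle σ H → Round σ G k H .negativeOrdinary
  | good (H C : Graph α β) : IsChosenLeafBlock σ G H → HasUnbalancedTheta σ G →
      ¬ IsNegativeCycle σ H → IsChosenGoodCycle σ G H C →
      HasUnbalancedTheta σ (G.deleteVerts V(C)) → Round σ G k C .positive
  | final (H D C : Graph α β) (t : CycleType) : IsChosenLeafBlock σ G H →
      HasUnbalancedTheta σ G → ¬ IsNegativeCycle σ H → IsChosenGoodCycle σ G H D →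
      ¬ HasUnbalancedTheta σ (G.deleteVerts V(D)) → FinalStep σ G k C t → Round σ G k C t

/-- The graph that remains after deleting the vertices of all members of the list. -/
def remaining (G : Graph α β) (L : List (Graph α β × CycleType)) : Graph α β :=
  G.deleteVerts {v | ∃ p ∈ L, v ∈ V(p.1)}

open Classical in
/-- The number of negative ordinary cycles of even length in the list. -/
noncomputable def evenOrdinaryCount (L : List (Graph α β × CycleType)) : ℕ :=
  L.countP fun p => decide (p.2 = .negativeOrdinary ∧ Even (length p.1))

/-- Two vertex-disjoint negative cycles that together cover all the vertices. -/
def IsNegativePartition (σ : β → ℤˣ) (G C₁ C₂ : Graph α β) : Prop :=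
  C₁ ≤ G ∧ C₂ ≤ G ∧ IsNegativeCycle σ C₁ ∧ IsNegativeCycle σ C₂ ∧
    Disjoint V(C₁) V(C₂) ∧ V(C₁) ∪ V(C₂) = V(G)

/-- The lists that can occur during the recursive part of the algorithm on input `G`. -/
inductive Partial (σ : β → ℤˣ) (G : Graph α β) : List (Graph α β × CycleType) → Prop
  | start (C : Graph α β) : (¬ ∃ C₁ C₂, IsNegativePartition σ G C₁ C₂) →
      C ≤ G → IsNegativeCycle σ C → HasUnbalancedTheta σ (G.deleteVerts V(C)) →
      Partial σ G [(C, .negativeSpecial)]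
  | step (L : List (Graph α β × CycleType)) (C : Graph α β) (t : CycleType) : Partial σ G L →
      Round σ (remaining G L) (evenOrdinaryCount L) C t → Partial σ G (L ++ [(C, t)])

/-- `L` is a list that the algorithm can return on input `G`, for some choices it can make. -/
inductive Returned (σ : β → ℤˣ) (G : Graph α β) : List (Graph α β × CycleType) → Prop
  | preprocess (C₁ C₂ : Graph α β) : IsNegativePartition σ G C₁ C₂ →
      Returned σ G [(C₁, .negativeSpecial), (C₂, .negativeSpecial)]
  | recursion (L : List (Graph α β × CycleType)) : Partial σ G L → V(remaining G L) = ∅ →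
      Returned σ G L

/-! ### Subdivisions, orientations and preflows -/

/-- A labelling of the two ends of every edge of `G` by `false` and `true`, which gives names to
the two half-edges of every edge (loops included). -/
structure EndLabelling (G : Graph α β) where
  tip : β → Bool → α
  isLink : ∀ e ∈ E(G), G.IsLink e (tip e false) (tip e true)

/-- The graph obtained from `G` by subdividing every edge in `S` once. The vertex `inr e`
subdivides `e ∈ S`, whose two halves are the edges `inr (e, false)` and `inr (e, true)`; an edge
`e ∉ S` persists as `inl e`. -/
def subdivide (G : Graph α β) (ℓ : EndLabelling G) (S : Set β) :
    Graph (α ⊕ β) (β ⊕ β × Bool) where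
  vertexSet := Sum.inl '' V(G) ∪ Sum.inr '' (S ∩ E(G))
  IsLink
    | .inl e, u, v => e ∉ S ∧ ∃ x y, G.IsLink e x y ∧ u = .inl x ∧ v = .inl y
    | .inr (e, b), u, v => e ∈ S ∧ e ∈ E(G) ∧
        ((u = .inl (ℓ.tip e b) ∧ v = .inr e) ∨ (u = .inr e ∧ v = .inl (ℓ.tip e b)))
  isLink_symm := by
    rintro (e | ⟨e, b⟩) _ <;> refine ⟨fun u v h => ?_⟩
    · obtain ⟨h1, x, y, h2, h3, h4⟩ := h
      exact ⟨h1, y, x, h2.symm, h4, h3⟩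
    · obtain ⟨h1, h2, h3⟩ := h
      exact ⟨h1, h2, by tauto⟩
  eq_or_eq_of_isLink_of_isLink := by
    rintro (e | ⟨e, b⟩) u v w z h h'
    · obtain ⟨-, x, y, h2, rfl, rfl⟩ := h
      obtain ⟨-, x', y', h2', rfl, rfl⟩ := h'
      simpa using h2.left_eq_or_eq h2'
    · obtain ⟨-, -, h3⟩ := h
      obtain ⟨-, -, h3'⟩ := h'
      rcases h3 with ⟨rfl, rfl⟩ | ⟨rfl, rfl⟩ <;> rcases h3' with ⟨rfl, rfl⟩ | ⟨rfl, rfl⟩ <;> simp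
  left_mem_of_isLink := by
    rintro (e | ⟨e, b⟩) u v h
    · obtain ⟨-, x, y, h2, rfl, rfl⟩ := h
      exact Or.inl ⟨x, h2.left_mem, rfl⟩
    · obtain ⟨h1, h2, h3⟩ := h
      rcases h3 with ⟨rfl, rfl⟩ | ⟨rfl, rfl⟩
      · refine Or.inl ⟨_, ?_, rfl⟩
        cases b
        · exact (ℓ.isLink e h2).left_mem
        · exact (ℓ.isLink e h2).right_mem
      · exact Or.inr ⟨e, ⟨h1, h2⟩, rfl⟩

/-- The edge of the original graph of which an edge of a subdivision is (a half of). -/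
def parent : β ⊕ β × Bool → β := Sum.elim id Prod.fst

/-- `σ'` is a signature of the subdivided graph that comes from `σ`: undivided edges keep their
sign, and the signs of the two halves of a subdivided edge multiply to the sign of the edge. -/
def IsSubdividedSignature (G : Graph α β) (S : Set β) (σ : β → ℤˣ) (σ' : β ⊕ β × Bool → ℤˣ) :
    Prop :=
  ∀ e ∈ E(G), (e ∉ S → σ' (.inl e) = σ e) ∧
    (e ∈ S → σ' (.inr (e, false)) * σ' (.inr (e, true)) = σ e)

/-- `S` consists of exactly one edge of every negative special cycle and of every negative
ordinary cycle of even length in the list. -/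
def IsSubdivisionChoice (L : List (Graph α β × CycleType)) (S : Set β) : Prop :=
  let M := {C : Graph α β | (C, .negativeSpecial) ∈ L ∨
    ((C, .negativeOrdinary) ∈ L ∧ Even (length C))}
  (∀ C ∈ M, ∃! e, e ∈ S ∧ e ∈ E(C)) ∧ ∀ e ∈ S, ∃ C ∈ M, e ∈ E(C)

/-- An orientation of the signed graph `(G, σ)`: every half-edge is directed away from its end
(`1`) or towards it (`-1`). The two directions of a positive edge differ, those of a negative
edge agree. -/
structure Orientation (G : Graph α β) (σ : β → ℤˣ) extends EndLabelling G where
  dir : β → Bool → ℤˣ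
  dir_mul_dir : ∀ e ∈ E(G), dir e false * dir e true = - σ e

/-- The boundary of `f` at `v`: the sum over the half-edges directed away from `v` minus the sum
over those directed towards `v`. -/
noncomputable def boundary {A : Type*} [AddCommGroup A] {G : Graph α β} {σ : β → ℤˣ}
    (O : Orientation G σ) (f : β → A) (v : α) : A :=
  ∑ᶠ (h : β × Bool) (_ : h.1 ∈ E(G) ∧ O.tip h.1 h.2 = v), (O.dir h.1 h.2 : ℤ) • f h.1

def IsPreflow {A : Type*} [AddCommGroup A] {G : Graph α β} {σ : β → ℤˣ}
    (O : Orientation G σ) (f : β → A) : Prop :=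
  ∀ v ∈ V(G), boundary O f v ≠ 0 ↔ (degree G v = 1 ∨ degree G v = 2)

end CycleSelection

/-! Orientation and subdivision can be removed first. Describe a flow by the value `c e b` of each
half-edge, counted as directed away from its end. An undivided edge then forces `c e true = -σ e * c
e false`. A subdivided edge carries a new vertex of degree two, whose boundary must be nonzero, and
this says exactly that the same equation fails. A preflow of the subdivided graph thus becomes an
`IsHalfPreflow` on the original graph, whatever the orientation (`IsHalfPreflow.exists_isPreflow`).

The algorithm is then run backwards from the empty graph: a preflow of `R - V(C)` is extended to `R`
for each selected `C` (`Round.exists_halfPreflow`). The edges outside `C` that meet `V(C)` can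
always be given nonzero values that repair the boundaries outside `C`, because degrees are at most
three (`IsHalfPreflow.exists_off`). It remains to choose the values on `C`, and this depends on its
type.

A negative special cycle may contain zeros, and over `ZMod 3` every boundary is attained on a
negative cycle (`IsHalfPreflowOff.exists_of_special`).

On a positive cycle there is one linear obstruction. Two places where only the absolute value of the
boundary matters are enough to meet it, since `±p ± q` takes all values in `ZMod 3` for nonzero `p`,
`q`. A vertex of degree two is such a place. A vertex of degree three whose third edge leaves the
leaf-block is another, since the preflow beyond that edge may be negated as a whole
(`IsHalfPreflowOff.exists_of_two_free`, `IsHalfPreflowOff.exists_of_bridge`).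

A negative ordinary cycle has odd length after subdivision, and at most one vertex of degree three
in `R`. It has a nowhere-zero solution in which both half-edges at each vertex carry the same value,
and one global sign adapts this to the single outer edge (`IsHalfPreflowOff.exists_of_ordinary`).

A fish receives an explicit preflow that vanishes only on its distinguished edge
(`exists_halfPreflow_of_fish`). A single vertex of degree at most one needs no values of its own. -/

namespace CycleSelection

open scoped Classical

variable {α β : Type*}

/-! ### Half-edge sums and degrees. -/

/-- `t` lists the two ends of every edge of `K`. -/
def Tips (K : Graph α β) (t : β → Bool → α) : Prop :=
  ∀ e ∈ E(K), K.IsLink e (t e false) (t e true)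

lemma Tips.mono {K G : Graph α β} {t : β → Bool → α} (h : Tips G t) (hK : K ≤ G) : Tips K t :=
  fun e he => (Graph.IsSubgraph.isLink_iff hK he).2 (h e (hK.edgeSet_mono he))

lemma Tips.mem {K : Graph α β} {t : β → Bool → α} (h : Tips K t) {e : β} (he : e ∈ E(K))
    (b : Bool) : t e b ∈ V(K) := by
  cases b
  · exact (h e he).left_mem
  · exact (h e he).right_mem

lemma Tips.isLink {K : Graph α β} {t : β → Bool → α} (h : Tips K t) {e : β} (he : e ∈ E(K))
    (b : Bool) : K.IsLink e (t e b) (t e !b) := by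
  cases b
  · exact h e he
  · exact (h e he).symm

lemma Tips.exists_of_isLink {K : Graph α β} {t : β → Bool → α} (h : Tips K t) {e : β} {x y : α}
    (hl : K.IsLink e x y) : ∃ b, t e b = x ∧ t e (!b) = y := by
  rcases hl.eq_and_eq_or_eq_and_eq (h e hl.edge_mem) with ⟨rfl, rfl⟩ | ⟨rfl, rfl⟩
  · exact ⟨false, rfl, rfl⟩
  · exact ⟨true, rfl, rfl⟩

section Sums

variable [Fintype β] {A : Type*}

/-- The sum of `c` over the half-edges at `v` that belong to edges in `F`. -/
noncomputable def halfSum [AddCommMonoid A] (t : β → Bool → α) (F : Set β) (c : β → Bool → A)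
    (v : α) : A :=
  ∑ e : β, ∑ b : Bool, if e ∈ F ∧ t e b = v then c e b else 0

lemma halfSum_congr [AddCommMonoid A] {t : β → Bool → α} {F F' : Set β} {c c' : β → Bool → A}
    {v : α} (hF : ∀ e b, t e b = v → (e ∈ F ↔ e ∈ F'))
    (h : ∀ e ∈ F, ∀ b, t e b = v → c e b = c' e b) :
    halfSum t F c v = halfSum t F' c' v := by
  refine Finset.sum_congr rfl fun e _ => Finset.sum_congr rfl fun b _ => ?_
  by_cases hv : t e b = v
  · by_cases he : e ∈ F
    · rw [if_pos ⟨he, hv⟩, if_pos ⟨(hF e b hv).1 he, hv⟩, h e he b hv]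
    · rw [if_neg fun h => he h.1, if_neg fun h => he ((hF e b hv).2 h.1)]
  · rw [if_neg fun h => hv h.2, if_neg fun h => hv h.2]

lemma halfSum_union [AddCommMonoid A] {t : β → Bool → α} {F F' : Set β} (hd : Disjoint F F')
    (c : β → Bool → A) (v : α) :
    halfSum t (F ∪ F') c v = halfSum t F c v + halfSum t F' c v := by
  simp only [halfSum, ← Finset.sum_add_distrib]
  refine Finset.sum_congr rfl fun e _ => Finset.sum_congr rfl fun b _ => ?_
  have : e ∈ F → e ∉ F' := fun h h' => Set.disjoint_left.1 hd h h'
  by_cases h1 : e ∈ F <;> by_cases h2 : e ∈ F' <;> simp_all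

/-- With equal values on all half-edges at a vertex, the boundary depends only on their number
modulo 3; most boundary computations are reduced to this. -/
lemma halfSum_eq_nsmul [AddCommMonoid A] {t : β → Bool → α} {F : Set β} {c : β → Bool → A}
    {v : α} {a : A} (h : ∀ e ∈ F, ∀ b, t e b = v → c e b = a) :
    halfSum t F c v = halfSum t F (fun _ _ => (1 : ℕ)) v • a := by
  simp only [halfSum, Finset.sum_smul]
  refine Finset.sum_congr rfl fun e _ => Finset.sum_congr rfl fun b _ => ?_
  split_ifs with h1
  · rw [h e h1.1 b h1.2, one_smul]
  · rw [zero_smul]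

lemma halfSum_eq_zero [AddCommMonoid A] {t : β → Bool → α} {F : Set β} {c : β → Bool → A}
    {v : α} (h : ∀ e ∈ F, ∀ b, t e b = v → c e b = 0) : halfSum t F c v = 0 := by
  rw [halfSum_eq_nsmul h, smul_zero]

lemma halfSum_neg [AddCommGroup A] (t : β → Bool → α) (F : Set β) (c : β → Bool → A) (v : α) :
    halfSum t F (fun e b => - c e b) v = - halfSum t F c v := by
  simp only [halfSum, ← Finset.sum_neg_distrib]
  refine Finset.sum_congr rfl fun e _ => Finset.sum_congr rfl fun b _ => ?_
  split_ifs <;> simp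

lemma halfSum_add [AddCommMonoid A] (t : β → Bool → α) (F : Set β) (c c' : β → Bool → A)
    (v : α) :
    halfSum t F (fun e b => c e b + c' e b) v = halfSum t F c v + halfSum t F c' v := by
  simp only [halfSum, ← Finset.sum_add_distrib]
  refine Finset.sum_congr rfl fun e _ => Finset.sum_congr rfl fun b _ => ?_
  split_ifs <;> simp

/-- Double counting: the pairing of a vertex function with a boundary, regrouped by edges. The
constant 1 gives the handshake identity, an indicator gives the parity of cuts, and a general `l`
identifies the functionals that vanish on all boundaries. -/
lemma sum_mul_halfSum [Fintype α] [CommSemiring A] (t : β → Bool → α) (F : Set β) (c : β → Bool → A)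
    (l : α → A) :
    ∑ v, l v * halfSum t F c v =
      ∑ e : β, if e ∈ F then l (t e false) * c e false + l (t e true) * c e true else 0 := by
  simp only [halfSum, Finset.mul_sum]
  rw [Finset.sum_comm]
  refine Finset.sum_congr rfl fun e _ => ?_
  rw [Finset.sum_comm]
  by_cases he : e ∈ F <;> simp [he, add_comm]

/-- A loop at `v` has both half-edges at `v`, which accounts for the second summand in the
definition of the degree. -/
lemma degree_eq_halfSum {K : Graph α β} {t : β → Bool → α} (ht : Tips K t) (v : α) :
    degree K v = halfSum t E(K) (fun _ _ => 1) v := by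
  have h1 : (K.incidenceSet v).ncard = ∑ e : β, if K.Inc e v then 1 else 0 := by
    rw [Finset.sum_boole, Nat.cast_id, ← Set.ncard_coe_finset]
    congr 1; ext e; simp
  have h2 : (K.loopSet v).ncard = ∑ e : β, if K.IsLoopAt e v then 1 else 0 := by
    rw [Finset.sum_boole, Nat.cast_id, ← Set.ncard_coe_finset]
    congr 1; ext e; simp
  rw [degree, h1, h2, ← Finset.sum_add_distrib]
  refine Finset.sum_congr rfl fun e _ => ?_
  by_cases he : e ∈ E(K)
  · have hl := ht e he
    have hi : K.Inc e v ↔ t e false = v ∨ t e true = v := by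
      constructor
      · intro h; exact (h.eq_or_eq_of_isLink hl).imp Eq.symm Eq.symm
      · rintro (rfl | rfl)
        exacts [hl.inc_left, hl.inc_right]
    have hlo : K.IsLoopAt e v ↔ t e false = v ∧ t e true = v := by
      rw [← Graph.isLink_self_iff, hl.isLink_iff]; tauto
    simp only [hi, hlo, Fintype.sum_bool, he, true_and]
    by_cases ha : t e false = v <;> by_cases hb : t e true = v <;> simp [ha, hb]
  · simp [he, ← Graph.isLink_self_iff]

lemma halfSum_eq_degree_nsmul [AddCommMonoid A] {K : Graph α β} {t : β → Bool → α}
    (ht : Tips K t) {c : β → Bool → A} {v : α} {a : A}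
    (h : ∀ e ∈ E(K), ∀ b, t e b = v → c e b = a) : halfSum t E(K) c v = degree K v • a := by
  rw [halfSum_eq_nsmul h, degree_eq_halfSum ht]

lemma halfSum_of_notMem [AddCommMonoid A] {K : Graph α β} {t : β → Bool → α} (ht : Tips K t)
    (c : β → Bool → A) {v : α} (hv : v ∉ V(K)) : halfSum t E(K) c v = 0 :=
  halfSum_eq_zero fun _ he b hb => (hv (hb ▸ ht.mem he b)).elim

lemma degree_of_notMem {K : Graph α β} {t : β → Bool → α} (ht : Tips K t) {v : α}
    (hv : v ∉ V(K)) : degree K v = 0 := by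
  rw [degree_eq_halfSum ht, halfSum_of_notMem ht _ hv]

lemma halfSum_one_mono {t : β → Bool → α} {F F' : Set β} (h : F ⊆ F') (v : α) :
    halfSum t F (fun _ _ => (1 : ℕ)) v ≤ halfSum t F' (fun _ _ => (1 : ℕ)) v := by
  rw [← Set.union_sdiff_cancel h, halfSum_union Set.disjoint_sdiff_right]
  exact Nat.le_add_right _ _

lemma degree_mono {K G : Graph α β} {t : β → Bool → α} (ht : Tips G t) (h : K ≤ G) (v : α) :
    degree K v ≤ degree G v := by
  rw [degree_eq_halfSum ht, degree_eq_halfSum (ht.mono h)]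
  exact halfSum_one_mono h.edgeSet_mono v

lemma halfSum_one_pos {t : β → Bool → α} {F : Set β} {e : β} (he : e ∈ F) {b : Bool} {v : α}
    (hb : t e b = v) : 0 < halfSum t F (fun _ _ => (1 : ℕ)) v := by
  refine Finset.sum_pos' (fun _ _ => Nat.zero_le _) ⟨e, Finset.mem_univ _, ?_⟩
  refine Finset.sum_pos' (fun _ _ => Nat.zero_le _) ⟨b, Finset.mem_univ _, ?_⟩
  rw [if_pos ⟨he, hb⟩]; exact one_pos

lemma exists_of_halfSum_ne_zero [AddCommMonoid A] {t : β → Bool → α} {F : Set β}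
    {c : β → Bool → A} {v : α} (h : halfSum t F c v ≠ 0) : ∃ e ∈ F, ∃ b, t e b = v := by
  by_contra! hc
  exact h (halfSum_eq_zero fun e he b hb => (hc e he b hb).elim)

/-- Edges on which a graph exceeds a subgraph account for the difference of the degrees. -/
lemma degree_add_halfSum_diff {K G : Graph α β} {t : β → Bool → α} (ht : Tips G t) (h : K ≤ G)
    (v : α) : degree K v + halfSum t (E(G) \ E(K)) (fun _ _ => 1) v = degree G v := by
  rw [degree_eq_halfSum ht, degree_eq_halfSum (ht.mono h),
    ← halfSum_union Set.disjoint_sdiff_right, Set.union_sdiff_cancel h.edgeSet_mono]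

/-- If the degrees in `K` and `G` agree at `v`, then `K` contains all the edges of `G` at `v`. -/
lemma mem_of_degree_le {K G : Graph α β} {t : β → Bool → α} (ht : Tips G t) (h : K ≤ G)
    {v : α} (hd : degree G v ≤ degree K v) {e : β} (he : e ∈ E(G)) {b : Bool} (hb : t e b = v) :
    e ∈ E(K) := by
  by_contra hn
  have h1 := degree_add_halfSum_diff ht h v
  have h2 := halfSum_one_pos (F := E(G) \ E(K)) ⟨he, hn⟩ hb
  omega

/-- A half-edge together with the remaining ones exhausts the degree. -/
lemma exists_halfSum_one_eq {t : β → Bool → α} {F : Set β} {v : α}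
    (h : halfSum t F (fun _ _ => (1 : ℕ)) v = 1) :
    ∃ e ∈ F, ∃ b, t e b = v ∧ ∀ e' ∈ F, ∀ b', t e' b' = v → e' = e ∧ b' = b := by
  obtain ⟨e, he, b, hb⟩ := exists_of_halfSum_ne_zero (h.trans_ne one_ne_zero)
  refine ⟨e, he, b, hb, fun e' he' b' hb' => ?_⟩
  by_contra hc
  have h2 : ∑ p : β × Bool, (if p.1 ∈ F ∧ t p.1 p.2 = v then 1 else 0) = 1 := by
    rw [Fintype.sum_prod_type]; exact h
  rw [Finset.sum_boole, Nat.cast_id, Finset.card_eq_one] at h2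
  obtain ⟨p, hp⟩ := h2
  have m1 : (e, b) ∈ ({p} : Finset (β × Bool)) := by rw [← hp]; simp [he, hb]
  have m2 : (e', b') ∈ ({p} : Finset (β × Bool)) := by rw [← hp]; simp [he', hb']
  rw [Finset.mem_singleton] at m1 m2
  have := m2.trans m1.symm
  simp only [Prod.mk.injEq] at this
  exact hc this

/-- The product of the end values over the edges. -/
lemma prod_tips_eq [Fintype α] {K : Graph α β} {t : β → Bool → α} (ht : Tips K t) (s : α → ℤˣ) :
    (∏ e : β, if e ∈ E(K) then s (t e false) * s (t e true) else 1) = ∏ v, s v ^ degree K v := by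
  simp only [degree_eq_halfSum ht, halfSum, ← Finset.prod_pow_eq_pow_sum]
  rw [Finset.prod_comm]
  refine Finset.prod_congr rfl fun e _ => ?_
  rw [Finset.prod_comm]
  by_cases he : e ∈ E(K) <;> simp [he, mul_comm, pow_ite]

lemma finprod_mem_eq_prod_ite {M : Type*} [CommMonoid M] (F : Set β) (f : β → M) :
    ∏ᶠ e ∈ F, f e = ∏ e : β, if e ∈ F then f e else 1 := by
  rw [finprod_mem_eq_finite_toFinset_prod _ F.toFinite, ← Finset.prod_filter]
  congr 1; ext e; simp

lemma sum_degree [Fintype α] {K : Graph α β} {t : β → Bool → α} (ht : Tips K t) :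
    ∑ v, degree K v = 2 * E(K).ncard := by
  have := sum_mul_halfSum t E(K) (fun _ _ => (1 : ℕ)) (fun _ => 1)
  simp only [one_mul, ← degree_eq_halfSum ht] at this
  rw [this, Finset.sum_ite, Finset.sum_const_zero, add_zero, Finset.sum_const, smul_eq_mul,
    ← Set.ncard_coe_finset, mul_comm]
  congr 2; ext e; simp

/-- If all the degrees in a set of vertices are even, then no single edge of the graph leaves the
set. -/
lemma exists_other_crossing [Fintype α] {t : β → Bool → α} {F : Set β} {X : Set α}
    (hX : ∀ v ∈ X, Even (halfSum t F (fun _ _ => (1 : ℕ)) v)) {e₀ : β} {b₀ : Bool} (he₀ : e₀ ∈ F)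
    (hin : t e₀ b₀ ∈ X) (hout : t e₀ (!b₀) ∉ X) :
    ∃ e ∈ F, e ≠ e₀ ∧ ∃ b, t e b ∈ X ∧ t e (!b) ∉ X := by
  by_contra! hc
  -- Pair the degrees modulo 2 with the indicator of `X`. The vertex side vanishes, while on the
  -- edge side exactly the crossing edges contribute 1, so `e₀` cannot be the only one.
  have key := sum_mul_halfSum t F (fun _ _ => (1 : ZMod 2)) (fun v => if v ∈ X then 1 else 0)
  have hl : ∑ v, (if v ∈ X then (1 : ZMod 2) else 0) * halfSum t F (fun _ _ => (1 : ZMod 2)) v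
      = 0 := by
    refine Finset.sum_eq_zero fun v _ => ?_
    by_cases hv : v ∈ X
    · rw [if_pos hv, one_mul, halfSum_eq_nsmul (a := 1) fun _ _ _ _ => rfl]
      obtain ⟨k, hk⟩ := hX v hv
      rw [hk, nsmul_one, Nat.cast_add]
      exact CharTwo.add_self_eq_zero _
    · rw [if_neg hv, zero_mul]
  rw [hl, Finset.sum_eq_single e₀, if_pos he₀] at key
  · cases b₀
    · rw [Bool.not_false] at hout
      rw [if_pos hin, if_neg hout] at key
      exact absurd key (by decide)
    · rw [Bool.not_true] at hout
      rw [if_pos hin, if_neg hout] at key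
      exact absurd key (by decide)
  · intro e _ hne
    by_cases he : e ∈ F
    · have h1 := hc e he hne false
      have h2 := hc e he hne true
      rw [Bool.not_false] at h1
      rw [Bool.not_true] at h2
      rw [if_pos he]
      by_cases ha : t e false ∈ X
      · rw [if_pos ha, if_pos (h1 ha)]; decide
      · rw [if_neg ha, if_neg fun hb => ha (h2 hb)]; decide
    · rw [if_neg he]
  · exact fun h => (h (Finset.mem_univ _)).elim

end Sums

end CycleSelection

/-! ### Linear algebra over `ZMod 3`: which boundaries a signed graph attains. -/

namespace CycleSelection

open scoped Classical

variable {α β : Type*}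

/-- A sign as an element of `ZMod 3`. -/
def sg (u : ℤˣ) : ZMod 3 := ((u : ℤ) : ZMod 3)

lemma sg_one : sg 1 = 1 := by simp [sg]

lemma sg_neg (u : ℤˣ) : sg (-u) = - sg u := by simp [sg]

lemma sg_mul (u w : ℤˣ) : sg (u * w) = sg u * sg w := by simp [sg]

lemma sg_mul_self (u : ℤˣ) : sg u * sg u = 1 := by
  rw [← sg_mul, Int.units_mul_self, sg_one]

lemma sg_ne_zero (u : ℤˣ) : sg u ≠ 0 := fun h => by
  have := sg_mul_self u
  rw [h] at this
  exact absurd this (by decide)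

lemma sg_injective : Function.Injective sg := by
  intro u w h
  rcases Int.units_eq_one_or u with rfl | rfl <;> rcases Int.units_eq_one_or w with rfl | rfl <;>
    first
    | rfl
    | exact absurd h (by simp only [sg_neg, sg_one]; decide)

/-- The nonzero elements of `ZMod 3` are the signs; this turns nowhere-zero solutions of linear
equations into sign functions. -/
lemma exists_sg_eq {x : ZMod 3} (hx : x ≠ 0) : ∃ u, sg u = x := by
  have : x = 0 ∨ x = 1 ∨ x = -1 := by revert x; decide
  rcases this with h | h | h
  · exact (hx h).elim
  · exact ⟨1, by rw [sg_one, h]⟩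
  · exact ⟨-1, by rw [sg_neg, sg_one, h]⟩

lemma Connected.induction {K : Graph α β} (hK : Connected K) {P : α → Prop}
    (h : ∀ x y, K.Adj x y → P x → P y) {x : α} (hx : x ∈ V(K)) (hP : P x) :
    ∀ y ∈ V(K), P y := by
  intro y hy
  have hr := hK.2 x hx y hy
  unfold Reach at hr
  induction hr with
  | refl => exact hP
  | tail _ hbc ih => exact h _ _ hbc (ih hbc.left_mem)

/-- A connected graph has an edge leaving any proper set of its vertices. -/
lemma Connected.exists_crossing {K : Graph α β} {t : β → Bool → α} (ht : Tips K t)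
    (hK : Connected K) {X : Set α} {x y : α} (hx : x ∈ V(K)) (hy : y ∈ V(K)) (hxX : x ∈ X)
    (hyX : y ∉ X) : ∃ e ∈ E(K), ∃ b, t e b ∈ X ∧ t e (!b) ∉ X := by
  by_contra! hc
  refine hyX (hK.induction (P := fun v => v ∈ X) ?_ hx hxX y hy)
  rintro u v ⟨e, he⟩ hu
  obtain ⟨b, rfl, rfl⟩ := ht.exists_of_isLink he
  exact hc e he.edge_mem b hu

/-- `l` vanishes on the boundaries of all functions on the edges of `K`, where the value on the
second half of an edge `e` is `τ e` times the value on the first half. -/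
def IsDual (K : Graph α β) (t : β → Bool → α) (τ : β → ℤˣ) (l : α → ZMod 3) : Prop :=
  ∀ e ∈ E(K), l (t e false) + sg (τ e) * l (t e true) = 0

lemma IsDual.sub {K : Graph α β} {t : β → Bool → α} {τ : β → ℤˣ} {l m : α → ZMod 3}
    (hl : IsDual K t τ l) (hm : IsDual K t τ m) (a : ZMod 3) :
    IsDual K t τ (fun v => m v - a * l v) := fun e he => by
  linear_combination hm e he - a * hl e he

/-- The factor `sg (τ e)` is invertible, so a zero propagates along every edge. On a connected graph
the duals therefore form a space of dimension at most one. -/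
lemma IsDual.eq_zero {K : Graph α β} {t : β → Bool → α} {τ : β → ℤˣ} {l : α → ZMod 3}
    (ht : Tips K t) (hK : Connected K) (hl : IsDual K t τ l) {x : α} (hx : x ∈ V(K))
    (h0 : l x = 0) : ∀ v ∈ V(K), l v = 0 := by
  refine hK.induction ?_ hx h0
  rintro u v ⟨e, he⟩ hu
  obtain ⟨b, rfl, rfl⟩ := ht.exists_of_isLink he
  have h := hl e he.edge_mem
  cases b
  · rw [hu, zero_add] at h
    exact (mul_eq_zero.1 h).resolve_left (sg_ne_zero _)
  · rw [hu, mul_zero, add_zero] at h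
    exact h

/-- A dual that vanishes nowhere, normalised to signs. -/
lemma IsDual.exists_signs {K : Graph α β} {t : β → Bool → α} {τ : β → ℤˣ} {l : α → ZMod 3}
    (ht : Tips K t) (hl : IsDual K t τ l) (h : ∀ v ∈ V(K), l v ≠ 0) :
    ∃ s : α → ℤˣ, ∀ e ∈ E(K), s (t e false) * s (t e true) = - τ e := by
  have : ∀ v, ∃ s : ℤˣ, v ∈ V(K) → sg s = l v := fun v => by
    by_cases hv : v ∈ V(K)
    · exact (exists_sg_eq (h v hv)).imp fun _ hs _ => hs
    · exact ⟨1, fun hv' => (hv hv').elim⟩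
  choose s hs using this
  refine ⟨s, fun e he => sg_injective ?_⟩
  have h1 := hl e he
  rw [← hs _ (ht.mem he _), ← hs _ (ht.mem he _)] at h1
  rw [sg_mul, sg_neg]
  linear_combination sg (s (t e true)) * h1 - sg (τ e) * sg_mul_self (s (t e true))

lemma sign_eq_prod [Fintype β] (σ : β → ℤˣ) (K : Graph α β) :
    sign σ K = ∏ e : β, if e ∈ E(K) then σ e else 1 := finprod_mem_eq_prod_ite _ _

section Solve

variable [Fintype α] [Fintype β]

/-- Fredholm alternative: a vector lies in the range of the boundary map if it is annihilated by
every functional that annihilates the range, and these functionals are the duals. -/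
lemma exists_halfSum_eq {K : Graph α β} {t : β → Bool → α} (τ : β → ℤˣ)
    (D : α → ZMod 3)
    (h : ∀ l, IsDual K t τ l → ∑ v, (if v ∈ V(K) then l v * D v else 0) = 0) :
    ∃ c : β → Bool → ZMod 3, (∀ e, c e true = sg (τ e) * c e false) ∧
      ∀ v ∈ V(K), halfSum t E(K) c v = D v := by
  let ext : (β → ZMod 3) → β → Bool → ZMod 3 := fun f e b => if b then sg (τ e) * f e else f e
  have ext_add : ∀ f g, ext (f + g) = fun e b => ext f e b + ext g e b := by
    intro f g; funext e b; cases b <;> simp [ext, mul_add]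
  have ext_smul : ∀ (a : ZMod 3) f e b, ext (a • f) e b = a * ext f e b := by
    intro a f e b; cases b <;> simp [ext, mul_left_comm]
  let Φ : (β → ZMod 3) →ₗ[ZMod 3] (α → ZMod 3) :=
    { toFun := fun f v => halfSum t E(K) (ext f) v
      map_add' := fun f g => by
        funext v; simp only [ext_add, halfSum_add, Pi.add_apply]
      map_smul' := fun a f => by
        funext v
        simp only [halfSum, ext_smul, RingHom.id_apply, Pi.smul_apply, smul_eq_mul, Finset.mul_sum,
          mul_ite, mul_zero] }
  let D' : α → ZMod 3 := fun v => if v ∈ V(K) then D v else 0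
  have hD : D' ∈ LinearMap.range Φ := by
    by_contra hn
    -- A functional that kills the range but not `D'`. Its coordinates `f (Pi.single v 1)` form a
    -- dual, because it kills the boundary of every single edge.
    obtain ⟨f, hf, hker⟩ := Submodule.exists_le_ker_of_notMem hn
    apply hf
    rw [LinearMap.pi_apply_eq_sum_univ f D']
    have hdual : IsDual K t τ (fun v => f (Pi.single v 1)) := by
      intro e he
      have h0 : f (Φ (Pi.single e 1)) = 0 := hker ⟨_, rfl⟩
      rw [LinearMap.pi_apply_eq_sum_univ f] at h0
      have h1 := sum_mul_halfSum t E(K) (ext (Pi.single e 1)) (fun v => f (Pi.single v 1))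
      rw [Finset.sum_eq_single e, if_pos he] at h1
      · simp only [ext, Pi.single_eq_same, if_true, mul_one, Bool.false_eq_true, if_false] at h1
        rw [mul_comm (sg _), ← h1, ← h0]
        refine Finset.sum_congr rfl fun v _ => ?_
        rw [smul_eq_mul, mul_comm]
        congr 2
        funext w
        simp [Pi.single_apply, eq_comm]
      · intro e' _ hne
        have : ∀ b, ext (Pi.single e 1) e' b = 0 := by
          intro b; cases b <;> simp [ext, hne]
        rw [this, this]; simp
      · exact fun h => (h (Finset.mem_univ _)).elim
    refine (Finset.sum_congr rfl fun v _ => ?_).trans (h _ hdual)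
    have : (fun j => if v = j then (1 : ZMod 3) else 0) = Pi.single v 1 := by
      funext w; simp [Pi.single_apply, eq_comm]
    rw [this, smul_eq_mul]
    by_cases hv : v ∈ V(K) <;> simp [D', hv, mul_comm]
  obtain ⟨f, hf⟩ := hD
  refine ⟨ext f, fun e => by simp [ext], fun v hv => ?_⟩
  exact (congrFun hf v).trans (if_pos hv)

/-- Every boundary can be attained on a connected graph without nontrivial duals. -/
lemma exists_halfSum_eq_of_not_dual {K : Graph α β} {t : β → Bool → α}
    (τ : β → ℤˣ) (D : α → ZMod 3) (h : ∀ l, IsDual K t τ l → ∀ v ∈ V(K), l v = 0) :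
    ∃ c : β → Bool → ZMod 3, (∀ e, c e true = sg (τ e) * c e false) ∧
      ∀ v ∈ V(K), halfSum t E(K) c v = D v := by
  refine exists_halfSum_eq τ D fun l hl => Finset.sum_eq_zero fun v _ => ?_
  split_ifs with hv
  · rw [h l hl v hv, zero_mul]
  · rfl

/-- The boundary can be prescribed on a connected graph up to the signs at two vertices. -/
lemma exists_halfSum_eq_up_to_signs {K : Graph α β} {t : β → Bool → α} (ht : Tips K t)
    (hK : Connected K) (τ : β → ℤˣ) (D : α → ZMod 3) {x y : α} (hx : x ∈ V(K)) (hy : y ∈ V(K))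
    (hxy : x ≠ y) (hDx : D x ≠ 0) (hDy : D y ≠ 0) :
    ∃ (a b : ℤˣ) (c : β → Bool → ZMod 3), (∀ e, c e true = sg (τ e) * c e false) ∧
      halfSum t E(K) c x = sg a * D x ∧ halfSum t E(K) c y = sg b * D y ∧
      ∀ v ∈ V(K), v ≠ x → v ≠ y → halfSum t E(K) c v = D v := by
  by_cases hd : ∃ l, IsDual K t τ l ∧ l x ≠ 0
  · obtain ⟨l, hl, hlx⟩ := hd
    have hly : l y ≠ 0 := fun h0 => hlx (hl.eq_zero ht hK hy h0 x hx)
    -- For nonzero `p` and `q`, the sums `±p ± q` cover all of `ZMod 3`; hence signs at two vertices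
    -- meet any single linear condition.
    have hchoice : ∀ r p q : ZMod 3, p ≠ 0 → q ≠ 0 → ∃ a b : ZMod 3, a ≠ 0 ∧ b ≠ 0 ∧
        r + a * p + b * q = 0 := by decide
    obtain ⟨a, b, ha, hb, hab⟩ := hchoice
      (∑ v ∈ (Finset.univ.erase x).erase y, if v ∈ V(K) then l v * D v else 0)
      (l x * D x) (l y * D y) (mul_ne_zero hlx hDx) (mul_ne_zero hly hDy)
    obtain ⟨a, rfl⟩ := exists_sg_eq ha
    obtain ⟨b, rfl⟩ := exists_sg_eq hb
    let D' : α → ZMod 3 := fun v => if v = x then sg a * D x else if v = y then sg b * D y else D v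
    have hsum : ∑ v, (if v ∈ V(K) then l v * D' v else 0) = 0 := by
      rw [← Finset.add_sum_erase _ _ (Finset.mem_univ x),
        ← Finset.add_sum_erase _ _ (Finset.mem_erase.2 ⟨hxy.symm, Finset.mem_univ y⟩)]
      refine Eq.trans ?_ hab
      have : ∑ v ∈ (Finset.univ.erase x).erase y, (if v ∈ V(K) then l v * D' v else 0) =
          ∑ v ∈ (Finset.univ.erase x).erase y, (if v ∈ V(K) then l v * D v else 0) := by
        refine Finset.sum_congr rfl fun v hv => ?_
        simp only [Finset.mem_erase] at hv
        simp [D', hv.1, hv.2.1]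
      rw [this]
      simp only [D', hx, hy, if_true, hxy.symm, if_false]
      ring
    obtain ⟨c, hc, hcD⟩ := exists_halfSum_eq τ D' fun m hm => by
      -- Subtracting the multiple of `l` that agrees with `m` at `x` leaves a dual with a zero, so
      -- every dual is a multiple of `l` and one orthogonality condition is enough.
      have hz := (hl.sub hm (m x / l x)).eq_zero ht hK hx (by field_simp; ring)
      have : ∀ v, (if v ∈ V(K) then m v * D' v else 0) =
          m x / l x * (if v ∈ V(K) then l v * D' v else 0) := by
        intro v
        split_ifs with hv
        · rw [sub_eq_zero.1 (hz v hv)]; ring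
        · rw [mul_zero]
      simp only [this]
      rw [← Finset.mul_sum, hsum, mul_zero]
    refine ⟨a, b, c, hc, ?_, ?_, fun v hv h1 h2 => ?_⟩
    · rw [hcD x hx]; simp [D']
    · rw [hcD y hy]; simp [D', hxy.symm]
    · rw [hcD v hv]; simp [D', h1, h2]
  · push Not at hd
    obtain ⟨c, hc, hcD⟩ := exists_halfSum_eq_of_not_dual τ D
      fun l hl => hl.eq_zero ht hK hx (hd l hl)
    exact ⟨1, 1, c, hc, by rw [hcD x hx, sg_one, one_mul], by rw [hcD y hy, sg_one, one_mul],
      fun v hv _ _ => hcD v hv⟩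

/-- A negative cycle has no nontrivial dual, so that every boundary can be attained. -/
lemma IsNegativeCycle.exists_halfSum_eq {K : Graph α β} {t : β → Bool → α} (ht : Tips K t)
    {σ : β → ℤˣ} (hK : IsNegativeCycle σ K) (D : α → ZMod 3) :
    ∃ c : β → Bool → ZMod 3, (∀ e, c e true = sg (- σ e) * c e false) ∧
      ∀ v ∈ V(K), halfSum t E(K) c v = D v := by
  refine exists_halfSum_eq_of_not_dual (fun e => - σ e) D fun l hl v hv => ?_
  by_contra h0
  -- A nonzero dual on a connected graph vanishes nowhere and yields signs with `s (t e false) * s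
  -- (t e true) = σ e`. Around the cycle each vertex sign occurs twice, so the product of the edge
  -- signs would be 1.
  obtain ⟨s, hs⟩ := hl.exists_signs ht fun w hw hw0 => h0 (hl.eq_zero ht hK.1.1 hw hw0 v hv)
  have hp := prod_tips_eq ht s
  have h1 : (∏ e : β, if e ∈ E(K) then s (t e false) * s (t e true) else 1) = -1 := by
    rw [← hK.2, sign_eq_prod]
    refine Finset.prod_congr rfl fun e _ => ?_
    split_ifs with he
    · rw [hs e he, neg_neg]
    · rfl
  have h2 : ∏ v, s v ^ degree K v = 1 := by
    refine Finset.prod_eq_one fun w _ => ?_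
    by_cases hw : w ∈ V(K)
    · rw [hK.1.2 w hw, pow_two, Int.units_mul_self]
    · rw [degree_of_notMem ht hw, pow_zero]
  rw [h1, h2] at hp
  exact absurd hp (by decide)

/-! ### Edge signs of paths and cycles as products of vertex signs. -/

/-- Fewer edges than vertices leave room for a nonzero dual. -/
lemma exists_dual_ne_zero {K : Graph α β} (t : β → Bool → α) (τ : β → ℤˣ) {F : Set β}
    (hlt : F.ncard < V(K).ncard) :
    ∃ l : α → ZMod 3, (∃ v ∈ V(K), l v ≠ 0) ∧ (∀ v ∉ V(K), l v = 0) ∧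
      ∀ e ∈ F, l (t e false) + sg (τ e) * l (t e true) = 0 := by
  let ext : (V(K) → ZMod 3) → α → ZMod 3 := fun f v => if h : v ∈ V(K) then f ⟨v, h⟩ else 0
  let Ψ : (V(K) → ZMod 3) →ₗ[ZMod 3] (F → ZMod 3) :=
    { toFun := fun f e => ext f (t e false) + sg (τ e) * ext f (t e true)
      map_add' := fun f g => by
        funext e
        have : ∀ v, ext (f + g) v = ext f v + ext g v := by
          intro v; by_cases h : v ∈ V(K) <;> simp [ext, h]
        simp only [this, Pi.add_apply]; ring
      map_smul' := fun a f => by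
        funext e
        have : ∀ v, ext (a • f) v = a * ext f v := by
          intro v; by_cases h : v ∈ V(K) <;> simp [ext, h]
        simp only [this, Pi.smul_apply, RingHom.id_apply, smul_eq_mul]; ring }
  have hker : LinearMap.ker Ψ ≠ ⊥ := by
    apply LinearMap.ker_ne_bot_of_finrank_lt
    rw [Module.finrank_fintype_fun_eq_card, Module.finrank_fintype_fun_eq_card,
      ← Nat.card_eq_fintype_card, ← Nat.card_eq_fintype_card, Nat.card_coe_set_eq,
      Nat.card_coe_set_eq]
    exact hlt
  obtain ⟨f, hf, hf0⟩ := (Submodule.ne_bot_iff _).1 hker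
  obtain ⟨v, hv⟩ := Function.ne_iff.1 hf0
  refine ⟨ext f, ⟨v, v.2, by simpa [ext] using hv⟩, fun w hw => by simp [ext, hw], fun e he => ?_⟩
  exact congrFun (LinearMap.mem_ker.1 hf) ⟨e, he⟩

/-- Every signature of a tree is induced by signs at the vertices. -/
lemma exists_signs_of_card_lt {K : Graph α β} {t : β → Bool → α} (ht : Tips K t)
    (hK : Connected K) (hlt : E(K).ncard < V(K).ncard) (τ : β → ℤˣ) :
    ∃ s : α → ℤˣ, ∀ e ∈ E(K), s (t e false) * s (t e true) = τ e := by
  obtain ⟨l, ⟨v, hv, hv0⟩, -, hl⟩ := exists_dual_ne_zero (K := K) t (fun e => - τ e) hlt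
  have hd : IsDual K t (fun e => - τ e) l := hl
  obtain ⟨s, hs⟩ := hd.exists_signs ht fun w hw hw0 => hv0 (hd.eq_zero ht hK hw hw0 v hv)
  exact ⟨s, fun e he => by rw [hs e he, neg_neg]⟩

/-- The number of vertices of a graph, weighted by half their degrees. -/
lemma sum_degree_eq_sum_mem {K : Graph α β} {t : β → Bool → α} (ht : Tips K t) :
    ∑ v ∈ V(K).toFinset, degree K v = 2 * E(K).ncard := by
  rw [← sum_degree ht]
  refine Finset.sum_subset (Finset.subset_univ _) fun v _ hv => ?_
  exact degree_of_notMem ht (by simpa using hv)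

lemma IsCycle.ncard_eq {K : Graph α β} {t : β → Bool → α} (ht : Tips K t) (hK : IsCycle K) :
    E(K).ncard = V(K).ncard := by
  have h := sum_degree_eq_sum_mem ht
  rw [Finset.sum_congr rfl (g := fun _ => 2) (fun v hv => hK.2 v (by simpa using hv)),
    Finset.sum_const, smul_eq_mul, ← Set.ncard_eq_toFinset_card'] at h
  omega

lemma IsPath.ncard_eq {K : Graph α β} {t : β → Bool → α} (ht : Tips K t) {x y : α}
    (hK : IsPath K x y) : V(K).ncard = E(K).ncard + 1 := by
  obtain ⟨-, hx, hy, hxy, hdx, hdy, hd⟩ := hK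
  have h := sum_degree_eq_sum_mem ht
  have hx' : x ∈ V(K).toFinset := by simpa using hx
  have hy' : y ∈ V(K).toFinset.erase x := by simpa [hxy.symm] using hy
  rw [← Finset.add_sum_erase _ _ hx', ← Finset.add_sum_erase _ _ hy',
    Finset.sum_congr rfl (g := fun _ => 2), Finset.sum_const, smul_eq_mul, hdx, hdy] at h
  · have h1 := Finset.card_erase_add_one hx'
    have h2 := Finset.card_erase_add_one hy'
    rw [← Set.ncard_eq_toFinset_card'] at h1
    omega
  · intro v hv
    simp only [Finset.mem_erase, Set.mem_toFinset] at hv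
    exact hd v hv.2.2 hv.2.1 hv.1

/-- If signs at the vertices of a path induce a signature, then the product of the signs at the
ends is the sign of the path. -/
lemma IsPath.mul_eq_sign {K : Graph α β} {t : β → Bool → α} (ht : Tips K t) {x y : α}
    (hK : IsPath K x y) {τ : β → ℤˣ} {s : α → ℤˣ}
    (hs : ∀ e ∈ E(K), s (t e false) * s (t e true) = τ e) : s x * s y = sign τ K := by
  obtain ⟨-, hx, hy, hxy, hdx, hdy, hd⟩ := hK
  have hp := prod_tips_eq ht s
  rw [sign_eq_prod]
  have h1 : (∏ e : β, if e ∈ E(K) then s (t e false) * s (t e true) else 1) =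
      ∏ e : β, if e ∈ E(K) then τ e else 1 := by
    refine Finset.prod_congr rfl fun e _ => ?_
    split_ifs with he
    · exact hs e he
    · rfl
  rw [← h1, hp, ← Finset.mul_prod_erase _ _ (Finset.mem_univ x),
    ← Finset.mul_prod_erase _ _ (Finset.mem_erase.2 ⟨hxy.symm, Finset.mem_univ y⟩), hdx, hdy,
    pow_one, pow_one, Finset.prod_eq_one, mul_one]
  intro v hv
  simp only [Finset.mem_erase, Finset.mem_univ, and_true] at hv
  by_cases hw : v ∈ V(K)
  · rw [hd v hw hv.2 hv.1, pow_two, Int.units_mul_self]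
  · rw [degree_of_notMem ht hw, pow_zero]

/-- Every signature of a path is induced by signs at the vertices, which can be prescribed at the
ends as far as the sign of the path permits. -/
lemma IsPath.exists_signs {K : Graph α β} {t : β → Bool → α} (ht : Tips K t) {x y : α}
    (hK : IsPath K x y) (τ : β → ℤˣ) {a b : ℤˣ} (hab : a * b = sign τ K) :
    ∃ s : α → ℤˣ, (∀ e ∈ E(K), s (t e false) * s (t e true) = τ e) ∧ s x = a ∧ s y = b := by
  obtain ⟨s, hs⟩ := exists_signs_of_card_lt ht hK.1 (by rw [hK.ncard_eq ht]; omega) τ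
  have h1 := hK.mul_eq_sign ht hs
  -- A global factor does not change the products along edges. The factor `a * s x` gives the sign
  -- `a` at `x`, and the sign of the path then forces `b` at `y`.
  refine ⟨fun v => a * s x * s v, fun e he => ?_, ?_, ?_⟩
  · rw [← hs e he]
    calc a * s x * s (t e false) * (a * s x * s (t e true))
        = (a * a) * (s x * s x) * (s (t e false) * s (t e true)) := by ac_rfl
      _ = _ := by rw [Int.units_mul_self, Int.units_mul_self, one_mul, one_mul]
  · beta_reduce
    rw [mul_assoc, Int.units_mul_self, mul_one]
  · beta_reduce
    rw [mul_assoc, h1, ← hab, ← mul_assoc, Int.units_mul_self, one_mul]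

/-- A signature of a cycle whose product is one is induced by signs at the vertices. -/
lemma IsCycle.exists_signs {K : Graph α β} {t : β → Bool → α} (ht : Tips K t) (hK : IsCycle K)
    (τ : β → ℤˣ) (hτ : sign τ K = 1) :
    ∃ s : α → ℤˣ, ∀ e ∈ E(K), s (t e false) * s (t e true) = τ e := by
  have hcard := hK.ncard_eq ht
  obtain ⟨v₀, hv₀⟩ := hK.1.1
  obtain ⟨e₀, he₀⟩ : E(K).Nonempty := by
    rw [← Set.ncard_pos, hcard, Set.ncard_pos]
    exact ⟨v₀, hv₀⟩
  -- A cycle has as many edges as vertices, so omitting `e₀` leaves one equation fewer than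
  -- unknowns.
  obtain ⟨l, ⟨v, hv, hv0⟩, hout, hl⟩ := exists_dual_ne_zero (K := K) t (fun e => - τ e)
    (F := E(K) \ {e₀}) (by
      have := Set.ncard_sdiff_singleton_lt_of_mem he₀
      omega)
  have hiff : ∀ e ∈ E(K), e ≠ e₀ → (l (t e false) = 0 ↔ l (t e true) = 0) := by
    intro e he hne
    have h := hl e ⟨he, hne⟩
    constructor
    · intro h0
      rw [h0, zero_add] at h
      exact (mul_eq_zero.1 h).resolve_left (sg_ne_zero _)
    · intro h0
      rw [h0, mul_zero, add_zero] at h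
      exact h
  -- Only `e₀` can leave the support of `l`. As all degrees are even, no cut consists of a single
  -- edge, so by connectivity the support is all of `V(K)`.
  have hnz : ∀ w ∈ V(K), l w ≠ 0 := by
    by_contra! hc
    obtain ⟨w, hw, hw0⟩ := hc
    obtain ⟨e, he, b, hb1, hb2⟩ := hK.1.exists_crossing ht (X := {u | l u ≠ 0}) hv hw hv0
      (by simpa using hw0)
    simp only [Set.mem_ofPred_eq, not_not] at hb1 hb2
    have hee : e = e₀ := by
      by_contra hne
      have := hiff e he hne
      cases b <;> simp_all
    subst hee
    obtain ⟨e', he', hne, b', h1, h2⟩ := exists_other_crossing (t := t) (F := E(K))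
      (X := {u | l u ≠ 0}) (fun u hu => by
        rw [← degree_eq_halfSum ht, hK.2 u (by by_contra hu'; exact hu (hout u hu'))]
        exact even_two) he hb1 (by simpa using hb2)
    simp only [Set.mem_ofPred_eq, not_not] at h1 h2
    have := hiff e' he' hne
    cases b' <;> simp_all
  have : ∀ v, ∃ s : ℤˣ, v ∈ V(K) → sg s = l v := fun v => by
    by_cases hv : v ∈ V(K)
    · exact (exists_sg_eq (hnz v hv)).imp fun _ hs _ => hs
    · exact ⟨1, fun hv' => (hv hv').elim⟩
  choose s hs using this
  have hs' : ∀ e ∈ E(K), e ≠ e₀ → s (t e false) * s (t e true) = τ e := by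
    intro e he hne
    refine sg_injective ?_
    have h1 := hl e ⟨he, hne⟩
    rw [← hs _ (ht.mem he _), ← hs _ (ht.mem he _), sg_neg] at h1
    rw [sg_mul]
    linear_combination sg (s (t e true)) * h1 + sg (τ e) * sg_mul_self (s (t e true))
  refine ⟨s, fun e he => ?_⟩
  -- The equation at the omitted edge follows from the others, since both products over the whole
  -- cycle are 1.
  by_cases hne : e = e₀
  · subst hne
    have hp := prod_tips_eq ht s
    rw [Finset.prod_eq_one (s := Finset.univ) (f := fun v => s v ^ degree K v) fun w _ => by
      by_cases hw : w ∈ V(K)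
      · rw [hK.2 w hw, pow_two, Int.units_mul_self]
      · rw [degree_of_notMem ht hw, pow_zero]] at hp
    replace hp := hp.trans hτ.symm
    rw [sign_eq_prod,
      ← Finset.mul_prod_erase _ _ (Finset.mem_univ e),
      ← Finset.mul_prod_erase _ (fun e => if e ∈ E(K) then τ e else 1) (Finset.mem_univ e),
      if_pos he, if_pos he] at hp
    have heq : ∀ e' ∈ Finset.univ.erase e,
        (if e' ∈ E(K) then s (t e' false) * s (t e' true) else 1) =
          if e' ∈ E(K) then τ e' else 1 := by
      intro e' he'
      split_ifs with h'
      · exact hs' e' h' (Finset.ne_of_mem_erase he')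
      · rfl
    rw [Finset.prod_congr rfl heq] at hp
    exact mul_right_cancel hp
  · exact hs' e he hne

end Solve

end CycleSelection

/-! ### Extending a preflow over one selected cycle or vertex. -/

namespace CycleSelection

open scoped Classical

variable {α β : Type*}

/-- The value that the boundary of a preflow may have at `v`. -/
noncomputable def targetValue (R : Graph α β) (v : α) : ZMod 3 :=
  if degree R v = 1 ∨ degree R v = 2 then 1 else 0

lemma targetValue_ne_zero_iff {R : Graph α β} (v : α) :
    targetValue R v ≠ 0 ↔ degree R v = 1 ∨ degree R v = 2 := by
  unfold targetValue
  split_ifs with h <;> simp [h]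

variable [Fintype β]

/-- The half-edge values `c` describe a preflow of the signed graph obtained from `R` by subdividing
the edges in `S`. The zeros are confined to `Z`. -/
structure IsHalfPreflow (σ : β → ℤˣ) (S Z : Set β) (t : β → Bool → α) (R : Graph α β)
    (c : β → Bool → ZMod 3) : Prop where
  rel : ∀ e ∈ E(R), e ∉ S → c e true = sg (- σ e) * c e false
  rel_sub : ∀ e ∈ E(R), e ∈ S → c e true ≠ sg (- σ e) * c e false
  zero : ∀ e ∈ E(R), ∀ b, c e b = 0 → e ∈ Z
  boundary : ∀ v ∈ V(R), halfSum t E(R) c v ≠ 0 ↔ degree R v = 1 ∨ degree R v = 2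

/-- The half-edge values `c` describe a preflow everywhere but on the subgraph `C`. -/
structure IsHalfPreflowOff (σ : β → ℤˣ) (S Z : Set β) (t : β → Bool → α) (R C : Graph α β)
    (c : β → Bool → ZMod 3) : Prop where
  rel : ∀ e ∈ E(R) \ E(C), e ∉ S → c e true = sg (- σ e) * c e false
  rel_sub : ∀ e ∈ E(R) \ E(C), e ∈ S → c e true ≠ sg (- σ e) * c e false
  zero : ∀ e ∈ E(R) \ E(C), ∀ b, c e b = 0 → e ∈ Z
  ne_zero : ∀ e ∈ E(R) \ E(C), ∀ b, t e b ∈ V(C) → c e b ≠ 0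
  boundary : ∀ v ∈ V(R), v ∉ V(C) →
    (halfSum t (E(R) \ E(C)) c v ≠ 0 ↔ degree R v = 1 ∨ degree R v = 2)

variable {σ : β → ℤˣ} {S Z : Set β} {t : β → Bool → α} {R C : Graph α β}

/-- A preflow of a graph without vertices. -/
lemma isHalfPreflow_of_isEmpty (h : V(R) = ∅) (c : β → Bool → ZMod 3) :
    IsHalfPreflow σ S Z t R c := by
  have hE : ∀ e, e ∉ E(R) := fun e he => by
    obtain ⟨x, y, hl⟩ := R.exists_isLink_of_mem_edgeSet he
    have := hl.left_mem
    rw [h] at this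
    exact this
  exact ⟨fun e he => (hE e he).elim, fun e he => (hE e he).elim, fun e he => (hE e he).elim,
    fun v hv => by rw [h] at hv; exact hv.elim⟩

/-- Here `d` is the old degree of a vertex, `B` its old boundary and `n` the number of its new
half-edges, which all receive `g`. If `d = 0`, any nonzero `g` works, as `g` and `2g` are nonzero
and `3g = 0`. If `d = 1`, take `g = B`: then `2B ≠ 0` and `3B = 0`. If `d = 2` and `n = 1`, take `g
= -B`. -/
lemma exists_extension_value {B : ZMod 3} {d n : ℕ} (hdn : d + n ≤ 3)
    (h : B ≠ 0 ↔ d = 1 ∨ d = 2) :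
    ∃ g : ZMod 3, g ≠ 0 ∧ (B + n • g ≠ 0 ↔ d + n = 1 ∨ d + n = 2) := by
  have hd : d ≤ 3 := by omega
  have hn : n ≤ 3 := by omega
  interval_cases d <;> interval_cases n <;> first | omega | (revert B; decide)

/-- A preflow of `R - V(C)` extends to the edges of `R` outside `C`. -/
lemma IsHalfPreflow.exists_off (ht : Tips R t) (hC : C ≤ R) (hdeg : ∀ v ∈ V(R), degree R v ≤ 3)
    (hS : ∀ e ∈ E(R) \ E(C), ∀ b, t e b ∈ V(C) → e ∉ S) {c' : β → Bool → ZMod 3}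
    (hc' : IsHalfPreflow σ S Z t (R.deleteVerts V(C)) c') :
    ∃ c, IsHalfPreflowOff σ S Z t R C c := by
  set R' := R.deleteVerts V(C) with hR'
  have hle : R' ≤ R := Graph.deleteVerts_le
  have hmemR' : ∀ e ∈ E(R), (e ∈ E(R') ↔ t e false ∉ V(C) ∧ t e true ∉ V(C)) := by
    intro e he
    constructor
    · intro h
      have h1 := (ht.mono hle).mem h false
      have h2 := (ht.mono hle).mem h true
      rw [hR', Graph.vertexSet_deleteVerts] at h1 h2
      exact ⟨h1.2, h2.2⟩
    · intro h
      exact Graph.IsLink.edge_mem ((Graph.deleteVerts_isLink R V(C)).2 ⟨ht e he, h.1, h.2⟩)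
  have hCR' : ∀ e ∈ E(C), e ∉ E(R') := fun e he h =>
    ((hmemR' e (hC.edgeSet_mono he)).1 h).1 ((ht.mono hC).mem he false)
  set F : Set β := {e | e ∈ E(R) ∧ e ∉ E(R') ∧ e ∉ E(C)} with hF
  have hsplit : E(R) \ E(C) = E(R') ∪ F := by
    ext e
    simp only [Set.mem_sdiff, Set.mem_union, hF, Set.mem_ofPred_eq]
    constructor
    · rintro ⟨h1, h2⟩
      by_cases h : e ∈ E(R')
      · exact Or.inl h
      · exact Or.inr ⟨h1, h, h2⟩
    · rintro (h | ⟨h1, -, h2⟩)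
      · exact ⟨hle.edgeSet_mono h, fun h2 => hCR' e h2 h⟩
      · exact ⟨h1, h2⟩
  have hdisj : Disjoint E(R') F := Set.disjoint_left.2 fun e h1 h2 => h2.2.1 h1
  have hdegv : ∀ v, v ∉ V(C) →
      degree R v = degree R' v + halfSum t F (fun _ _ => 1) v := by
    intro v hv
    rw [← degree_add_halfSum_diff ht hC, degree_of_notMem (ht.mono hC) hv, zero_add, hsplit,
      halfSum_union hdisj, degree_eq_halfSum (ht.mono hle)]
  -- All half-edges from an outer vertex `v` to `V(C)` share one value `g v`, so that the outer
  -- vertices can be treated independently.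
  have hg : ∀ v, ∃ g : ZMod 3, g ≠ 0 ∧ (v ∈ V(R) → v ∉ V(C) →
      (halfSum t E(R') c' v + halfSum t F (fun _ _ => (1 : ℕ)) v • g ≠ 0 ↔
        degree R v = 1 ∨ degree R v = 2)) := by
    intro v
    by_cases hv : v ∈ V(R) ∧ v ∉ V(C)
    · have hb := hc'.boundary v (by rw [hR', Graph.vertexSet_deleteVerts]; exact hv)
      have hd := hdeg v hv.1
      rw [hdegv v hv.2] at hd ⊢
      obtain ⟨g, h1, h2⟩ := exists_extension_value hd hb
      exact ⟨g, h1, fun _ _ => h2⟩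
    · exact ⟨1, one_ne_zero, fun h1 h2 => (hv ⟨h1, h2⟩).elim⟩
  choose g hg0 hg using hg
  -- Every edge of `F` has an end in `V(C)`. Its value is fixed at the other end and carried across
  -- by the sign, which keeps it nonzero. A chord of `C` also falls under this rule, where any
  -- nonzero value would do.
  let c : β → Bool → ZMod 3 := fun e b =>
    if e ∈ E(R') then c' e b
    else if t e false ∈ V(C) then
      (if b then g (t e true) else sg (- σ e) * g (t e true))
    else (if b then sg (- σ e) * g (t e false) else g (t e false))
  have hcF : ∀ e, e ∉ E(R') → ∀ b, c e b ≠ 0 := by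
    intro e he b
    simp only [c, if_neg he]
    split_ifs
    exacts [hg0 _, mul_ne_zero (sg_ne_zero _) (hg0 _), mul_ne_zero (sg_ne_zero _) (hg0 _), hg0 _]
  have hcR : ∀ e ∈ E(R'), ∀ b, c e b = c' e b := fun e he b => if_pos he
  have hcrel : ∀ e, e ∉ E(R') → c e true = sg (- σ e) * c e false := by
    intro e he
    simp only [c, if_neg he, if_true, Bool.false_eq_true, if_false]
    split_ifs
    · rw [← mul_assoc, sg_mul_self, one_mul]
    · rfl
  have hFS : ∀ e ∈ E(R) \ E(C), e ∉ E(R') → e ∉ S := by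
    intro e he h
    rw [hmemR' e he.1, not_and_or, not_not, not_not] at h
    rcases h with h | h
    exacts [hS e he _ h, hS e he _ h]
  refine ⟨c, ⟨fun e he heS => ?_, fun e he heS => ?_, fun e he b h0 => ?_, fun e he b hb => ?_,
    fun v hv hvC => ?_⟩⟩
  · by_cases h : e ∈ E(R')
    · rw [hcR e h, hcR e h, hc'.rel e h heS]
    · exact hcrel e h
  · by_cases h : e ∈ E(R')
    · rw [hcR e h, hcR e h]
      exact hc'.rel_sub e h heS
    · exact (hFS e he h heS).elim
  · by_cases h : e ∈ E(R')
    · exact hc'.zero e h b (by rw [← hcR e h, h0])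
    · exact (hcF e h b h0).elim
  · refine hcF e (fun h => ?_) b
    rw [hmemR' e he.1] at h
    cases b
    exacts [h.1 hb, h.2 hb]
  · rw [hsplit, halfSum_union hdisj, ← hg v hv hvC,
      halfSum_congr (t := t) (F := E(R')) (F' := E(R')) (fun _ _ _ => Iff.rfl)
        (fun e he b _ => hcR e he b), halfSum_eq_nsmul (F := F) (a := g v)]
    intro e he b hb
    have h1 := he.2.1
    rw [hmemR' e he.1, not_and_or, not_not, not_not] at h1
    simp only [c, if_neg he.2.1]
    cases b
    · rw [if_neg (by rw [hb]; exact hvC), hb]; rfl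
    · rw [if_pos (h1.resolve_right (by rw [hb]; exact hvC)), hb]; rfl

/-- Values on `C` that fit at the vertices of `C` complete the preflow. -/
lemma IsHalfPreflowOff.glue (ht : Tips R t) (hC : C ≤ R) {c d : β → Bool → ZMod 3}
    (hc : IsHalfPreflowOff σ S Z t R C c)
    (hrel : ∀ e ∈ E(C), e ∉ S → d e true = sg (- σ e) * d e false)
    (hrel' : ∀ e ∈ E(C), e ∈ S → d e true ≠ sg (- σ e) * d e false)
    (hzero : ∀ e ∈ E(C), ∀ b, d e b = 0 → e ∈ Z)
    (hb : ∀ v ∈ V(C), halfSum t (E(R) \ E(C)) c v + halfSum t E(C) d v ≠ 0 ↔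
      degree R v = 1 ∨ degree R v = 2) :
    ∃ f, IsHalfPreflow σ S Z t R f := by
  let f : β → Bool → ZMod 3 := fun e b => if e ∈ E(C) then d e b else c e b
  have f1 : ∀ e ∈ E(C), ∀ b, f e b = d e b := fun e he b => if_pos he
  have f2 : ∀ e, e ∉ E(C) → ∀ b, f e b = c e b := fun e he b => if_neg he
  refine ⟨f, ⟨fun e he heS => ?_, fun e he heS => ?_, fun e he b h0 => ?_, fun v hv => ?_⟩⟩
  · by_cases h : e ∈ E(C)
    · rw [f1 e h, f1 e h, hrel e h heS]
    · rw [f2 e h, f2 e h, hc.rel e ⟨he, h⟩ heS]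
  · by_cases h : e ∈ E(C)
    · rw [f1 e h, f1 e h]; exact hrel' e h heS
    · rw [f2 e h, f2 e h]; exact hc.rel_sub e ⟨he, h⟩ heS
  · by_cases h : e ∈ E(C)
    · exact hzero e h b (by rw [← f1 e h, h0])
    · exact hc.zero e ⟨he, h⟩ b (by rw [← f2 e h, h0])
  · have h1 : halfSum t E(R) f v = halfSum t (E(R) \ E(C)) c v + halfSum t E(C) d v := by
      rw [← Set.sdiff_union_of_subset hC.edgeSet_mono, halfSum_union Set.disjoint_sdiff_left,
        halfSum_congr (F := E(R) \ E(C)) (c := f) (c' := c) (fun _ _ _ => Iff.rfl)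
          (fun e he b _ => f2 e he.2 b),
        halfSum_congr (F := E(C)) (c := f) (c' := d) (fun _ _ _ => Iff.rfl)
          (fun e he b _ => f1 e he b), Set.sdiff_union_of_subset hC.edgeSet_mono]
    rw [h1]
    by_cases hvC : v ∈ V(C)
    · exact hb v hvC
    · rw [halfSum_of_notMem (ht.mono hC) _ hvC, add_zero]
      exact hc.boundary v hv hvC

/-- `C` already uses every edge at such a vertex; in particular this applies to a vertex of degree
two on a cycle. -/
lemma halfSum_diff_eq_zero (ht : Tips R t) (hC : C ≤ R) {v : α} (h : degree R v ≤ degree C v)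
    (c : β → Bool → ZMod 3) : halfSum t (E(R) \ E(C)) c v = 0 := by
  rw [halfSum_eq_nsmul (a := 0), smul_zero]
  intro e he b hb
  exact (he.2 (mem_of_degree_le ht hC h he.1 hb)).elim

/-- A preflow extends over a negative cycle that may contain zeros. -/
lemma IsHalfPreflowOff.exists_of_special [Fintype α] (ht : Tips R t) (hC : C ≤ R)
    (hneg : IsNegativeCycle σ C) (hZ : E(C) ⊆ Z) {c : β → Bool → ZMod 3}
    (hc : IsHalfPreflowOff σ S Z t R C c) : ∃ f, IsHalfPreflow σ S Z t R f := by
  -- The unit added to one half of every subdivided edge violates the edge relation, as the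
  -- subdividing vertex requires. Its effect on the boundaries is subtracted from the prescribed
  -- values below.
  let r : β → Bool → ZMod 3 := fun e b => if b ∧ e ∈ S then 1 else 0
  obtain ⟨d, hd, hdv⟩ := hneg.exists_halfSum_eq (ht.mono hC)
    (fun v => targetValue R v - halfSum t (E(R) \ E(C)) c v - halfSum t E(C) r v)
  refine hc.glue ht hC (d := fun e b => d e b + r e b) (fun e _ heS => ?_) (fun e _ heS => ?_)
    (fun e he b _ => hZ he) (fun v hv => ?_)
  · simp [r, heS, hd]
  · simp [r, heS, hd]
  · rw [halfSum_add, hdv v hv, ← targetValue_ne_zero_iff]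
    ring_nf

/-- A preflow extends over a cycle that may contain zeros and has two vertices of degree two. -/
lemma IsHalfPreflowOff.exists_of_two_free [Fintype α] (ht : Tips R t) (hC : C ≤ R)
    (hcyc : IsCycle C) (hZ : E(C) ⊆ Z) (hS : ∀ e ∈ E(C), e ∉ S) {c : β → Bool → ZMod 3}
    (hc : IsHalfPreflowOff σ S Z t R C c) {x y : α} (hx : x ∈ V(C)) (hy : y ∈ V(C)) (hxy : x ≠ y)
    (hdx : degree R x = 2) (hdy : degree R y = 2) : ∃ f, IsHalfPreflow σ S Z t R f := by
  have ox := halfSum_diff_eq_zero ht hC (v := x) (by rw [hdx, hcyc.2 x hx]) c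
  have oy := halfSum_diff_eq_zero ht hC (v := y) (by rw [hdy, hcyc.2 y hy]) c
  have tx : targetValue R x = 1 := if_pos (Or.inr hdx)
  have ty : targetValue R y = 1 := if_pos (Or.inr hdy)
  -- At `x` and `y` there is no outer contribution and the boundary only has to be nonzero, so the
  -- undetermined signs are harmless.
  obtain ⟨a, b, d, hd, hdx', hdy', hdv⟩ := exists_halfSum_eq_up_to_signs (ht.mono hC) hcyc.1
    (fun e => - σ e) (fun v => targetValue R v - halfSum t (E(R) \ E(C)) c v) hx hy hxy
    (by simp [ox, tx]) (by simp [oy, ty])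
  refine hc.glue ht hC (d := d) (fun e _ _ => hd e) (fun e he heS => (hS e he heS).elim)
    (fun e he b _ => hZ he) (fun v hv => ?_)
  by_cases hvx : v = x
  · subst hvx
    simp only [hdx', ox, tx, hdx, sub_zero, mul_one, zero_add, ne_eq, sg_ne_zero,
      not_false_eq_true, or_true]
  · by_cases hvy : v = y
    · subst hvy
      simp only [hdy', oy, ty, hdy, sub_zero, mul_one, zero_add, ne_eq, sg_ne_zero,
        not_false_eq_true, or_true]
    · rw [hdv v hv hvx hvy, ← targetValue_ne_zero_iff]
      ring_nf

/-- Negating a preflow on a set `A` of vertices that is attached to the rest of the graph only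
through a vertex `y` of `C`. -/
lemma IsHalfPreflowOff.negate {c : β → Bool → ZMod 3}
    (hc : IsHalfPreflowOff σ S Z t R C c) {A : Set α} {y : α} (hy : y ∈ V(C))
    (hA : ∀ e ∈ E(R), ∀ b, t e b ∈ A → t e (!b) ∈ A ∨ t e (!b) = y) :
    IsHalfPreflowOff σ S Z t R C
      (fun e b => if t e false ∈ A ∨ t e true ∈ A then - c e b else c e b) := by
  refine ⟨fun e he heS => ?_, fun e he heS => ?_, fun e he b h0 => ?_, fun e he b hb => ?_,
    fun v hv hvC => ?_⟩
  · split_ifs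
    · rw [hc.rel e he heS, mul_neg]
    · exact hc.rel e he heS
  · split_ifs
    · rw [mul_neg, Ne, neg_inj]
      exact hc.rel_sub e he heS
    · exact hc.rel_sub e he heS
  · refine hc.zero e he b ?_
    split_ifs at h0
    · exact neg_eq_zero.1 h0
    · exact h0
  · split_ifs
    · exact neg_ne_zero.2 (hc.ne_zero e he b hb)
    · exact hc.ne_zero e he b hb
  · rw [← hc.boundary v hv hvC]
    have hvy : v ≠ y := fun h => hvC (h ▸ hy)
    by_cases hvA : v ∈ A
    · rw [halfSum_congr (c' := fun e b => - c e b) (fun _ _ _ => Iff.rfl), halfSum_neg, neg_ne_zero]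
      intro e he b hb
      rw [if_pos]
      cases b
      · exact Or.inl (hb ▸ hvA)
      · exact Or.inr (hb ▸ hvA)
    · rw [halfSum_congr (c' := c) (fun _ _ _ => Iff.rfl)]
      intro e he b hb
      rw [if_neg]
      have h1 := hA e he.1 (!b)
      rw [Bool.not_not, hb] at h1
      cases b
      · rintro (h | h)
        · exact hvA (hb ▸ h)
        · exact (h1 h).elim hvA hvy
      · rintro (h | h)
        · exact (h1 h).elim hvA hvy
        · exact hvA (hb ▸ h)

/-- A preflow extends over a cycle that may contain zeros, has a vertex `x` of degree two and a
vertex `y` of degree three whose third edge is the only link to a set of vertices. -/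
lemma IsHalfPreflowOff.exists_of_bridge [Fintype α] (ht : Tips R t) (hC : C ≤ R)
    (hcyc : IsCycle C) (hZ : E(C) ⊆ Z) (hS : ∀ e ∈ E(C), e ∉ S) {c : β → Bool → ZMod 3}
    (hc : IsHalfPreflowOff σ S Z t R C c) {x y : α} (hx : x ∈ V(C)) (hy : y ∈ V(C)) (hxy : x ≠ y)
    (hdx : degree R x = 2) (hdy : degree R y = 3) {A : Set α} (hAC : ∀ v ∈ V(C), v ∉ A)
    (hA : ∀ e ∈ E(R), ∀ b, t e b ∈ A → t e (!b) ∈ A ∨ t e (!b) = y)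
    (hyA : ∀ e ∈ E(R) \ E(C), ∀ b, t e b = y → t e (!b) ∈ A) :
    ∃ f, IsHalfPreflow σ S Z t R f := by
  have ox := halfSum_diff_eq_zero ht hC (v := x) (by rw [hdx, hcyc.2 x hx])
  have tx : targetValue R x = 1 := if_pos (Or.inr hdx)
  have ty : targetValue R y = 0 := if_neg (by omega)
  have hone : halfSum t (E(R) \ E(C)) (fun _ _ => 1) y = 1 := by
    have h := degree_add_halfSum_diff ht hC y
    rw [hdy, hcyc.2 y hy] at h
    omega
  have oy : halfSum t (E(R) \ E(C)) c y ≠ 0 := by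
    obtain ⟨e, he, b, hb, huniq⟩ := exists_halfSum_one_eq hone
    rw [halfSum_eq_nsmul (a := c e b), hone, one_smul]
    · exact hc.ne_zero e he b (hb ▸ hy)
    · rintro e' he' b' hb'
      obtain ⟨rfl, rfl⟩ := huniq e' he' b' hb'
      rfl
  obtain ⟨a, b, d, hd, hdx', hdy', hdv⟩ := exists_halfSum_eq_up_to_signs (ht.mono hC) hcyc.1
    (fun e => - σ e) (fun v => targetValue R v - halfSum t (E(R) \ E(C)) c v) hx hy hxy
    (by simp [ox, tx]) (by simpa [ty] using oy)
  have finish : ∀ c', IsHalfPreflowOff σ S Z t R C c' →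
      (∀ v ∈ V(C), v ≠ y → halfSum t (E(R) \ E(C)) c' v = halfSum t (E(R) \ E(C)) c v) →
      halfSum t (E(R) \ E(C)) c' y = sg b * halfSum t (E(R) \ E(C)) c y →
      ∃ f, IsHalfPreflow σ S Z t R f := by
    intro c' hc' h1 h2
    refine hc'.glue ht hC (d := d) (fun e _ _ => hd e) (fun e he heS => (hS e he heS).elim)
      (fun e he b _ => hZ he) (fun v hv => ?_)
    by_cases hvx : v = x
    · subst hvx
      simp only [hdx', ox, tx, hdx, sub_zero, mul_one, zero_add, ne_eq, sg_ne_zero,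
        not_false_eq_true, or_true]
    · by_cases hvy : v = y
      · subst hvy
        rw [hdy', h2, ty, hdy, zero_sub, mul_neg, add_neg_cancel]
        simp
      · rw [hdv v hv hvx hvy, h1 v hv hvy, ← targetValue_ne_zero_iff]
        ring_nf
  -- If the values on `C` cancel the wrong sign at `y`, negate everything on the side of `A`. Among
  -- the vertices of `C`, only `y` notices this.
  rcases Int.units_eq_one_or b with rfl | rfl
  · exact finish c hc (fun _ _ _ => rfl) (by rw [sg_one, one_mul])
  · refine finish _ (hc.negate hy hA) (fun v hv hvy => ?_) ?_
    · refine halfSum_congr (fun _ _ _ => Iff.rfl) fun e he b hb => if_neg ?_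
      have h1 := hA e he.1 (!b)
      rw [Bool.not_not, hb] at h1
      have h2 : t e (!b) ∉ A := fun h => (h1 h).elim (hAC v hv) hvy
      have h3 : t e b ∉ A := hb ▸ hAC v hv
      cases b <;> simp_all
    · rw [sg_neg, sg_one, neg_one_mul, ← halfSum_neg]
      refine halfSum_congr (fun _ _ _ => Iff.rfl) fun e he b hb => if_pos ?_
      have h1 := hyA e he b hb
      cases b <;> simp_all

/-- Each edge outside `S` contributes a factor -1, and modulo 2 their number is the length plus `|S
∩ E(C)|`. -/
lemma sign_twist (σ : β → ℤˣ) (S : Set β) (C : Graph α β) :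
    sign (fun e => if e ∈ S then σ e else - σ e) C =
      (-1) ^ (length C + (S ∩ E(C)).ncard) * sign σ C := by
  have h1 : ∀ F : Set β, (-1 : ℤˣ) ^ F.ncard = ∏ e : β, if e ∈ F then -1 else 1 := by
    intro F
    rw [Finset.prod_ite, Finset.prod_const_one, mul_one, Finset.prod_const, ← Set.ncard_coe_finset]
    congr 2; ext e; simp
  rw [sign_eq_prod, sign_eq_prod, pow_add, length, h1, h1, ← Finset.prod_mul_distrib,
    ← Finset.prod_mul_distrib]
  refine Finset.prod_congr rfl fun e _ => ?_
  by_cases he : e ∈ E(C) <;> by_cases hS : e ∈ S <;> simp [he, hS]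

/-- A preflow extends without new zeros over a negative cycle with at most one vertex of degree
three, if the cycle has odd length after the subdivision. -/
lemma IsHalfPreflowOff.exists_of_ordinary [Fintype α] (ht : Tips R t) (hC : C ≤ R)
    (hneg : IsNegativeCycle σ C) (hodd : Odd (length C + (S ∩ E(C)).ncard))
    (hdeg : ∀ v ∈ V(R), degree R v ≤ 3) (hsub : {v ∈ V(C) | degree R v ≠ 2}.Subsingleton)
    {c : β → Bool → ZMod 3} (hc : IsHalfPreflowOff σ S Z t R C c) :
    ∃ f, IsHalfPreflow σ S Z t R f := by
  obtain ⟨s, hs⟩ := hneg.1.exists_signs (ht.mono hC) (fun e => if e ∈ S then σ e else - σ e)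
    (by rw [sign_twist, hodd.neg_one_pow, hneg.2]; rfl)
  -- Give every half-edge at `v` the value `u * s v`. The products of `s` along edges are `-σ e` off
  -- `S`, which is the relation for undivided edges, and `σ e` on `S`, which violates it because the
  -- values are nonzero. A vertex of degree two gets twice a nonzero value. At a vertex of degree
  -- three the outer edge has the same value, and three equal values sum to zero.
  have main : ∀ u : ℤˣ,
      (∀ v ∈ V(C), degree R v ≠ 2 → halfSum t (E(R) \ E(C)) c v = sg u * sg (s v)) →
      ∃ f, IsHalfPreflow σ S Z t R f := by
    intro u hu
    have hs' : ∀ e ∈ E(C),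
        sg (s (t e true)) = sg (if e ∈ S then σ e else - σ e) * sg (s (t e false)) := by
      intro e he
      rw [← hs e he, sg_mul]
      linear_combination - sg (s (t e true)) * sg_mul_self (s (t e false))
    refine hc.glue ht hC (d := fun e b => sg u * sg (s (t e b))) (fun e he heS => ?_)
      (fun e he heS => ?_) (fun e he b h0 => ?_) (fun v hv => ?_)
    · rw [hs' e he, if_neg heS]; ring
    · rw [hs' e he, if_pos heS, sg_neg]
      intro h
      have h0 : sg u * (sg (σ e) * sg (s (t e false))) ≠ 0 :=
        mul_ne_zero (sg_ne_zero _) (mul_ne_zero (sg_ne_zero _) (sg_ne_zero _))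
      have : ∀ z : ZMod 3, z ≠ 0 → z ≠ -z := by decide
      exact this _ h0 (h.trans (by ring))
    · exact (mul_ne_zero (sg_ne_zero _) (sg_ne_zero _) h0).elim
    · rw [halfSum_eq_degree_nsmul (ht.mono hC) (a := sg u * sg (s v))
        (fun e _ b hb => by rw [hb]), hneg.1.2 v hv]
      have h0 : sg u * sg (s v) ≠ 0 := mul_ne_zero (sg_ne_zero _) (sg_ne_zero _)
      have h2 : 2 ≤ degree R v := by
        rw [← hneg.1.2 v hv]; exact degree_mono ht hC v
      have h3 := hdeg v (hC.vertexSet_mono hv)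
      by_cases hd : degree R v = 2
      · rw [halfSum_diff_eq_zero ht hC (by rw [hd, hneg.1.2 v hv]), hd]
        generalize sg u * sg (s v) = z at h0
        revert z; decide
      · have hd3 : degree R v = 3 := by omega
        rw [hu v hv hd, hd3]
        generalize sg u * sg (s v) = z at h0
        revert z; decide
  by_cases hw : ∃ w ∈ V(C), degree R w ≠ 2
  · obtain ⟨w, hw, hdw⟩ := hw
    have h2 : 2 ≤ degree R w := by
      rw [← hneg.1.2 w hw]; exact degree_mono ht hC w
    have h3 := hdeg w (hC.vertexSet_mono hw)
    have hone : halfSum t (E(R) \ E(C)) (fun _ _ => 1) w = 1 := by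
      have h := degree_add_halfSum_diff ht hC w
      rw [hneg.1.2 w hw] at h
      omega
    obtain ⟨e, he, b, hb, huniq⟩ := exists_halfSum_one_eq hone
    -- The global sign is chosen so that `u * s w` is the value of the only outer edge at `w`, which
    -- is known to be nonzero.
    obtain ⟨u, hu⟩ := exists_sg_eq (mul_ne_zero (hc.ne_zero e he b (hb ▸ hw)) (sg_ne_zero (s w)))
    refine main u fun v hv hdv => ?_
    obtain rfl : v = w := hsub ⟨hv, hdv⟩ ⟨hw, hdw⟩
    rw [halfSum_eq_nsmul (a := c e b), hone, one_smul, hu, mul_assoc, sg_mul_self, mul_one]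
    rintro e' he' b' hb'
    obtain ⟨rfl, rfl⟩ := huniq e' he' b' hb'
    rfl
  · push Not at hw
    exact main 1 fun v hv hdv => (hdv (hw v hv)).elim

/-- A preflow extends over a single vertex of degree at most one. -/
lemma IsHalfPreflowOff.exists_of_vertex (ht : Tips R t) {v : α}
    (hC : Graph.noEdge {v} β ≤ R) (hd : degree R v ≤ 1)
    {c : β → Bool → ZMod 3} (hc : IsHalfPreflowOff σ S Z t R (Graph.noEdge {v} β) c) :
    ∃ f, IsHalfPreflow σ S Z t R f := by
  refine hc.glue ht hC (d := c) (fun e he => he.elim) (fun e he => he.elim) (fun e he => he.elim) ?_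
  rintro w rfl
  have h := degree_eq_halfSum ht w
  rw [Graph.edgeSet_noEdge, Set.sdiff_empty, halfSum_eq_zero (F := ∅) fun e he => he.elim, add_zero]
  by_cases h0 : degree R w = 0
  · rw [halfSum_eq_nsmul (a := 0), smul_zero, h0]
    · simp
    · intro e he b hb
      have := halfSum_one_pos he hb
      omega
  · have h1 : degree R w = 1 := by omega
    rw [h1] at h
    obtain ⟨e, he, b, hb, huniq⟩ := exists_halfSum_one_eq h.symm
    rw [halfSum_eq_nsmul (a := c e b), ← h, one_smul, h1]
    · simpa using hc.ne_zero e ⟨he, fun h => h.elim⟩ b hb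
    · rintro e' he' b' hb'
      obtain ⟨rfl, rfl⟩ := huniq e' he' b' hb'
      rfl

end CycleSelection

/-! ### Blocks and leaf-blocks: where edges leave them. -/

namespace CycleSelection

open scoped Classical

variable {α β : Type*}

lemma Reach.mono {H K : Graph α β} (hle : H ≤ K) {x y : α} (h : Reach H x y) : Reach K x y :=
  Relation.ReflTransGen.lift id (fun _ _ hab => Graph.Adj.mono hle hab) _ _ h

lemma Reach.symm {K : Graph α β} {x y : α} (h : Reach K x y) : Reach K y x := by
  unfold Reach at *
  induction h with
  | refl => exact .refl
  | tail _ hbc ih => exact .head hbc.symm ih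

lemma Reach.trans {K : Graph α β} {x y z : α} (h : Reach K x y) (h' : Reach K y z) :
    Reach K x z := Relation.ReflTransGen.trans h h'

lemma deleteVerts_mono {H K : Graph α β} (hle : H ≤ K) (X : Set α) :
    H.deleteVerts X ≤ K.deleteVerts X where
  vertexSet_mono := by
    simp only [Graph.vertexSet_deleteVerts]
    exact Set.sdiff_subset_sdiff_left hle.vertexSet_mono
  isLink_mono := by
    intro e x y h
    rw [Graph.deleteVerts_isLink] at h ⊢
    exact ⟨h.1.mono hle, h.2⟩

/-- A path that leads from `a` to a first vertex with the property `P`. -/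
lemma exists_path_to_first {r : α → α → Prop} {P : α → Prop} {a b : α}
    (h : Relation.ReflTransGen r a b) (hb : P b) :
    ∃ (n : ℕ) (p : ℕ → α), p 0 = a ∧ P (p n) ∧ (∀ i < n, r (p i) (p (i + 1))) ∧
      (∀ i < n, ¬ P (p i)) ∧ ∀ i j, i < j → j ≤ n → p i ≠ p j := by
  have hex : ∃ n, ∃ p : ℕ → α, p 0 = a ∧ P (p n) ∧ ∀ i < n, r (p i) (p (i + 1)) := by
    have : ∃ n, ∃ p : ℕ → α, p 0 = a ∧ p n = b ∧ ∀ i < n, r (p i) (p (i + 1)) := by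
      clear hb
      induction h with
      | refl => exact ⟨0, fun _ => a, rfl, rfl, fun i hi => by omega⟩
      | @tail b c _ hbc ih =>
        obtain ⟨n, p, h0, hn, hs⟩ := ih
        refine ⟨n + 1, fun i => if i ≤ n then p i else c, ?_, ?_, fun i hi => ?_⟩
        · simpa using h0
        · simp
        · by_cases hin : i = n
          · subst hin; simpa [hn] using hbc
          · simp only [show i ≤ n by omega, show i + 1 ≤ n by omega, if_true]
            exact hs i (by omega)
    obtain ⟨n, p, h0, hn, hs⟩ := this
    exact ⟨n, p, h0, hn ▸ hb, hs⟩
  -- A shortest walk to a vertex with `P`: stopping at an earlier such vertex, or cutting out the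
  -- part between two visits to the same vertex, would shorten it.
  obtain ⟨p, h0, hn, hs⟩ := Nat.find_spec hex
  have hmin := fun m => Nat.find_min hex (m := m)
  generalize Nat.find hex = n at *
  refine ⟨n, p, h0, hn, hs, fun i hi hPi => ?_, fun i j hij hj heq => ?_⟩
  · exact hmin i hi ⟨p, h0, hPi, fun k hk => hs k (by omega)⟩
  · refine hmin (n - (j - i)) (by omega)
      ⟨fun k => if k ≤ i then p k else p (k + (j - i)), ?_, ?_, fun k hk => ?_⟩
    · simpa using h0
    · by_cases hjn : j = n
      · have : n - (j - i) ≤ i := by omega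
        simp only [this, if_true]
        have h1 : n - (j - i) = i := by omega
        rw [h1, heq, hjn]; exact hn
      · have : ¬ n - (j - i) ≤ i := by omega
        simp only [this, if_false]
        have h1 : n - (j - i) + (j - i) = n := by omega
        rw [h1]; exact hn
    · by_cases h1 : k + 1 ≤ i
      · simp only [h1, show k ≤ i by omega, if_true]
        exact hs k (by omega)
      · by_cases h2 : k ≤ i
        · have hki : k = i := by omega
          subst hki
          simp only [h1, le_refl, if_true, if_false, heq]
          have h3 : k + 1 + (j - k) = j + 1 := by omega
          rw [h3]
          exact hs j (by omega)
        · simp only [h1, h2, if_false]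
          have h3 : k + 1 + (j - i) = k + (j - i) + 1 := by omega
          rw [h3]
          exact hs _ (by omega)

/-- A graph without cut vertices keeps this property when vertices are added that stay connected
to it after the removal of any other vertex. -/
lemma connected_noCut_of_reach {H K : Graph α β} (hle : H ≤ K) (hconn : Connected H)
    (hcut : ∀ v, ¬ IsCutVertex H v)
    (hr : ∀ c, ∀ x ∈ V(K), x ∉ V(H) → x ≠ c → ∃ h ∈ V(H), h ≠ c ∧ Reach (K.deleteVerts {c}) x h) :
    Connected K ∧ ∀ v, ¬ IsCutVertex K v := by
  constructor
  · obtain ⟨h₀, hh₀⟩ := hconn.1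
    have hall : ∀ x ∈ V(K), Reach K x h₀ := by
      intro x hx
      by_cases hxH : x ∈ V(H)
      · exact (hconn.2 x hxH h₀ hh₀).mono hle
      · obtain ⟨h, hh, -, hxh⟩ := hr h₀ x hx hxH (fun h => hxH (h ▸ hh₀))
        exact (hxh.mono Graph.deleteVerts_le).trans ((hconn.2 h hh h₀ hh₀).mono hle)
    exact ⟨⟨h₀, hle.vertexSet_mono hh₀⟩, fun x hx y hy => (hall x hx).trans (hall y hy).symm⟩
  · rintro c ⟨-, x, hx, y, hy, hxc, hyc, -, hn⟩
    have hall : ∀ x ∈ V(K), x ≠ c → ∃ h ∈ V(H), h ≠ c ∧ Reach (K.deleteVerts {c}) x h := by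
      intro x hx hxc
      by_cases hxH : x ∈ V(H)
      · exact ⟨x, hxH, hxc, .refl⟩
      · exact hr c x hx hxH hxc
    obtain ⟨h₁, hh₁, hc₁, hr₁⟩ := hall x hx hxc
    obtain ⟨h₂, hh₂, hc₂, hr₂⟩ := hall y hy hyc
    refine hn (hr₁.trans (Reach.trans ?_ hr₂.symm))
    refine Reach.mono (deleteVerts_mono hle _) ?_
    by_cases hcH : c ∈ V(H)
    · by_contra hnr
      exact hcut c ⟨hcH, h₁, hh₁, h₂, hh₂, hc₁, hc₂, hconn.2 h₁ hh₁ h₂ hh₂, hnr⟩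
    · refine (hconn.2 h₁ hh₁ h₂ hh₂).mono ⟨?_, ?_⟩
      · rw [Graph.vertexSet_deleteVerts]
        exact fun v hv => ⟨hv, fun h => hcH (h ▸ hv)⟩
      · intro e x y hl
        rw [Graph.deleteVerts_isLink]
        exact ⟨hl, fun h => hcH (h ▸ hl.left_mem), fun h => hcH (h ▸ hl.right_mem)⟩

lemma le_induce {H R : Graph α β} (hle : H ≤ R) {X : Set α} (hX : V(H) ⊆ X) :
    H ≤ R.induce X where
  vertexSet_mono := hX
  isLink_mono := by
    intro e x y hl
    exact ⟨hl.mono hle, hX hl.left_mem, hX hl.right_mem⟩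

/-- A larger induced subgraph without cut vertices contradicts the maximality of a block. -/
lemma IsBlock.subset_of_noCut {R H : Graph α β} (hH : IsBlock R H) {X : Set α} (hXR : X ⊆ V(R))
    (hX : V(H) ⊆ X) (hK : Connected (R.induce X) ∧ ∀ v, ¬ IsCutVertex (R.induce X) v) :
    R.induce X ≤ H :=
  hH.2 ⟨Graph.induce_le hXR, hK.1, hK.2⟩ (le_induce hH.1.1 hX)

/-- Additional edges between vertices of a block create no cut vertex, so by maximality a block is
an induced subgraph. -/
lemma IsBlock.notMem_of_isLink {R H : Graph α β} (hH : IsBlock R H) {e : β} {w w' : α}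
    (hl : R.IsLink e w w') (hw : w ∈ V(H)) (he : e ∉ E(H)) : w' ∉ V(H) := by
  intro hw'
  have h1 : H ≤ R.induce V(H) := le_induce hH.1.1 subset_rfl
  have h2 := hH.subset_of_noCut hH.1.1.vertexSet_mono subset_rfl
    (connected_noCut_of_reach h1 hH.1.2.1 hH.1.2.2 fun c x hx hn => (hn hx).elim)
  have h3 : (R.induce V(H)).IsLink e w w' := ⟨hl, hw, hw'⟩
  exact he (h2.edgeSet_mono h3.edge_mem)

/-- An edge that leaves a block at `w` leads to vertices that are separated from it by `w`. -/
lemma IsBlock.notMem_of_reach {R H : Graph α β} (hH : IsBlock R H) {e : β} {w w' u : α}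
    (hl : R.IsLink e w w') (hw : w ∈ V(H)) (he : e ∉ E(H))
    (hr : Reach (R.deleteVerts {w}) w' u) : u ∉ V(H) := by
  intro hu
  have hw' := hH.notMem_of_isLink hl hw he
  obtain ⟨n, p, h0, hn, hs, hP, hinj⟩ := exists_path_to_first (P := fun v => v ∈ V(H)) hr hu
  have hn0 : n ≠ 0 := by
    rintro rfl
    rw [h0] at hn
    exact hw' hn
  have hR : ∀ i < n, R.Adj (p i) (p (i + 1)) := fun i hi => (hs i hi).mono Graph.deleteVerts_le
  have hpn : p n ≠ w := by
    have := (hs (n - 1) (by omega)).right_mem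
    rw [Graph.vertexSet_deleteVerts, show n - 1 + 1 = n by omega] at this
    exact this.2
  -- `H` enlarged by an ear that starts with `e` at `w` and ends at `p n ≠ w`. An ear between two
  -- distinct vertices of `H` creates no cut vertex, which contradicts maximality.
  let X : Set α := V(H) ∪ {v | ∃ i < n, p i = v}
  have hXR : X ⊆ V(R) := by
    rintro v (hv | ⟨i, hi, rfl⟩)
    · exact hH.1.1.vertexSet_mono hv
    · exact (hR i hi).left_mem
  have hpX : ∀ i ≤ n, p i ∈ X := by
    intro i hi
    by_cases hin : i = n
    · exact Or.inl (hin ▸ hn)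
    · exact Or.inr ⟨i, by omega, rfl⟩
  have hK := connected_noCut_of_reach (K := R.induce X) (le_induce hH.1.1 Set.subset_union_left)
    hH.1.2.1 hH.1.2.2 (by
      intro c x hx hxH hxc
      obtain ⟨i, hi, rfl⟩ := hx.resolve_left hxH
      have hadj : ∀ j < n, p j ≠ c → p (j + 1) ≠ c →
          ((R.induce X).deleteVerts {c}).Adj (p j) (p (j + 1)) := by
        intro j hj h1 h2
        obtain ⟨f, hf⟩ := hR j hj
        exact ⟨f, (Graph.deleteVerts_isLink _ _).2
          ⟨⟨hf, hpX j hj.le, hpX (j + 1) hj⟩, h1, h2⟩⟩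
      have hback : (∀ j ≤ i, p j ≠ c) → w ≠ c →
          ∃ h ∈ V(H), h ≠ c ∧ Reach ((R.induce X).deleteVerts {c}) (p i) h := by
        intro hj hwc
        refine ⟨w, hw, hwc, ?_⟩
        have : ∀ j ≤ i, Reach ((R.induce X).deleteVerts {c}) (p j) (p 0) := by
          intro j hji
          induction j with
          | zero => exact .refl
          | succ j ih =>
            exact .head (hadj j (by omega) (hj j (by omega)) (hj _ hji)).symm (ih (by omega))
        refine (this i le_rfl).trans (Relation.ReflTransGen.single ⟨e, ?_⟩)
        rw [Graph.deleteVerts_isLink, h0]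
        exact ⟨⟨hl.symm, h0 ▸ hpX 0 (by omega), Or.inl hw⟩,
          fun h => hj 0 (by omega) (h0.trans h), hwc⟩
      have hforw : (∀ j, i ≤ j → j ≤ n → p j ≠ c) →
          ∃ h ∈ V(H), h ≠ c ∧ Reach ((R.induce X).deleteVerts {c}) (p i) h := by
        intro hj
        refine ⟨p n, hn, hj n hi.le le_rfl, ?_⟩
        have : ∀ k, i + k ≤ n → Reach ((R.induce X).deleteVerts {c}) (p i) (p (i + k)) := by
          intro k hk
          induction k with
          | zero => exact .refl
          | succ k ih =>
            exact (ih (by omega)).tail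
              (hadj (i + k) (by omega) (hj _ (by omega) (by omega)) (hj _ (by omega) hk))
        have h := this (n - i) (by omega)
        rwa [show i + (n - i) = n by omega] at h
      -- After removal of `c`, an inner vertex `p i` of the ear still reaches `H` along the part of
      -- the ear that avoids `c`: forwards if `c` is `w` or lies before `p i`, and backwards to `w`
      -- otherwise.
      by_cases hcw : c = w
      · subst hcw
        refine hforw fun j hij hjn => ?_
        by_cases hjn' : j = n
        · rw [hjn']; exact hpn
        · exact fun h => hP j (by omega) (h ▸ hw)
      · by_cases hj : ∃ j ≤ i, p j = c
        · obtain ⟨j, hji, rfl⟩ := hj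
          refine hforw fun k hik hkn h => ?_
          have hji' : j < i := lt_of_le_of_ne hji fun h => hxc (by rw [h])
          exact hinj j k (by omega) hkn h.symm
        · push Not at hj
          exact hback hj (Ne.symm hcw))
  have h2 := hH.subset_of_noCut hXR Set.subset_union_left hK
  exact hw' (h2.vertexSet_mono (h0 ▸ hpX 0 (by omega)))

/-- An edge that leaves a block does so at a cut vertex. -/
lemma IsBlock.isCutVertex_of_isLink {R H : Graph α β} (hH : IsBlock R H) {e : β} {w w' : α}
    (hl : R.IsLink e w w') (hw : w ∈ V(H)) (he : e ∉ E(H)) : IsCutVertex R w := by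
  have hw' := hH.notMem_of_isLink hl hw he
  by_cases hu : ∃ u ∈ V(H), u ≠ w
  · obtain ⟨u, hu, huw⟩ := hu
    refine ⟨hl.left_mem, w', hl.right_mem, u, hH.1.1.vertexSet_mono hu, fun h => hw' (h ▸ hw), huw,
      ?_, fun hr => hH.notMem_of_reach hl hw he hr hu⟩
    exact Relation.ReflTransGen.head ⟨e, hl.symm⟩ ((hH.1.2.1.2 w hw u hu).mono hH.1.1)
  · push Not at hu
    -- If `H` has no vertex but `w`, then the graph induced on the two ends of the edge is larger
    -- and too small to have a cut vertex.
    exfalso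
    have hle := hH.subset_of_noCut (X := {w, w'}) (by
        rintro v (rfl | rfl)
        exacts [hl.left_mem, hl.right_mem]) (fun v hv => Or.inl (hu v hv)) (by
      have hadj : (R.induce {w, w'}).Adj w w' := ⟨e, hl, Or.inl rfl, Or.inr rfl⟩
      refine ⟨⟨⟨w, Or.inl rfl⟩, ?_⟩, ?_⟩
      · rintro x (rfl | rfl) y (rfl | rfl)
        exacts [.refl, .single hadj, .single hadj.symm, .refl]
      · rintro v ⟨hv, x, hx, y, hy, hxv, hyv, -, hn⟩
        have hxy : x = y := by
          rcases hv with rfl | rfl <;> rcases hx with rfl | rfl <;> rcases hy with rfl | rfl <;>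
            first | rfl | exact (hxv rfl).elim | exact (hyv rfl).elim
        subst hxy
        exact hn .refl)
    exact hw' (hle.vertexSet_mono (Or.inr rfl))

/-- At most one vertex of a leaf-block is incident with edges outside of it. -/
lemma IsLeafBlock.eq_of_edges {R H : Graph α β} {t : β → Bool → α} (ht : Tips R t)
    (hH : IsLeafBlock R H) {e e' : β} (he : e ∈ E(R) \ E(H)) (he' : e' ∈ E(R) \ E(H))
    {b b' : Bool} (hb : t e b ∈ V(H)) (hb' : t e' b' ∈ V(H)) : t e b = t e' b' :=
  hH.2 ⟨hb, hH.1.isCutVertex_of_isLink (ht.isLink he.1 b) hb he.2⟩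
    ⟨hb', hH.1.isCutVertex_of_isLink (ht.isLink he'.1 b') hb' he'.2⟩

lemma exists_edge_of_degree_ne [Fintype β] {R H : Graph α β} {t : β → Bool → α} (ht : Tips R t)
    (hH : H ≤ R) {v : α} (h : degree R v ≠ degree H v) :
    ∃ e ∈ E(R) \ E(H), ∃ b, t e b = v := by
  have h1 := degree_add_halfSum_diff ht hH v
  exact exists_of_halfSum_ne_zero (A := ℕ) (c := fun _ _ => 1) (by omega)

/-- A usable negative cycle has at most one vertex whose degree in the whole graph is not two. -/
lemma IsLeafBlock.subsingleton_of_cycle [Finite α] [Fintype β] {R H C : Graph α β}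
    {t : β → Bool → α}
    (ht : Tips R t) (hH : IsLeafBlock R H) (hdeg : ∀ v ∈ V(R), degree R v ≤ 3) (hCH : C ≤ H)
    (hC : IsCycle C) (h1 : {v ∈ V(C) | degree H v ≠ 2}.ncard ≤ 1) :
    {v ∈ V(C) | degree R v ≠ 2}.Subsingleton := by
  have hHR := hH.1.1.1
  have htH := ht.mono hHR
  have hsub : ∀ v w, v ∈ V(C) → degree H v ≠ 2 → w ∈ V(C) → degree H w ≠ 2 → v = w :=
    fun v w hv hv' hw hw' => (Set.ncard_le_one (Set.toFinite _)).1 h1 v ⟨hv, hv'⟩ w ⟨hw, hw'⟩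
  by_cases hw : ∃ w ∈ V(C), degree H w ≠ 2
  · obtain ⟨w, hw, hdw⟩ := hw
    -- Suppose that `C` has a second vertex `u`. All vertices of `C` other than `w` have degree two
    -- in `H`, so the third edge at `w` leaves `C`, and `w` separates its far end from `u` within
    -- the block. Hence `C` is a loop at `w`.
    have hCw : ∀ u ∈ V(C), u = w := by
      by_contra! hu
      obtain ⟨u, hu, huw⟩ := hu
      have hCdeg := degree_add_halfSum_diff htH hCH w
      rw [hC.2 w hw] at hCdeg
      have h3 := (degree_mono ht hHR w).trans (hdeg w (hHR.vertexSet_mono (hCH.vertexSet_mono hw)))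
      obtain ⟨e, he, b, hb, huniq⟩ := exists_halfSum_one_eq
        (show halfSum t (E(H) \ E(C)) (fun _ _ => 1) w = 1 by omega)
      have hin : ∀ f ∈ E(H), ∀ b, t f b ∈ V(C) → t f b ≠ w → f ∈ E(C) := by
        intro f hf b' hfC hfw
        have hd : degree H (t f b') = 2 := by
          by_contra hd
          exact hfw (hsub _ _ hfC hd hw hdw)
        exact mem_of_degree_le htH hCH (by rw [hd, hC.2 _ hfC]) hf rfl
      have hout : t e (!b) ∉ V(C) := by
        intro hbC
        by_cases hbw : t e (!b) = w
        · have := (huniq e he (!b) hbw).2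
          simp at this
        · exact he.2 (hin e he.1 (!b) hbC hbw)
      refine hH.1.1.2.2 w ⟨hCH.vertexSet_mono hw, u, hCH.vertexSet_mono hu, t e (!b),
        htH.mem he.1 _, huw, fun h => hout (h ▸ hw),
        hH.1.1.2.1.2 _ (hCH.vertexSet_mono hu) _ (htH.mem he.1 _), fun hr => hout ?_⟩
      unfold Reach at hr
      generalize t e (!b) = z at hr
      induction hr with
      | refl => exact hu
      | tail _ hbc ih =>
        obtain ⟨f, hf⟩ := hbc
        rw [Graph.deleteVerts_isLink] at hf
        obtain ⟨b', hb1, hb2⟩ := htH.exists_of_isLink hf.1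
        have hfC := hin f hf.1.edge_mem b' (hb1 ▸ ih) (hb1 ▸ hf.2.1)
        rw [← hb2]
        exact (htH.mono hCH).mem hfC _
    exact fun x hx y hy => (hCw x hx.1).trans (hCw y hy.1).symm
  · push Not at hw
    rintro x ⟨hx, hdx⟩ y ⟨hy, hdy⟩
    obtain ⟨e, he, b, rfl⟩ := exists_edge_of_degree_ne ht hHR (by rw [hw x hx]; exact hdx)
    obtain ⟨e', he', b', rfl⟩ := exists_edge_of_degree_ne ht hHR (by rw [hw y hy]; exact hdy)
    exact hH.eq_of_edges ht he he' (hCH.vertexSet_mono hx) (hCH.vertexSet_mono hy)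

/-- A preflow extends over a good cycle of a leaf-block. -/
lemma IsHalfPreflowOff.exists_of_good [Fintype α] [Fintype β] {σ : β → ℤˣ} {S Z : Set β}
    {t : β → Bool → α} {R H C : Graph α β} (ht : Tips R t) (hH : IsLeafBlock R H)
    (hdeg : ∀ v ∈ V(R), degree R v ≤ 3) (hCH : C ≤ H) (hcyc : IsCycle C)
    (h2 : 2 ≤ {v ∈ V(C) | degree H v = 2}.ncard) (hZ : E(C) ⊆ Z) (hS : ∀ e ∈ E(C), e ∉ S)
    {c : β → Bool → ZMod 3} (hc : IsHalfPreflowOff σ S Z t R C c) :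
    ∃ f, IsHalfPreflow σ S Z t R f := by
  have hHR := hH.1.1.1
  have hCR := hCH.trans hHR
  obtain ⟨x, ⟨hx, hdx⟩, y, ⟨hy, hdy⟩, hxy⟩ := (Set.one_lt_ncard (Set.toFinite _)).1 h2
  -- A vertex whose degree in `R` exceeds that in `H` has an edge leaving the leaf-block; `x` and
  -- `y` cannot both be such vertices.
  wlog hRx : degree R x = 2 generalizing x y
  · by_cases hRy : degree R y = 2
    · exact this y hy hdy x hxy.symm hx hdx hRy
    · obtain ⟨e, he, b, rfl⟩ := exists_edge_of_degree_ne ht hHR (by rw [hdx]; exact hRx)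
      obtain ⟨e', he', b', rfl⟩ := exists_edge_of_degree_ne ht hHR (by rw [hdy]; exact hRy)
      exact (hxy (hH.eq_of_edges ht he he' (hCH.vertexSet_mono hx) (hCH.vertexSet_mono hy))).elim
  by_cases hRy : degree R y = 2
  · exact hc.exists_of_two_free ht hCR hcyc hZ hS hx hy hxy hRx hRy
  have hRy3 : degree R y = 3 := by
    have h1 := degree_mono ht hHR y
    have h2 := hdeg y (hCR.vertexSet_mono hy)
    omega
  obtain ⟨e, he, b, hb⟩ := exists_edge_of_degree_ne ht hHR (v := y) (by rw [hdy]; exact hRy)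
  have hyH : y ∈ V(H) := hCH.vertexSet_mono hy
  have hlink : R.IsLink e y (t e !b) := hb ▸ ht.isLink he.1 b
  have hAH : ∀ v, Reach (R.deleteVerts {y}) (t e !b) v → v ∉ V(H) :=
    fun v hv => hH.1.notMem_of_reach hlink hyH he.2 hv
  -- The set to be negated consists of what the third edge at `y` leads to once `y` is deleted. It
  -- avoids `H`, since `y` separates it from the block.
  refine hc.exists_of_bridge ht hCR hcyc hZ hS hx hy hxy hRx hRy3
    (A := {v | Reach (R.deleteVerts {y}) (t e !b) v})
    (fun v hv hvA => hAH v hvA (hCH.vertexSet_mono hv)) (fun f hf b' hfA => ?_)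
    (fun f hf b' hb' => ?_)
  · by_cases hfy : t f (!b') = y
    · exact Or.inr hfy
    · refine Or.inl (Relation.ReflTransGen.tail hfA ⟨f, ?_⟩)
      rw [Graph.deleteVerts_isLink]
      exact ⟨ht.isLink hf b', fun h => hAH _ hfA (h ▸ hyH), hfy⟩
  · have hd := degree_add_halfSum_diff ht hCR y
    rw [hRy3, hcyc.2 y hy] at hd
    obtain ⟨e₁, -, b₁, -, huniq⟩ := exists_halfSum_one_eq
      (show halfSum t (E(R) \ E(C)) (fun _ _ => 1) y = 1 by omega)
    obtain ⟨rfl, rfl⟩ := huniq f hf b' hb'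
    obtain ⟨rfl, rfl⟩ := huniq e ⟨he.1, fun h => he.2 (hCH.edgeSet_mono h)⟩ b hb
    exact .refl

end CycleSelection

/-! ### Balance, and the explicit preflow of a fish. -/

namespace CycleSelection

open scoped Classical

variable {α β : Type*}

/-- Switching by `u` makes all edges positive exactly when `u` multiplies to the sign along every
edge, because signs are their own inverses. -/
lemma balanced_iff {K : Graph α β} {t : β → Bool → α} (ht : Tips K t) {σ : β → ℤˣ} :
    Balanced σ K ↔ ∃ u : α → ℤˣ, ∀ e ∈ E(K), u (t e false) * u (t e true) = σ e := by
  constructor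
  · rintro ⟨τ, ⟨u, hu⟩, hτ⟩
    refine ⟨u, fun e he => ?_⟩
    have h := hu e _ _ (ht e he)
    rw [hτ e he] at h
    calc u (t e false) * u (t e true)
        = u (t e false) * 1 * u (t e true) := by rw [mul_one]
      _ = (u (t e false) * u (t e false)) * σ e * (u (t e true) * u (t e true)) := by
          rw [h]; ac_rfl
      _ = σ e := by rw [Int.units_mul_self, Int.units_mul_self, one_mul, mul_one]
  · rintro ⟨u, hu⟩
    refine ⟨fun _ => 1, ⟨u, fun e x y hl => ?_⟩, fun _ _ => rfl⟩
    obtain ⟨b, rfl, rfl⟩ := ht.exists_of_isLink hl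
    have h := hu e hl.edge_mem
    rw [← h]
    cases b
    · calc (1 : ℤˣ) = (u (t e false) * u (t e false)) * (u (t e true) * u (t e true)) := by
            rw [Int.units_mul_self, Int.units_mul_self, one_mul]
        _ = _ := by rw [Bool.not_false]; ac_rfl
    · calc (1 : ℤˣ) = (u (t e false) * u (t e false)) * (u (t e true) * u (t e true)) := by
            rw [Int.units_mul_self, Int.units_mul_self, one_mul]
        _ = _ := by rw [Bool.not_true]; ac_rfl

/-- Multiplying vertex signs by the switching function converts witnesses of balance for one
signature into witnesses for the other. -/
lemma SwitchEquivalent.balanced_iff {R K : Graph α β} {t : β → Bool → α} (ht : Tips R t)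
    {σ τ : β → ℤˣ} (h : SwitchEquivalent R σ τ) (hK : K ≤ R) : Balanced τ K ↔ Balanced σ K := by
  obtain ⟨s, hs⟩ := h
  rw [CycleSelection.balanced_iff (ht.mono hK), CycleSelection.balanced_iff (ht.mono hK)]
  constructor
  · rintro ⟨u, hu⟩
    refine ⟨fun v => s v * u v, fun e he => ?_⟩
    have h1 := hs e _ _ (ht e (hK.edgeSet_mono he))
    calc s (t e false) * u (t e false) * (s (t e true) * u (t e true))
        = s (t e false) * s (t e true) * (u (t e false) * u (t e true)) := by ac_rfl
      _ = (s (t e false) * s (t e false)) * (s (t e true) * s (t e true)) * σ e := by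
          rw [hu e he, h1]; ac_rfl
      _ = σ e := by rw [Int.units_mul_self, Int.units_mul_self, one_mul, one_mul]
  · rintro ⟨u, hu⟩
    refine ⟨fun v => s v * u v, fun e he => ?_⟩
    have h1 := hs e _ _ (ht e (hK.edgeSet_mono he))
    rw [h1, ← hu e he]
    beta_reduce
    ac_rfl

/-- A path has an edge that joins its ends only if its length is one. -/
lemma IsPath.length_eq_one [Fintype α] [Fintype β] {K : Graph α β} {t : β → Bool → α}
    (ht : Tips K t) {p q : α} (hK : IsPath K p q) {e : β} (he : e ∈ E(K))
    (h : ∀ b, t e b = p ∨ t e b = q) : length K = 1 := by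
  have hcard := hK.ncard_eq ht
  obtain ⟨hconn, hp, hq, hpq, hdp, hdq, -⟩ := hK
  rw [degree_eq_halfSum ht] at hdp hdq
  obtain ⟨e₁, -, b₁, -, hu₁⟩ := exists_halfSum_one_eq hdp
  obtain ⟨e₂, -, b₂, -, hu₂⟩ := exists_halfSum_one_eq hdq
  have hends : ∀ z, z = p ∨ z = q → ∃ b, t e b = z := by
    have hp1 := fun b => hu₁ e he b
    have hq1 := fun b => hu₂ e he b
    rintro z (rfl | rfl)
    · by_contra! hc
      have h1 := (hq1 false ((h false).resolve_left (hc false))).2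
      have h2 := (hq1 true ((h true).resolve_left (hc true))).2
      exact absurd (h1.trans h2.symm) (by decide)
    · by_contra! hc
      have h1 := (hp1 false ((h false).resolve_right (hc false))).2
      have h2 := (hp1 true ((h true).resolve_right (hc true))).2
      exact absurd (h1.trans h2.symm) (by decide)
  -- The ends have degree one, so `e` is the only edge at either of them and no edge leaves `{p,
  -- q}`.
  have hV : V(K) = {p, q} := by
    refine Set.Subset.antisymm (fun z hz => ?_) (by rintro z (rfl | rfl) <;> assumption)
    by_contra hzn
    obtain ⟨e', he', b', h1, h2⟩ := hconn.exists_crossing ht (X := {p, q}) hp hz (Or.inl rfl) hzn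
    have hee : e' = e := by
      rcases h1 with h1 | h1
      · obtain ⟨b, hb⟩ := hends p (Or.inl rfl)
        exact (hu₁ e' he' b' h1).1.trans (hu₁ e he b hb).1.symm
      · obtain ⟨b, hb⟩ := hends q (Or.inr rfl)
        exact (hu₂ e' he' b' h1).1.trans (hu₂ e he b hb).1.symm
    subst hee
    exact h2 (h (!b'))
  rw [hV, Set.ncard_pair hpq] at hcard
  unfold length
  omega

/-- The edges and vertices of a fish. The edge `e₀` joins the ends of the path `P`. -/
structure IsFishShape (t : β → Bool → α) (R B₁ B₂ B₃ P : Graph α β) (p q x y : α) (e₀ : β) :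
    Prop where
  le₁ : B₁ ≤ R
  le₂ : B₂ ≤ R
  le₃ : B₃ ≤ R
  leP : P ≤ R
  path₁ : IsPath B₁ p q
  path₂ : IsPath B₂ p q
  path₃ : IsPath B₃ p q
  pathP : IsPath P x y
  inter₁₂ : V(B₁) ∩ V(B₂) = {p, q}
  inter₁₃ : V(B₁) ∩ V(B₃) = {p, q}
  inter₂₃ : V(B₂) ∩ V(B₃) = {p, q}
  interP : V(P) ∩ (V(B₁) ∪ V(B₂) ∪ V(B₃)) = {x, y}
  verts₃ : V(B₃) = {p, q, x, y}
  verts : V(R) = V(B₁) ∪ V(B₂) ∪ V(B₃) ∪ V(P)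
  edges : E(R) = E(B₁) ∪ E(B₂) ∪ E(B₃) ∪ E(P)
  disj₁₂ : Disjoint E(B₁) E(B₂)
  disj₃ : Disjoint (E(B₁) ∪ E(B₂)) E(B₃)
  disjP : Disjoint (E(B₁) ∪ E(B₂) ∪ E(B₃)) E(P)
  mem : e₀ ∈ E(B₃)
  link : ∃ b, t e₀ b = x ∧ t e₀ (!b) = y
  other : ∀ e ∈ E(B₃), e ≠ e₀ → ∃ b, (t e b = p ∨ t e b = q) ∧ (t e (!b) = x ∨ t e (!b) = y)
  x_ne : x ≠ p ∧ x ≠ q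
  y_ne : y ≠ p ∧ y ≠ q

/-- Two paths that share no more than their common ends are edge-disjoint. -/
lemma IsPath.disjoint_edgeSet [Fintype α] [Fintype β] {K L : Graph α β} {t : β → Bool → α}
    (hK : Tips K t) (hL : Tips L t) {p q : α} (hp : IsPath K p q) (hlen : length K ≠ 1)
    (hinter : V(K) ∩ V(L) ⊆ {p, q}) : Disjoint E(K) E(L) :=
  Set.disjoint_left.2 fun _ h1 h2 =>
    hlen (hp.length_eq_one hK h1 fun b => hinter ⟨hK.mem h1 b, hL.mem h2 b⟩)

/-- `p` and `q` have degree three in the theta, so they differ from `x` and `y`. A branch of length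
two has only three vertices and cannot contain both `x` and `y` besides its ends. Hence the edge
`xy` lies on the branch of length three, whose inner vertices are `x` and `y`, and its other two
edges each join one of `p`, `q` to one of `x`, `y`. -/
lemma exists_isFishShape [Fintype α] [Fintype β] {R H P B₁ B₂ B₃ : Graph α β} {t : β → Bool → α}
    (ht : Tips R t) (hH : H ≤ R) (hP : P ≤ R) {p q x y : α} (hB₁ : B₁ ≤ H) (hB₂ : B₂ ≤ H)
    (hB₃ : B₃ ≤ H) (h₁ : IsPath B₁ p q) (h₂ : IsPath B₂ p q) (h₃ : IsPath B₃ p q)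
    (l₁ : length B₁ = 2) (l₂ : length B₂ = 2) (l₃ : length B₃ = 3)
    (i₁₂ : V(B₁) ∩ V(B₂) = {p, q}) (i₁₃ : V(B₁) ∩ V(B₃) = {p, q})
    (i₂₃ : V(B₂) ∩ V(B₃) = {p, q}) (hV : V(H) = V(B₁) ∪ V(B₂) ∪ V(B₃))
    (hE : E(H) = E(B₁) ∪ E(B₂) ∪ E(B₃)) (hxy : IsPath P x y) (lP : 3 ≤ length P)
    (iP : V(P) ∩ V(H) = {x, y}) (hdx : degree H x = 2) (hdy : degree H y = 2)
    (hadj : H.Adj x y) (hVR : V(R) = V(H) ∪ V(P)) (hER : E(R) = E(H) ∪ E(P)) :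
    ∃ e₀, IsFishShape t R B₁ B₂ B₃ P p q x y e₀ := by
  have htH := ht.mono hH
  have ht₁ := htH.mono hB₁
  have ht₂ := htH.mono hB₂
  have ht₃ := htH.mono hB₃
  have htP := ht.mono hP
  have d₁₂ : Disjoint E(B₁) E(B₂) := h₁.disjoint_edgeSet ht₁ ht₂ (by omega) i₁₂.subset
  have d₁₃ : Disjoint E(B₁) E(B₃) := h₁.disjoint_edgeSet ht₁ ht₃ (by omega) i₁₃.subset
  have d₂₃ : Disjoint E(B₂) E(B₃) := h₂.disjoint_edgeSet ht₂ ht₃ (by omega) i₂₃.subset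
  have dPH : Disjoint E(P) E(H) := hxy.disjoint_edgeSet htP htH (by omega) iP.subset
  have d₃ : Disjoint (E(B₁) ∪ E(B₂)) E(B₃) := Set.disjoint_union_left.2 ⟨d₁₃, d₂₃⟩
  have hdeg : ∀ v, degree H v = degree B₁ v + degree B₂ v + degree B₃ v := by
    intro v
    rw [degree_eq_halfSum htH, hE, halfSum_union d₃, halfSum_union d₁₂, degree_eq_halfSum ht₁,
      degree_eq_halfSum ht₂, degree_eq_halfSum ht₃]
  obtain ⟨-, p₁, q₁, hpq, dp₁, dq₁, -⟩ := id h₁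
  obtain ⟨-, p₂, q₂, -, dp₂, dq₂, -⟩ := id h₂
  obtain ⟨-, p₃, q₃, -, dp₃, dq₃, -⟩ := id h₃
  have hp3 : degree H p = 3 := by rw [hdeg, dp₁, dp₂, dp₃]
  have hq3 : degree H q = 3 := by rw [hdeg, dq₁, dq₂, dq₃]
  have hxp : x ≠ p := by rintro rfl; omega
  have hxq : x ≠ q := by rintro rfl; omega
  have hyp : y ≠ p := by rintro rfl; omega
  have hyq : y ≠ q := by rintro rfl; omega
  have hxy' : x ≠ y := hxy.2.2.2.1
  have hfour : ({p, q, x, y} : Set α).ncard = 4 := by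
    rw [Set.ncard_insert_of_notMem, Set.ncard_insert_of_notMem, Set.ncard_pair hxy'] <;>
      simp [hpq, hxp.symm, hyp.symm, hxq.symm, hyq.symm]
  have hshort : ∀ B : Graph α β, Tips B t → IsPath B p q → length B = 2 → x ∈ V(B) →
      y ∈ V(B) → False := by
    intro B htB hB hl hx hy
    have hc := hB.ncard_eq htB
    have hsub : ({p, q, x, y} : Set α) ⊆ V(B) := by
      rintro v (rfl | rfl | rfl | rfl)
      exacts [hB.2.1, hB.2.2.1, hx, hy]
    have := Set.ncard_le_ncard hsub
    unfold length at hl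
    omega
  obtain ⟨e₀, he₀⟩ := hadj
  have he₃ : e₀ ∈ E(B₃) := by
    have hmem := he₀.edge_mem
    rw [hE] at hmem
    rcases hmem with (h | h) | h
    · have hl := (Graph.IsSubgraph.isLink_iff hB₁ h).2 he₀
      exact (hshort B₁ ht₁ h₁ l₁ hl.left_mem hl.right_mem).elim
    · have hl := (Graph.IsSubgraph.isLink_iff hB₂ h).2 he₀
      exact (hshort B₂ ht₂ h₂ l₂ hl.left_mem hl.right_mem).elim
    · exact h
  have hl₀ := (Graph.IsSubgraph.isLink_iff hB₃ he₃).2 he₀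
  have hV₃ : V(B₃) = {p, q, x, y} := by
    symm
    refine Set.eq_of_subset_of_ncard_le ?_ ?_
    · rintro v (rfl | rfl | rfl | rfl)
      exacts [p₃, q₃, hl₀.left_mem, hl₀.right_mem]
    · rw [h₃.ncard_eq ht₃, hfour]
      unfold length at l₃
      omega
  obtain ⟨b₀, hb₀⟩ := ht₃.exists_of_isLink hl₀
  have hends₀ : ∀ b, t e₀ b = x ∨ t e₀ b = y := by
    intro b
    by_cases hb : b = b₀
    · rw [hb]; exact Or.inl hb₀.1
    · have : b = !b₀ := by revert hb; cases b <;> cases b₀ <;> simp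
      rw [this]; exact Or.inr hb₀.2
  have hnotboth : ∀ e ∈ E(B₃), ∀ b, (t e b = p ∨ t e b = q) →
      (t e (!b) = x ∨ t e (!b) = y) := by
    intro e he b hb
    have hm := ht₃.mem he (!b)
    rw [hV₃] at hm
    have hnot : ¬ (t e (!b) = p ∨ t e (!b) = q) := by
      intro hc
      have := h₃.length_eq_one ht₃ he fun b' => by
        by_cases hbb : b' = b
        · rw [hbb]; exact hb
        · have : b' = !b := by revert hbb; cases b' <;> cases b <;> simp
          rw [this]; exact hc
      omega
    rcases hm with h | h | h | h
    exacts [(hnot (Or.inl h)).elim, (hnot (Or.inr h)).elim, Or.inl h, Or.inr h]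
  rw [degree_eq_halfSum ht₃] at dp₃ dq₃
  obtain ⟨e₁, he₁, b₁, hb₁, -⟩ := exists_halfSum_one_eq dp₃
  obtain ⟨e₂, he₂, b₂, hb₂, -⟩ := exists_halfSum_one_eq dq₃
  have hend : ∀ b z, (z = p ∨ z = q) → t e₀ b ≠ z := by
    rintro b z (rfl | rfl) h
    · rcases hends₀ b with h' | h'
      exacts [hxp (h'.symm.trans h), hyp (h'.symm.trans h)]
    · rcases hends₀ b with h' | h'
      exacts [hxq (h'.symm.trans h), hyq (h'.symm.trans h)]
  have h01 : e₁ ≠ e₀ := by rintro rfl; exact hend b₁ p (Or.inl rfl) hb₁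
  have h02 : e₂ ≠ e₀ := by rintro rfl; exact hend b₂ q (Or.inr rfl) hb₂
  have h12 : e₁ ≠ e₂ := by
    rintro rfl
    by_cases hbb : b₂ = b₁
    · subst hbb; exact hpq (hb₁.symm.trans hb₂)
    · have : b₂ = !b₁ := by revert hbb; cases b₂ <;> cases b₁ <;> simp
      rw [this] at hb₂
      rcases hnotboth e₁ he₁ b₁ (Or.inl hb₁) with h | h
      exacts [hxq (h.symm.trans hb₂), hyq (h.symm.trans hb₂)]
  have hE₃ : E(B₃) = {e₀, e₁, e₂} := by
    symm
    refine Set.eq_of_subset_of_ncard_le ?_ ?_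
    · rintro e (rfl | rfl | rfl) <;> assumption
    · rw [Set.ncard_insert_of_notMem (by simp [h01.symm, h02.symm]), Set.ncard_pair h12]
      exact l₃.le
  refine ⟨e₀, ⟨hB₁.trans hH, hB₂.trans hH, hB₃.trans hH, hP, h₁, h₂, h₃, hxy, i₁₂, i₁₃, i₂₃,
    hV ▸ iP, hV₃, hV ▸ hVR, hE ▸ hER, d₁₂, d₃, hE ▸ dPH.symm, he₃, ⟨b₀, hb₀⟩, ?_, ⟨hxp, hxq⟩,
    ⟨hyp, hyq⟩⟩⟩
  intro e he hne
  rw [hE₃] at he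
  rcases he with rfl | rfl | rfl
  · exact (hne rfl).elim
  · exact ⟨b₁, Or.inl hb₁, hnotboth _ he₁ b₁ (Or.inl hb₁)⟩
  · exact ⟨b₂, Or.inr hb₂, hnotboth _ he₂ b₂ (Or.inr hb₂)⟩

section Shape

variable [Fintype β] {t : β → Bool → α} {R B₁ B₂ B₃ P : Graph α β} {p q x y : α} {e₀ : β}

lemma IsPath.degree_eq {K : Graph α β} (ht : Tips K t) (hK : IsPath K p q) {v : α} (hp : v ≠ p)
    (hq : v ≠ q) : degree K v = 0 ∨ degree K v = 2 := by
  by_cases hv : v ∈ V(K)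
  · exact Or.inr (hK.2.2.2.2.2.2 v hv hp hq)
  · exact Or.inl (degree_of_notMem ht hv)

/-- The edge that joins the ends of the path of a fish lies in no 2-edge cut. -/
lemma IsFishShape.isDistinguishedEdge [Fintype α] (ht : Tips R t)
    (h : IsFishShape t R B₁ B₂ B₃ P p q x y e₀) : IsDistinguishedEdge R e₀ := by
  have ht₁ := ht.mono h.le₁
  have ht₃ := ht.mono h.le₃
  have htP := ht.mono h.leP
  have hcross : ∀ (X : Set α) (e : β), e ∈ E(R) → (∃ b, t e b ∈ X ∧ t e (!b) ∉ X) →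
      e ∈ edgeCut R X := fun X e he ⟨b, h1, h2⟩ => ⟨_, _, ht.isLink he b, h1, h2⟩
  refine ⟨h.le₃.edgeSet_mono h.mem, fun X hX hmem => ?_⟩
  obtain ⟨x', y', hl, hx', hy'⟩ := hmem
  obtain ⟨b, rfl, rfl⟩ := ht.exists_of_isLink hl
  -- A cut through `e₀` meets the cycle `B₁ ∪ B₃` a second time by parity. It also meets `P`,
  -- because it separates the ends of `P`. This gives three distinct edges.
  obtain ⟨e₁, he₁, hne₁, hc₁⟩ := exists_other_crossing (t := t) (F := E(B₁) ∪ E(B₃)) (X := X)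
    (fun v _ => by
      rw [halfSum_union (h.disj₃.mono_left Set.subset_union_left), ← degree_eq_halfSum ht₁,
        ← degree_eq_halfSum ht₃]
      by_cases hp : v = p
      · rw [hp, h.path₁.2.2.2.2.1, h.path₃.2.2.2.2.1]; decide
      · by_cases hq : v = q
        · rw [hq, h.path₁.2.2.2.2.2.1, h.path₃.2.2.2.2.2.1]; decide
        · rcases h.path₁.degree_eq ht₁ hp hq with h1 | h1 <;>
            rcases h.path₃.degree_eq ht₃ hp hq with h3 | h3 <;> rw [h1, h3] <;> decide)
    (Or.inr h.mem) hx' hy'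
  obtain ⟨e₂, he₂, hc₂⟩ : ∃ e ∈ E(P), ∃ b, t e b ∈ X ∧ t e (!b) ∉ X := by
    have hends : ∀ c, t e₀ c ∈ V(P) := by
      obtain ⟨b₁, h1, h2⟩ := h.link
      intro c
      by_cases hc : c = b₁
      · rw [hc, h1]; exact h.pathP.2.1
      · have : c = !b₁ := by revert hc; cases c <;> cases b₁ <;> simp
        rw [this, h2]; exact h.pathP.2.2.1
    exact h.pathP.1.exists_crossing htP (hends b) (hends (!b)) hx' hy'
  have hmem₁ : e₁ ∈ E(B₁) ∪ E(B₂) ∪ E(B₃) := he₁.elim (fun h => Or.inl (Or.inl h)) Or.inr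
  have hne₂ : e₂ ≠ e₀ := by
    rintro rfl; exact Set.disjoint_left.1 h.disjP (Or.inr h.mem) he₂
  have hne₁₂ : e₁ ≠ e₂ := by
    rintro rfl; exact Set.disjoint_left.1 h.disjP hmem₁ he₂
  have hsub : ({e₀, e₁, e₂} : Set β) ⊆ edgeCut R X := by
    rintro e (rfl | rfl | rfl)
    · exact hcross X _ (h.le₃.edgeSet_mono h.mem) ⟨b, hx', hy'⟩
    · exact hcross X _ (h.edges ▸ Or.inl hmem₁) hc₁
    · exact hcross X _ (h.leP.edgeSet_mono he₂) hc₂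
  have := Set.ncard_le_ncard hsub
  rw [Set.ncard_insert_of_notMem (by simp [hne₁.symm, hne₂.symm]), Set.ncard_pair hne₁₂, hX] at this
  omega

/-- The preflow of a fish, given the signs of its half-edges. -/
lemma IsFishShape.exists_halfPreflow (ht : Tips R t)
    (h : IsFishShape t R B₁ B₂ B₃ P p q x y e₀) {σ : β → ℤˣ} {S Z : Set β} (hS : ∀ e ∈ E(R), e ∉ S)
    (hZ : e₀ ∈ Z) {u s₁ s₂ sP : α → ℤˣ}
    (hu : ∀ e ∈ E(B₃), u (t e false) * u (t e true) = σ e)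
    (h₁ : ∀ e ∈ E(B₁), s₁ (t e false) * s₁ (t e true) = - σ e) (hp₁ : s₁ p = u p)
    (hq₁ : s₁ q = u q)
    (h₂ : ∀ e ∈ E(B₂), s₂ (t e false) * s₂ (t e true) = - σ e) (hp₂ : s₂ p = u p)
    (hq₂ : s₂ q = u q)
    (hP : ∀ e ∈ E(P), sP (t e false) * sP (t e true) = - σ e) (hxP : sP x = u x)
    (hyP : sP y = u y) :
    ∃ f, IsHalfPreflow σ S Z t R f := by
  have ht₁ := ht.mono h.le₁
  have ht₂ := ht.mono h.le₂
  have ht₃ := ht.mono h.le₃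
  have htP := ht.mono h.leP
  -- On `B₁`, `B₂` and `P`, both half-edges at an inner vertex agree, so its boundary is twice a
  -- sign. At `p` and `q` the three branches all contribute `u`, which sums to zero. The two edges
  -- of `B₃` other than `e₀` change from `u` at `p` or `q` to `-u` at `x` or `y`, where they cancel
  -- the value `u` coming from `P`, since `e₀` carries zero.
  let c : β → Bool → ZMod 3 := fun e b =>
    if e = e₀ then 0
    else if e ∈ E(B₁) then sg (s₁ (t e b))
    else if e ∈ E(B₂) then sg (s₂ (t e b))
    else if e ∈ E(P) then sg (sP (t e b))
    else if t e b = p ∨ t e b = q then sg (u (t e b)) else - sg (u (t e b))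
  have n₁ : ∀ e ∈ E(B₁), e ≠ e₀ := by
    rintro e he rfl; exact Set.disjoint_left.1 h.disj₃ (Or.inl he) h.mem
  have n₂ : ∀ e ∈ E(B₂), e ≠ e₀ := by
    rintro e he rfl; exact Set.disjoint_left.1 h.disj₃ (Or.inr he) h.mem
  have nP : ∀ e ∈ E(P), e ≠ e₀ := by
    rintro e he rfl; exact Set.disjoint_left.1 h.disjP (Or.inr h.mem) he
  have c₁ : ∀ e ∈ E(B₁), ∀ b, c e b = sg (s₁ (t e b)) := fun e he b => by
    simp only [c, n₁ e he, he, if_true, if_false]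
  have c₂ : ∀ e ∈ E(B₂), ∀ b, c e b = sg (s₂ (t e b)) := fun e he b => by
    have : e ∉ E(B₁) := fun h' => Set.disjoint_left.1 h.disj₁₂ h' he
    simp only [c, n₂ e he, he, this, if_true, if_false]
  have cP : ∀ e ∈ E(P), ∀ b, c e b = sg (sP (t e b)) := fun e he b => by
    have h1 : e ∉ E(B₁) := fun h' => Set.disjoint_left.1 h.disjP (Or.inl (Or.inl h')) he
    have h2 : e ∉ E(B₂) := fun h' => Set.disjoint_left.1 h.disjP (Or.inl (Or.inr h')) he
    simp only [c, nP e he, he, h1, h2, if_true, if_false]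
  have c₃ : ∀ e ∈ E(B₃), e ≠ e₀ → ∀ b, c e b =
      if t e b = p ∨ t e b = q then sg (u (t e b)) else - sg (u (t e b)) := fun e he hne b => by
    have h1 : e ∉ E(B₁) := fun h' => Set.disjoint_left.1 h.disj₃ (Or.inl h') he
    have h2 : e ∉ E(B₂) := fun h' => Set.disjoint_left.1 h.disj₃ (Or.inr h') he
    have h3 : e ∉ E(P) := fun h' => Set.disjoint_left.1 h.disjP (Or.inr he) h'
    simp only [c, hne, h1, h2, h3, if_false]
  have c₀ : ∀ b, c e₀ b = 0 := fun b => by simp only [c, if_true]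
  have rel_of : ∀ (s : α → ℤˣ) (e : β), s (t e false) * s (t e true) = - σ e →
      sg (s (t e true)) = sg (- σ e) * sg (s (t e false)) := by
    intro s e hs
    rw [← hs, sg_mul]
    linear_combination - sg (s (t e true)) * sg_mul_self (s (t e false))
  have hxy : ∀ z, z = x ∨ z = y → ¬ (z = p ∨ z = q) := by
    rintro z (rfl | rfl) (h' | h')
    exacts [h.x_ne.1 h', h.x_ne.2 h', h.y_ne.1 h', h.y_ne.2 h']
  have sum_eq : ∀ v, halfSum t E(R) c v = degree B₁ v • sg (s₁ v) + degree B₂ v • sg (s₂ v) +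
      halfSum t E(B₃) c v + degree P v • sg (sP v) := by
    intro v
    rw [h.edges, halfSum_union h.disjP, halfSum_union h.disj₃, halfSum_union h.disj₁₂,
      halfSum_eq_degree_nsmul ht₁ (a := sg (s₁ v)) (fun e he b hb => by rw [c₁ e he, hb]),
      halfSum_eq_degree_nsmul ht₂ (a := sg (s₂ v)) (fun e he b hb => by rw [c₂ e he, hb]),
      halfSum_eq_degree_nsmul htP (a := sg (sP v)) (fun e he b hb => by rw [cP e he, hb])]
  have deg_eq : ∀ v, degree R v = degree B₁ v + degree B₂ v + degree B₃ v + degree P v := by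
    intro v
    rw [degree_eq_halfSum ht, h.edges, halfSum_union h.disjP, halfSum_union h.disj₃,
      halfSum_union h.disj₁₂, degree_eq_halfSum ht₁, degree_eq_halfSum ht₂,
      degree_eq_halfSum ht₃, degree_eq_halfSum htP]
  have two_ne : ∀ w : ℤˣ, 2 • sg w ≠ 0 := by
    intro w
    have h0 := sg_ne_zero w
    generalize sg w = z at h0
    revert z; decide
  have three_eq : ∀ z : ZMod 3, z + z + z = 0 := by decide
  obtain ⟨b₀, hb₀x, hb₀y⟩ := h.link
  have hends₀ : ∀ b, t e₀ b = x ∨ t e₀ b = y := by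
    intro b
    by_cases hb : b = b₀
    · rw [hb]; exact Or.inl hb₀x
    · have : b = !b₀ := by revert hb; cases b <;> cases b₀ <;> simp
      rw [this]; exact Or.inr hb₀y
  have notMem₁ : ∀ v, v ∈ V(B₃) → v ≠ p → v ≠ q → v ∉ V(B₁) := fun v hv h1 h2 hv' => by
    have : v ∈ ({p, q} : Set α) := h.inter₁₃ ▸ ⟨hv', hv⟩
    exact this.elim h1 h2
  have notMem₂ : ∀ v, v ∈ V(B₃) → v ≠ p → v ≠ q → v ∉ V(B₂) := fun v hv h1 h2 hv' => by
    have : v ∈ ({p, q} : Set α) := h.inter₂₃ ▸ ⟨hv', hv⟩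
    exact this.elim h1 h2
  have notMemP : ∀ v, v ∈ V(B₁) ∪ V(B₂) ∪ V(B₃) → v ≠ x → v ≠ y → v ∉ V(P) :=
    fun v hv h1 h2 hv' => by
      have : v ∈ ({x, y} : Set α) := h.interP ▸ ⟨hv', hv⟩
      exact this.elim h1 h2
  have hpq_bd : ∀ v, (v = p ∨ v = q) → s₁ v = u v → s₂ v = u v → degree B₁ v = 1 →
      degree B₂ v = 1 → degree B₃ v = 1 → v ∈ V(B₃) →
      (halfSum t E(R) c v ≠ 0 ↔ degree R v = 1 ∨ degree R v = 2) := by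
    intro v hv e1 e2 d1 d2 d3 hv3
    have dP : degree P v = 0 := degree_of_notMem htP
      (notMemP v (Or.inr hv3) (fun h' => hxy v (Or.inl h') hv) (fun h' => hxy v (Or.inr h') hv))
    have s3 : halfSum t E(B₃) c v = sg (u v) := by
      rw [halfSum_eq_degree_nsmul ht₃ (a := sg (u v)), d3, one_smul]
      intro e he b hb
      have hne : e ≠ e₀ := by
        rintro rfl
        exact hxy v (hb ▸ hends₀ b) hv
      rw [c₃ e he hne, hb, if_pos hv]
    rw [sum_eq, deg_eq, s3, d1, d2, d3, dP, e1, e2, one_smul, zero_smul, add_zero, three_eq]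
    simp
  have hxy_bd : ∀ v b, (v = x ∨ v = y) → t e₀ b = v → t e₀ (!b) ≠ v → sP v = u v →
      degree P v = 1 → v ∈ V(B₃) →
      (halfSum t E(R) c v ≠ 0 ↔ degree R v = 1 ∨ degree R v = 2) := by
    intro v b hv hb hb' eP dP hv3
    have hvp : v ≠ p := fun h' => hxy v hv (Or.inl h')
    have hvq : v ≠ q := fun h' => hxy v hv (Or.inr h')
    have d1 := degree_of_notMem ht₁ (notMem₁ v hv3 hvp hvq)
    have d2 := degree_of_notMem ht₂ (notMem₂ v hv3 hvp hvq)
    have d3 : degree B₃ v = 2 := h.path₃.2.2.2.2.2.2 v hv3 hvp hvq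
    have hsplit : E(B₃) = {e₀} ∪ E(B₃) \ {e₀} :=
      (Set.union_sdiff_cancel (Set.singleton_subset_iff.2 h.mem)).symm
    have hone : halfSum t {e₀} (fun _ _ => (1 : ℕ)) v = 1 := by
      unfold halfSum
      rw [Finset.sum_eq_single e₀ (fun e _ hne => by simp [hne])
        (fun h' => (h' (Finset.mem_univ _)).elim)]
      rw [Fintype.sum_bool]
      cases b
      · rw [if_neg fun h' => hb' h'.2, if_pos ⟨rfl, hb⟩, zero_add]
      · rw [if_pos ⟨rfl, hb⟩, if_neg fun h' => hb' h'.2, add_zero]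
    have hone' : halfSum t (E(B₃) \ {e₀}) (fun _ _ => (1 : ℕ)) v = 1 := by
      have := degree_eq_halfSum ht₃ v
      rw [hsplit, halfSum_union Set.disjoint_sdiff_right, hone, d3] at this
      omega
    have s3 : halfSum t E(B₃) c v = - sg (u v) := by
      rw [hsplit, halfSum_union Set.disjoint_sdiff_right, halfSum_eq_zero (F := {e₀}),
        halfSum_eq_nsmul (F := E(B₃) \ {e₀}) (a := - sg (u v)), hone', one_smul, zero_add]
      · intro e he b hb
        rw [c₃ e he.1 he.2, hb, if_neg (hxy v hv)]
      · rintro e rfl b -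
        exact c₀ b
    rw [sum_eq, deg_eq, s3, d1, d2, d3, dP, eP, one_smul, zero_smul, zero_smul, zero_add, zero_add,
      neg_add_cancel]
    simp
  refine ⟨c, ⟨fun e he _ => ?_, fun e he heS => (hS e he heS).elim, fun e he b h0 => ?_,
    fun v hv => ?_⟩⟩
  · rw [h.edges] at he
    rcases he with ((he | he) | he) | he
    · rw [c₁ e he, c₁ e he, rel_of s₁ e (h₁ e he)]
    · rw [c₂ e he, c₂ e he, rel_of s₂ e (h₂ e he)]
    · by_cases hne : e = e₀
      · rw [hne, c₀, c₀, mul_zero]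
      · have hσ : sg (u (t e true)) = sg (σ e) * sg (u (t e false)) := by
          rw [← hu e he, sg_mul]
          linear_combination - sg (u (t e true)) * sg_mul_self (u (t e false))
        rw [c₃ e he hne, c₃ e he hne, sg_neg, hσ]
        obtain ⟨b, hb1, hb2⟩ := h.other e he hne
        have hb3 := hxy _ hb2
        cases b
        · rw [Bool.not_false] at hb3
          rw [if_neg hb3, if_pos hb1]; ring
        · rw [Bool.not_true] at hb3
          rw [if_pos hb1, if_neg hb3]; ring
    · rw [cP e he, cP e he, rel_of sP e (hP e he)]
  · by_cases hne : e = e₀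
    · rw [hne]; exact hZ
    · exfalso
      rw [h.edges] at he
      rcases he with ((he | he) | he) | he
      · exact sg_ne_zero _ ((c₁ e he b).symm.trans h0)
      · exact sg_ne_zero _ ((c₂ e he b).symm.trans h0)
      · rw [c₃ e he hne] at h0
        split_ifs at h0
        · exact sg_ne_zero _ h0
        · exact sg_ne_zero _ (neg_eq_zero.1 h0)
      · exact sg_ne_zero _ ((cP e he b).symm.trans h0)
  · obtain ⟨-, p₁, q₁, -, dp₁, dq₁, hd₁⟩ := h.path₁
    obtain ⟨-, p₂, q₂, -, dp₂, dq₂, hd₂⟩ := h.path₂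
    obtain ⟨-, p₃, q₃, -, dp₃, dq₃, hd₃⟩ := h.path₃
    obtain ⟨-, xP, yP, hxny, dxP, dyP, hdP⟩ := h.pathP
    by_cases hvp : v = p
    · subst hvp
      exact hpq_bd v (Or.inl rfl) hp₁ hp₂ dp₁ dp₂ dp₃ p₃
    by_cases hvq : v = q
    · subst hvq
      exact hpq_bd v (Or.inr rfl) hq₁ hq₂ dq₁ dq₂ dq₃ q₃
    by_cases hvx : v = x
    · subst hvx
      exact hxy_bd v b₀ (Or.inl rfl) hb₀x (hb₀y ▸ hxny.symm) hxP dxP (by rw [h.verts₃]; simp)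
    by_cases hvy : v = y
    · subst hvy
      exact hxy_bd v (!b₀) (Or.inr rfl) hb₀y (by rw [Bool.not_not, hb₀x]; exact hxny) hyP dyP
        (by rw [h.verts₃]; simp)
    have n3 : v ∉ V(B₃) := by rw [h.verts₃]; simp [hvp, hvq, hvx, hvy]
    have d3 := degree_of_notMem ht₃ n3
    have s3 := halfSum_of_notMem ht₃ c n3
    rw [sum_eq, deg_eq, s3, d3]
    rw [h.verts] at hv
    rcases hv with ((hv | hv) | hv) | hv
    · have n2 : v ∉ V(B₂) := fun hv' => by
        have : v ∈ ({p, q} : Set α) := h.inter₁₂ ▸ ⟨hv, hv'⟩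
        exact this.elim hvp hvq
      rw [degree_of_notMem ht₂ n2,
        degree_of_notMem htP (notMemP v (Or.inl (Or.inl hv)) hvx hvy), hd₁ v hv hvp hvq]
      simpa using two_ne (s₁ v)
    · have n1 : v ∉ V(B₁) := fun hv' => by
        have : v ∈ ({p, q} : Set α) := h.inter₁₂ ▸ ⟨hv', hv⟩
        exact this.elim hvp hvq
      rw [degree_of_notMem ht₁ n1,
        degree_of_notMem htP (notMemP v (Or.inl (Or.inr hv)) hvx hvy), hd₂ v hv hvp hvq]
      simpa using two_ne (s₂ v)
    · exact (n3 hv).elim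
    · have n1 : v ∉ V(B₁) := fun hv' => notMemP v (Or.inl (Or.inl hv')) hvx hvy hv
      have n2 : v ∉ V(B₂) := fun hv' => notMemP v (Or.inl (Or.inr hv')) hvx hvy hv
      rw [degree_of_notMem ht₁ n1, degree_of_notMem ht₂ n2, hdP v hv hvx hvy]
      simpa using two_ne (sP v)

end Shape

lemma sign_neg [Fintype β] (σ : β → ℤˣ) (K : Graph α β) :
    sign (fun e => - σ e) K = (-1) ^ length K * sign σ K := by
  have := sign_twist σ ∅ K
  simpa using this

/-- A signed graph that is switching equivalent to a fish has a preflow whose zeros are confined to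
the distinguished edge. -/
lemma exists_halfPreflow_of_fish [Fintype α] [Fintype β] {R : Graph α β} {t : β → Bool → α}
    (ht : Tips R t) {σ τ : β → ℤˣ} (hsw : SwitchEquivalent R σ τ) (hfish : IsFish τ R)
    {S Z : Set β} (hS : ∀ e ∈ E(R), e ∉ S) (hZ : ∀ e, IsDistinguishedEdge R e → e ∈ Z) :
    ∃ f, IsHalfPreflow σ S Z t R f := by
  obtain ⟨H, hH, P, hP, ⟨p, q, B₁, hB₁, B₂, hB₂, B₃, hB₃, h₁, h₂, h₃, l₁, l₂, l₃, i₁₂, i₁₃, i₂₃,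
    hV, hE⟩, ⟨x, y, hxy, lodd, lP, iP, hdx, hdy, hadj⟩, hVR, hER, hbal, hunb⟩ := hfish
  obtain ⟨e₀, hs⟩ := exists_isFishShape ht hH hP hB₁ hB₂ hB₃ h₁ h₂ h₃ l₁ l₂ l₃ i₁₂ i₁₃ i₂₃ hV hE
    hxy lP iP hdx hdy hadj hVR hER
  rw [hsw.balanced_iff ht hH, balanced_iff (ht.mono hH)] at hbal
  rw [hsw.balanced_iff ht le_rfl, balanced_iff ht] at hunb
  obtain ⟨u, hu⟩ := hbal
  have ht₁ := ht.mono hs.le₁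
  have ht₂ := ht.mono hs.le₂
  have htP := ht.mono hP
  -- Negating the signature leaves the sign of a path of length two unchanged, so vertex signs for
  -- `-σ` can agree with `u` at both ends.
  have branch : ∀ B : Graph α β, Tips B t → B ≤ H → IsPath B p q → length B = 2 →
      ∃ s : α → ℤˣ, (∀ e ∈ E(B), s (t e false) * s (t e true) = - σ e) ∧ s p = u p ∧
        s q = u q := by
    intro B htB hBH hB hl
    refine hB.exists_signs htB (fun e => - σ e) ?_
    rw [sign_neg, hl, hB.mul_eq_sign htB fun e he => hu e (hBH.edgeSet_mono he)]
    simp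
  obtain ⟨s₁, hs₁, hp₁, hq₁⟩ := branch B₁ ht₁ hB₁ h₁ l₁
  obtain ⟨s₂, hs₂, hp₂, hq₂⟩ := branch B₂ ht₂ hB₂ h₂ l₂
  -- Otherwise `u` would extend along `P` to a witness that the whole graph is balanced.
  have hsign : u x * u y ≠ sign σ P := by
    intro heq
    obtain ⟨r, hr, hrx, hry⟩ := hxy.exists_signs htP σ heq
    refine hunb ⟨fun v => if v ∈ V(H) then u v else r v, fun e he => ?_⟩
    rw [hER] at he
    beta_reduce
    rcases he with he | he
    · rw [if_pos ((ht.mono hH).mem he _), if_pos ((ht.mono hH).mem he _), hu e he]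
    · have hagree : ∀ v ∈ V(P), (if v ∈ V(H) then u v else r v) = r v := by
        intro v hv
        split_ifs with hvH
        · have : v ∈ ({x, y} : Set α) := iP ▸ ⟨hv, hvH⟩
          rcases this with rfl | rfl
          exacts [hrx.symm, hry.symm]
        · rfl
      rw [hagree _ (htP.mem he _), hagree _ (htP.mem he _), hr e he]
  -- The sign of `P` is opposite to `u x * u y`; as `P` has odd length, passing to `-σ` corrects
  -- exactly this.
  obtain ⟨sP, hsP, hxP, hyP⟩ := hxy.exists_signs htP (fun e => - σ e) (a := u x) (b := u y) (by
    rw [sign_neg, lodd.neg_one_pow, neg_one_mul]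
    exact Int.units_ne_iff_eq_neg.1 hsign)
  exact hs.exists_halfPreflow ht hS (hZ _ (hs.isDistinguishedEdge ht))
    (fun e he => hu e (hB₃.edgeSet_mono he)) hs₁ hp₁ hq₁ hs₂ hp₂ hq₂ hsP hxP hyP

end CycleSelection

/-! ### Reversing the algorithm. -/

namespace CycleSelection

open scoped Classical

variable {α β : Type*}

/-- The edges on which the preflow may vanish. -/
def zeroSet (L : List (Graph α β × CycleType)) : Set β :=
  {e | ∃ C, ((C, CycleType.negativeSpecial) ∈ L ∧ e ∈ E(C)) ∨
    ((C, CycleType.positive) ∈ L ∧ e ∈ E(C)) ∨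
    ((C, CycleType.fish) ∈ L ∧ IsDistinguishedEdge C e)}

/-- The subdivided edges are related to the members of the list as the subdivision of the output
of the algorithm requires. -/
structure IsCompatible (t : β → Bool → α) (S : Set β) (L : List (Graph α β × CycleType)) :
    Prop where
  touch : ∀ p ∈ L, ∀ e ∈ S, ∀ b, t e b ∈ V(p.1) → e ∈ E(p.1)
  none : ∀ C, ((C, CycleType.positive) ∈ L ∨ (C, CycleType.fish) ∈ L) → ∀ e ∈ E(C), e ∉ S
  odd : ∀ C, (C, CycleType.negativeOrdinary) ∈ L → Odd (length C + (S ∩ E(C)).ncard)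

/-- Members of the list are vertex-disjoint, so a subdivided edge touches only the member that
contains it. Thus positive cycles and fish contain no subdivided edge. A negative ordinary cycle
contains one if its length is even and none if it is odd, and so becomes odd in either case. -/
lemma IsSubdivisionChoice.isCompatible {G : Graph α β} {t : β → Bool → α} (ht : Tips G t)
    {L : List (Graph α β × CycleType)} (hle : ∀ p ∈ L, p.1 ≤ G)
    (hd : L.Pairwise fun p q => Disjoint V(p.1) V(q.1)) {S : Set β}
    (hS : IsSubdivisionChoice L S) : IsCompatible t S L := by
  have hdisj : ∀ p ∈ L, ∀ q ∈ L, p ≠ q → Disjoint V(p.1) V(q.1) := fun p hp q hq hne =>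
    List.Pairwise.forall (R := fun p q : Graph α β × CycleType => Disjoint V(p.1) V(q.1))
      hd hp hq hne
  have hS2 : ∀ e ∈ S, ∃ q ∈ L, e ∈ E(q.1) ∧ (q.2 = .negativeSpecial ∨
      (q.2 = .negativeOrdinary ∧ Even (length q.1))) := by
    intro e he
    obtain ⟨C, hC, heC⟩ := hS.2 e he
    rcases hC with hC | hC
    · exact ⟨_, hC, heC, Or.inl rfl⟩
    · exact ⟨_, hC.1, heC, Or.inr ⟨rfl, hC.2⟩⟩
  have huniq : ∀ p ∈ L, ∀ q ∈ L, ∀ e, ∀ b, e ∈ E(q.1) → t e b ∈ V(p.1) → p = q := by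
    intro p hp q hq e b he hb
    by_contra hne
    exact Set.disjoint_left.1 (hdisj p hp q hq hne) hb ((ht.mono (hle q hq)).mem he b)
  refine ⟨fun p hp e he b hb => ?_, fun C hC e heC heS => ?_, fun C hC => ?_⟩
  · obtain ⟨q, hq, heq, -⟩ := hS2 e he
    rw [huniq p hp q hq e b heq hb]
    exact heq
  · obtain ⟨q, hq, heq, ht'⟩ := hS2 e heS
    rcases hC with hC | hC
    · have := huniq _ hC q hq e false heq ((ht.mono (hle _ hC)).mem heC false)
      subst this
      simp at ht'
    · have := huniq _ hC q hq e false heq ((ht.mono (hle _ hC)).mem heC false)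
      subst this
      simp at ht'
  · by_cases heven : Even (length C)
    · obtain ⟨e, ⟨heS, heC⟩, hu⟩ := hS.1 C (Or.inr ⟨hC, heven⟩)
      have : S ∩ E(C) = {e} := by
        ext e'
        constructor
        · exact fun h => hu e' h
        · rintro rfl; exact ⟨heS, heC⟩
      rw [this, Set.ncard_singleton]
      exact heven.add_one
    · have : S ∩ E(C) = ∅ := by
        refine Set.eq_empty_of_forall_notMem fun e he => ?_
        obtain ⟨q, hq, heq, ht'⟩ := hS2 e he.1
        have := huniq _ hC q hq e false heq ((ht.mono (hle _ hC)).mem he.2 false)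
        subst this
        simp [heven] at ht'
      rw [this, Set.ncard_empty, add_zero]
      exact Nat.not_even_iff_odd.1 heven

lemma FinalStep.le {σ : β → ℤˣ} {R C : Graph α β} {k : ℕ} {ty : CycleType}
    (h : FinalStep σ R k C ty) : C ≤ R := by
  cases h with
  | fishOdd => exact le_rfl
  | fishEven _ _ _ hC => exact hC.1
  | special _ _ _ hp _ => exact hp.1.1
  | positive _ _ _ hp _ => exact hp.2.1.2.1

lemma Round.le {σ : β → ℤˣ} {R C : Graph α β} {k : ℕ} {ty : CycleType}
    (h : Round σ R k C ty) : C ≤ R := by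
  cases h with
  | usableNegative H _ hH _ hC _ =>
    exact (hC.elim (fun h => h.1) (fun h => h.1)).trans hH.1.1.1.1
  | usablePositive H _ hH _ hC _ =>
    exact (hC.elim (fun h => h.1) (fun h => h.1)).trans hH.1.1.1.1
  | negativeBlock _ hH => exact hH.1.1.1.1
  | good H _ hH _ _ hC => exact hC.1.1.trans hH.1.1.1.1
  | final H D _ _ hH _ _ _ _ hF => exact hF.le

/-- A negative cycle cannot be usable by being good: good cycles are positive, and a vertex without
edges has degree zero. -/
lemma IsUsableIn.of_isNegativeCycle {σ : β → ℤˣ} {R H C : Graph α β}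
    (h : IsUsableIn σ R H C) (hn : IsNegativeCycle σ C) :
    C ≤ H ∧ {v ∈ V(C) | degree H v ≠ 2}.ncard ≤ 1 := by
  rcases h with ⟨-, ⟨v, rfl, -⟩ | ⟨hp, -⟩⟩ | ⟨h1, -, h2⟩
  · have := hn.1.2 v rfl
    simp [degree, Graph.incidenceSet, Graph.loopSet, Graph.Inc] at this
  · exact absurd (hp.2.symm.trans hn.2) (by decide)
  · exact ⟨h1, h2⟩

section Extend

variable [Fintype α] [Fintype β] {σ : β → ℤˣ} {S Z : Set β} {t : β → Bool → α}
  {R H C : Graph α β}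

/-- A preflow extends over a good generalized cycle of the whole graph. -/
lemma IsHalfPreflowOff.exists_of_isGood (ht : Tips R t) (hC : IsGood σ R C) (hZ : E(C) ⊆ Z)
    (hS : ∀ e ∈ E(C), e ∉ S) {c : β → Bool → ZMod 3} (hc : IsHalfPreflowOff σ S Z t R C c) :
    ∃ f, IsHalfPreflow σ S Z t R f := by
  obtain ⟨hle, ⟨v, rfl, hd⟩ | ⟨hcyc, h2⟩⟩ := hC
  · exact hc.exists_of_vertex ht hle hd
  · obtain ⟨x, ⟨hx, hdx⟩, y, ⟨hy, hdy⟩, hxy⟩ := (Set.one_lt_ncard (Set.toFinite _)).1 h2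
    exact hc.exists_of_two_free ht hle hcyc.1 hZ hS hx hy hxy hdx hdy

/-- A preflow extends over a good generalized cycle of a leaf-block. -/
lemma IsHalfPreflowOff.exists_of_isGoodIn (ht : Tips R t) (hH : IsLeafBlock R H)
    (hdeg : ∀ v ∈ V(R), degree R v ≤ 3) (hC : IsGoodIn σ R H C) (hZ : E(C) ⊆ Z)
    (hS : ∀ e ∈ E(C), e ∉ S) {c : β → Bool → ZMod 3} (hc : IsHalfPreflowOff σ S Z t R C c) :
    ∃ f, IsHalfPreflow σ S Z t R f := by
  obtain ⟨hle, ⟨v, rfl, hd⟩ | ⟨hcyc, h2⟩⟩ := hC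
  · exact hc.exists_of_vertex ht (hle.trans hH.1.1.1) hd
  · exact hc.exists_of_good ht hH hdeg hle hcyc.1 h2 hZ hS

/-- A preflow of the graph that remains after a round extends to the graph before the round. -/
lemma Round.exists_halfPreflow {L : List (Graph α β × CycleType)} (ht : Tips R t)
    (hdeg : ∀ v ∈ V(R), degree R v ≤ 3) (hcomp : IsCompatible t S L) {k : ℕ} {ty : CycleType}
    (h : Round σ R k C ty) (hmem : (C, ty) ∈ L) {c : β → Bool → ZMod 3}
    (hc : IsHalfPreflow σ S (zeroSet L) t (R.deleteVerts V(C)) c) :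
    ∃ f, IsHalfPreflow σ S (zeroSet L) t R f := by
  obtain ⟨c, hc⟩ := hc.exists_off ht h.le hdeg
    (fun e he b hb heS => he.2 (hcomp.touch _ hmem e heS b hb))
  have posZ : ∀ D, (D, CycleType.positive) ∈ L → E(D) ⊆ zeroSet L :=
    fun D hD e he => ⟨D, Or.inr (Or.inl ⟨hD, he⟩)⟩
  cases h with
  | usableNegative H _ hH _ hC hn =>
    obtain ⟨hCH, h1⟩ := hC.of_isNegativeCycle hn
    exact hc.exists_of_ordinary ht (hCH.trans hH.1.1.1.1) hn (hcomp.odd _ hmem) hdeg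
      (hH.1.subsingleton_of_cycle ht hdeg hCH hn.1 h1)
  | usablePositive H _ hH _ hC hn =>
    rcases hC with hC | hC
    · exact hc.exists_of_isGoodIn ht hH.1 hdeg hC (posZ _ hmem) (hcomp.none _ (Or.inl hmem))
    · exact (hn hC.2.1).elim
  | negativeBlock _ hH _ hn =>
    refine hc.exists_of_ordinary ht hH.1.1.1.1 hn (hcomp.odd _ hmem) hdeg
      (hH.1.subsingleton_of_cycle ht hdeg le_rfl hn.1 ?_)
    have : {v ∈ V(C) | degree C v ≠ 2} = ∅ :=
      Set.eq_empty_of_forall_notMem fun v hv => hv.2 (hn.1.2 v hv.1)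
    rw [this, Set.ncard_empty]
    exact Nat.zero_le _
  | good H _ hH _ _ hC =>
    exact hc.exists_of_isGoodIn ht hH.1 hdeg hC.1 (posZ _ hmem) (hcomp.none _ (Or.inl hmem))
  | final H D _ _ hH _ _ _ _ hF =>
    cases hF with
    -- The fish is the whole remaining graph, so its preflow is constructed outright.
    | fishOdd hfish =>
      obtain ⟨τ, hsw, hfish⟩ := hfish
      exact exists_halfPreflow_of_fish ht hsw hfish (hcomp.none _ (Or.inr hmem))
        fun e he => ⟨_, Or.inr (Or.inr ⟨hmem, he⟩)⟩
    | fishEven _ _ _ hC =>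
      exact hc.exists_of_isGood ht hC (posZ _ hmem) (hcomp.none _ (Or.inl hmem))
    | special C₀ _ _ hp _ =>
      exact hc.exists_of_special ht hp.1.1 hp.1.2 fun e he => ⟨_, Or.inl ⟨hmem, he⟩⟩
    | positive _ C₁ _ hp _ =>
      exact hc.exists_of_isGood ht hp.2.1.2 (posZ _ hmem) (hcomp.none _ (Or.inl hmem))

/-- This serves the negative special cycles chosen before the recursive rounds: the first cycle, and
both cycles of the pre-process step. -/
lemma exists_halfPreflow_of_special {L : List (Graph α β × CycleType)} (ht : Tips R t)
    (hdeg : ∀ v ∈ V(R), degree R v ≤ 3) (hcomp : IsCompatible t S L) (hle : C ≤ R)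
    (hn : IsNegativeCycle σ C) (hmem : (C, CycleType.negativeSpecial) ∈ L)
    {c : β → Bool → ZMod 3} (hc : IsHalfPreflow σ S (zeroSet L) t (R.deleteVerts V(C)) c) :
    ∃ f, IsHalfPreflow σ S (zeroSet L) t R f := by
  obtain ⟨c, hc⟩ := hc.exists_off ht hle hdeg
    (fun e he b hb heS => he.2 (hcomp.touch _ hmem e heS b hb))
  exact hc.exists_of_special ht hle hn fun e he => ⟨_, Or.inl ⟨hmem, he⟩⟩

end Extend

lemma remaining_append (G : Graph α β) (L : List (Graph α β × CycleType)) (C : Graph α β)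
    (ty : CycleType) : remaining G (L ++ [(C, ty)]) = (remaining G L).deleteVerts V(C) := by
  refine Graph.ext ?_ fun e x y => ?_
  · ext v
    simp only [remaining, Graph.vertexSet_deleteVerts, List.mem_append, List.mem_singleton,
      Set.mem_sdiff, Set.mem_ofPred_eq]
    constructor
    · rintro ⟨h1, h2⟩
      exact ⟨⟨h1, fun ⟨p, hp, hv⟩ => h2 ⟨p, Or.inl hp, hv⟩⟩, fun hv => h2 ⟨_, Or.inr rfl, hv⟩⟩
    · rintro ⟨⟨h1, h2⟩, h3⟩
      refine ⟨h1, ?_⟩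
      rintro ⟨p, hp | rfl, hv⟩
      exacts [h2 ⟨p, hp, hv⟩, h3 hv]
  · have key : ∀ v, v ∉ {v | ∃ p ∈ L ++ [(C, ty)], v ∈ V(p.1)} ↔
        v ∉ {v | ∃ p ∈ L, v ∈ V(p.1)} ∧ v ∉ V(C) := by
      intro v
      simp only [List.mem_append, List.mem_singleton, Set.mem_ofPred_eq]
      constructor
      · intro h2
        exact ⟨fun ⟨p, hp, hv⟩ => h2 ⟨p, Or.inl hp, hv⟩, fun hv => h2 ⟨_, Or.inr rfl, hv⟩⟩
      · rintro ⟨h2, h3⟩ ⟨p, hp | rfl, hv⟩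
        exacts [h2 ⟨p, hp, hv⟩, h3 hv]
    rw [Graph.deleteVerts_isLink, remaining, remaining, Graph.deleteVerts_isLink,
      Graph.deleteVerts_isLink, key, key]
    tauto

lemma remaining_nil (G : Graph α β) : remaining G [] = G := by
  simp [remaining]

lemma remaining_singleton (G C : Graph α β) (ty : CycleType) :
    remaining G [(C, ty)] = G.deleteVerts V(C) := by
  have := remaining_append G [] C ty
  rwa [List.nil_append, remaining_nil] at this

lemma remaining_le (G : Graph α β) (L : List (Graph α β × CycleType)) : remaining G L ≤ G :=
  Graph.deleteVerts_le

lemma Partial.le {σ : β → ℤˣ} {G : Graph α β} {L : List (Graph α β × CycleType)}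
    (h : Partial σ G L) : ∀ p ∈ L, p.1 ≤ G := by
  induction h with
  | start C _ hC => simpa using hC
  | step L C ty _ hr ih =>
    intro p hp
    rw [List.mem_append, List.mem_singleton] at hp
    rcases hp with hp | rfl
    exacts [ih p hp, hr.le.trans (remaining_le G L)]

/-- Every round selects inside the graph from which the vertices of all earlier members have been
deleted. -/
lemma Partial.pairwise {σ : β → ℤˣ} {G : Graph α β} {L : List (Graph α β × CycleType)}
    (h : Partial σ G L) : L.Pairwise fun p q => Disjoint V(p.1) V(q.1) := by
  induction h with
  | start C _ hC => exact List.pairwise_singleton _ _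
  | step L C ty _ hr ih =>
    refine List.pairwise_append.2 ⟨ih, List.pairwise_singleton _ _, fun p hp q hq => ?_⟩
    rw [List.mem_singleton] at hq
    subst hq
    refine Set.disjoint_right.2 fun v hv hvp => ?_
    have := hr.le.vertexSet_mono hv
    rw [remaining, Graph.vertexSet_deleteVerts] at this
    exact this.2 ⟨p, hp, hvp⟩

section Returned

variable [Fintype α] [Fintype β] {σ : β → ℤˣ} {S : Set β} {t : β → Bool → α} {G : Graph α β}

/-- A preflow of the graph that remains during the recursion extends to the whole graph. -/
lemma Partial.exists_halfPreflow (ht : Tips G t) (hdeg : ∀ v ∈ V(G), degree G v ≤ 3)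
    {L L' : List (Graph α β × CycleType)} (hcomp : IsCompatible t S L) (h : Partial σ G L')
    (hsub : ∀ p ∈ L', p ∈ L)
    (hex : ∃ c, IsHalfPreflow σ S (zeroSet L) t (remaining G L') c) :
    ∃ f, IsHalfPreflow σ S (zeroSet L) t G f := by
  induction h with
  | start C _ hle hn _ =>
    obtain ⟨c, hc⟩ := hex
    rw [remaining_singleton] at hc
    exact exists_halfPreflow_of_special ht hdeg hcomp hle hn (hsub _ (by simp)) hc
  | step L' C ty _ hr ih =>
    obtain ⟨c, hc⟩ := hex
    rw [remaining_append] at hc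
    have hle := remaining_le G L'
    exact ih (fun p hp => hsub p (by simp [hp])) (hr.exists_halfPreflow (ht.mono hle)
      (fun v hv => (degree_mono ht hle v).trans (hdeg v (hle.vertexSet_mono hv))) hcomp
      (hsub _ (by simp)) hc)

/-- The backward induction starts at a graph without vertices, where every function is a preflow.
After the pre-process step this graph is reached by deleting both cycles, as they cover all
vertices. -/
lemma Returned.exists_halfPreflow (ht : Tips G t) (hdeg : ∀ v ∈ V(G), degree G v ≤ 3)
    {L : List (Graph α β × CycleType)} (h : Returned σ G L) (hS : IsSubdivisionChoice L S) :
    ∃ f, IsHalfPreflow σ S (zeroSet L) t G f := by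
  cases h with
  | preprocess C₁ C₂ hp =>
    obtain ⟨hle₁, hle₂, hn₁, hn₂, hd, hcov⟩ := hp
    have hcomp := hS.isCompatible ht (by simp [hle₁, hle₂]) (by simp [hd])
    have hle : C₂ ≤ G.deleteVerts V(C₁) := by
      refine ⟨?_, fun e x y hl => ?_⟩
      · rw [Graph.vertexSet_deleteVerts]
        exact fun v hv => ⟨hle₂.vertexSet_mono hv, Set.disjoint_right.1 hd hv⟩
      · rw [Graph.deleteVerts_isLink]
        exact ⟨hl.mono hle₂, Set.disjoint_right.1 hd hl.left_mem,
          Set.disjoint_right.1 hd hl.right_mem⟩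
    have hle' : G.deleteVerts V(C₁) ≤ G := Graph.deleteVerts_le
    obtain ⟨c, hc⟩ := exists_halfPreflow_of_special (ht.mono hle')
      (fun v hv => (degree_mono ht hle' v).trans (hdeg v (hle'.vertexSet_mono hv))) hcomp hle hn₂
      (by simp) (isHalfPreflow_of_isEmpty (by
        rw [Graph.vertexSet_deleteVerts, Graph.vertexSet_deleteVerts, ← hcov]
        refine Set.eq_empty_of_forall_notMem fun v hv => ?_
        exact hv.1.1.elim hv.1.2 hv.2) fun _ _ => 0)
    exact exists_halfPreflow_of_special ht hdeg hcomp hle₁ hn₁ (by simp) hc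
  | recursion _ hp hempty =>
    exact hp.exists_halfPreflow ht hdeg (hS.isCompatible ht hp.le hp.pairwise) (fun _ h => h)
      ⟨fun _ _ => 0, isHalfPreflow_of_isEmpty hempty _⟩

end Returned

end CycleSelection

/-! ### From half-edge values to flows on an oriented subdivision. -/

namespace CycleSelection

open scoped Classical

variable {α β : Type*}

lemma zsmul_eq_sg_mul (u : ℤˣ) (a : ZMod 3) : (u : ℤ) • a = sg u * a := by
  rw [zsmul_eq_mul]; rfl

lemma Orientation.tips {K : Graph α β} {σ : β → ℤˣ} (O : Orientation K σ) : Tips K O.tip :=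
  O.isLink

lemma boundary_eq_halfSum [Fintype β] {A : Type*} [AddCommGroup A] {K : Graph α β} {σ : β → ℤˣ}
    (O : Orientation K σ) (f : β → A) (v : α) :
    boundary O f v = halfSum O.tip E(K) (fun e b => (O.dir e b : ℤ) • f e) v := by
  unfold boundary halfSum
  rw [finsum_eq_sum_of_fintype, Fintype.sum_prod_type]
  refine Finset.sum_congr rfl fun e _ => Finset.sum_congr rfl fun b _ => ?_
  rw [finsum_eq_if]

/-- The value `a` at the vertex `x`, and zero elsewhere. -/
noncomputable def atVertex {A : Type*} [Zero A] (x : α) (a : A) (v : α) : A :=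
  if x = v then a else 0

/-- The sum of `g` over the half-edges of `e` at `v`. -/
noncomputable def edgeSum {A : Type*} [AddCommMonoid A] (t : β → Bool → α) (F : Set β) (e : β)
    (g : Bool → A) (v : α) : A :=
  ∑ b, if e ∈ F ∧ t e b = v then g b else 0

lemma edgeSum_of_notMem {A : Type*} [AddCommMonoid A] {t : β → Bool → α} {F : Set β} {e : β}
    (he : e ∉ F) (g : Bool → A) (v : α) : edgeSum t F e g v = 0 := by
  simp [edgeSum, he]

/-- The sum over the two half-edges of an edge with the given ends. -/
lemma Tips.sum_bool {A : Type*} [AddCommMonoid A] {K : Graph α β} {t : β → Bool → α}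
    (ht : Tips K t) {e : β} {x y : α} (hl : K.IsLink e x y) (g : Bool → A) :
    ∃ b, ∀ v, edgeSum t E(K) e g v = atVertex x (g b) v + atVertex y (g (!b)) v := by
  obtain ⟨b, rfl, rfl⟩ := ht.exists_of_isLink hl
  refine ⟨b, fun v => ?_⟩
  unfold edgeSum atVertex
  rw [Fintype.sum_bool]
  simp only [hl.edge_mem, true_and]
  cases b
  · rw [add_comm]; rfl
  · rfl

/-- The flow value of an edge whose half-edges have prescribed values. -/
lemma Orientation.exists_value {K : Graph α β} {σ : β → ℤˣ} (O : Orientation K σ) {e : β}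
    {x y : α} (hl : K.IsLink e x y) (a : ZMod 3) :
    ∃ f : ZMod 3, (f = 0 → a = 0) ∧ ∀ v,
      edgeSum O.tip E(K) e (fun b => (O.dir e b : ℤ) • f) v =
        atVertex x a v + atVertex y (sg (- σ e) * a) v := by
  obtain ⟨b, rfl, rfl⟩ := O.tips.exists_of_isLink hl
  have hdir : sg (O.dir e (!b)) * sg (O.dir e b) = sg (- σ e) := by
    rw [← O.dir_mul_dir e hl.edge_mem, ← sg_mul]
    cases b
    · rw [mul_comm]; rfl
    · rfl
  -- Multiplying by the direction at `x` makes the half-edge there contribute exactly `a`. The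
  -- contribution at `y` then carries the product of the two directions, which is `-σ e`.
  refine ⟨sg (O.dir e b) * a, fun h => (mul_eq_zero.1 h).resolve_left (sg_ne_zero _), fun v => ?_⟩
  have h1 : (O.dir e b : ℤ) • (sg (O.dir e b) * a) = a := by
    rw [zsmul_eq_sg_mul, ← mul_assoc, sg_mul_self, one_mul]
  have h2 : (O.dir e (!b) : ℤ) • (sg (O.dir e b) * a) = sg (- σ e) * a := by
    rw [zsmul_eq_sg_mul, ← mul_assoc, hdir]
  unfold edgeSum atVertex
  rw [Fintype.sum_bool]
  simp only [hl.edge_mem, true_and]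
  cases b
  · rw [add_comm, h1]; rw [Bool.not_false] at h2; rw [h2]; rfl
  · rw [h1]; rw [Bool.not_true] at h2; rw [h2]; rfl

section Subdivide

variable {G : Graph α β} {ℓ : EndLabelling G} {S : Set β}

lemma inl_mem_edgeSet_subdivide {e : β} :
    Sum.inl e ∈ E(subdivide G ℓ S) ↔ e ∈ E(G) ∧ e ∉ S := by
  constructor
  · rintro ⟨u, v, h, x, y, hl, -, -⟩
    exact ⟨hl.edge_mem, h⟩
  · rintro ⟨he, h⟩
    exact ⟨_, _, h, _, _, ℓ.isLink e he, rfl, rfl⟩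

lemma inr_mem_edgeSet_subdivide {e : β} {b : Bool} :
    Sum.inr (e, b) ∈ E(subdivide G ℓ S) ↔ e ∈ E(G) ∧ e ∈ S := by
  constructor
  · rintro ⟨u, v, h, h', -⟩
    exact ⟨h', h⟩
  · rintro ⟨he, h⟩
    exact ⟨_, _, h, he, Or.inl ⟨rfl, rfl⟩⟩

lemma subdivide_isLink_inl {e : β} (he : e ∈ E(G)) (hS : e ∉ S) :
    (subdivide G ℓ S).IsLink (Sum.inl e) (Sum.inl (ℓ.tip e false)) (Sum.inl (ℓ.tip e true)) :=
  ⟨hS, _, _, ℓ.isLink e he, rfl, rfl⟩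

lemma subdivide_isLink_inr {e : β} (he : e ∈ E(G)) (hS : e ∈ S) (b : Bool) :
    (subdivide G ℓ S).IsLink (Sum.inr (e, b)) (Sum.inl (ℓ.tip e b)) (Sum.inr e) :=
  ⟨hS, he, Or.inl ⟨rfl, rfl⟩⟩

/-- Sums over the half-edges of a subdivision at an original vertex and at a subdividing vertex,
in terms of the half-edges of the original graph. The values of a subdivided edge next to the
subdividing vertex are given by `m`. -/
lemma sum_subdivide [Fintype β] {M : Type*} [AddCommMonoid M] {c m : β → Bool → M}
    {A : β ⊕ β × Bool → α ⊕ β → M}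
    (h0 : ∀ e w, e ∉ E(subdivide G ℓ S) → A e w = 0)
    (h1 : ∀ e ∈ E(G), e ∉ S → ∀ w, A (.inl e) w =
      atVertex (.inl (ℓ.tip e false)) (c e false) w +
        atVertex (.inl (ℓ.tip e true)) (c e true) w)
    (h2 : ∀ e ∈ E(G), e ∈ S → ∀ b w, A (.inr (e, b)) w =
      atVertex (.inl (ℓ.tip e b)) (c e b) w + atVertex (.inr e) (m e b) w) :
    (∀ v, ∑ e, A e (.inl v) = halfSum ℓ.tip E(G) c v) ∧
      ∀ e ∈ E(G), e ∈ S → ∑ e', A e' (.inr e) = m e false + m e true := by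
  constructor
  · intro v
    rw [Fintype.sum_sum_type, Fintype.sum_prod_type, ← Finset.sum_add_distrib]
    refine Finset.sum_congr rfl fun e _ => ?_
    rw [Fintype.sum_bool, Fintype.sum_bool]
    by_cases he : e ∈ E(G)
    · by_cases hS : e ∈ S
      · rw [h0 (.inl e) _ fun h => (inl_mem_edgeSet_subdivide.1 h).2 hS, h2 e he hS, h2 e he hS]
        simp [he, atVertex]
      · rw [h1 e he hS, h0 (.inr (e, true)) _ fun h => hS (inr_mem_edgeSet_subdivide.1 h).2,
          h0 (.inr (e, false)) _ fun h => hS (inr_mem_edgeSet_subdivide.1 h).2]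
        simp [he, atVertex, add_comm]
    · rw [h0 (.inl e) _ fun h => he (inl_mem_edgeSet_subdivide.1 h).1,
        h0 (.inr (e, true)) _ fun h => he (inr_mem_edgeSet_subdivide.1 h).1,
        h0 (.inr (e, false)) _ fun h => he (inr_mem_edgeSet_subdivide.1 h).1]
      simp [he]
  · intro e he hS
    have hinl : ∀ e', A (.inl e') (.inr e) = 0 := by
      intro e'
      by_cases h : e' ∈ E(G) ∧ e' ∉ S
      · rw [h1 e' h.1 h.2]; simp [atVertex]
      · exact h0 _ _ fun h' => h (inl_mem_edgeSet_subdivide.1 h')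
    rw [Fintype.sum_sum_type, Finset.sum_eq_zero fun e' _ => hinl e', zero_add,
      Fintype.sum_prod_type, Finset.sum_eq_single e, Fintype.sum_bool, h2 e he hS, h2 e he hS]
    · simp [atVertex, add_comm]
    · intro e' _ hne
      refine Finset.sum_eq_zero fun b _ => ?_
      by_cases h : e' ∈ E(G) ∧ e' ∈ S
      · rw [h2 e' h.1 h.2]; simp [atVertex, hne]
      · exact h0 _ _ fun h' => h (inr_mem_edgeSet_subdivide.1 h')
    · exact fun h => (h (Finset.mem_univ _)).elim

/-- Degrees are half-edge sums of the constant 1, so this is `sum_subdivide` with every value equal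
to 1. The orientation only supplies names for the ends of the edges of the subdivision. -/
lemma degree_subdivide [Fintype β] {σ' : β ⊕ β × Bool → ℤˣ}
    (O : Orientation (subdivide G ℓ S) σ') :
    (∀ v, degree (subdivide G ℓ S) (.inl v) = degree G v) ∧
      ∀ e ∈ E(G), e ∈ S → degree (subdivide G ℓ S) (.inr e) = 2 := by
  have key := sum_subdivide (G := G) (ℓ := ℓ) (S := S) (c := fun _ _ => 1) (m := fun _ _ => 1)
    (A := fun e w => edgeSum O.tip E(subdivide G ℓ S) e (fun _ => (1 : ℕ)) w)
    (fun e w he => edgeSum_of_notMem he _ _)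
    (fun e he hS w => by
      obtain ⟨b, hb⟩ := O.tips.sum_bool (subdivide_isLink_inl he hS) (fun _ => (1 : ℕ))
      exact hb w)
    (fun e he hS b w => by
      obtain ⟨b', hb⟩ := O.tips.sum_bool (subdivide_isLink_inr he hS b) (fun _ => (1 : ℕ))
      exact hb w)
  refine ⟨fun v => ?_, fun e he hS => ?_⟩
  · rw [degree_eq_halfSum O.tips, degree_eq_halfSum (t := ℓ.tip) ℓ.isLink]
    exact key.1 v
  · rw [degree_eq_halfSum O.tips]
    exact key.2 e he hS

/-- A preflow of the subdivided graph from suitable values on the half-edges of the original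
graph. -/
lemma IsHalfPreflow.exists_isPreflow [Fintype β] {σ : β → ℤˣ} {Z : Set β} {c : β → Bool → ZMod 3}
    (hc : IsHalfPreflow σ S Z ℓ.tip G c) {σ' : β ⊕ β × Bool → ℤˣ}
    (hσ' : IsSubdividedSignature G S σ σ') (O : Orientation (subdivide G ℓ S) σ') :
    ∃ φ : β ⊕ β × Bool → ZMod 3, IsPreflow O φ ∧
      ∀ e ∈ E(subdivide G ℓ S), φ e = 0 → parent e ∈ Z := by
  have hφ : ∀ e : β ⊕ β × Bool, ∃ f : ZMod 3, e ∈ E(subdivide G ℓ S) → (f = 0 → parent e ∈ Z) ∧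
      ∀ w, edgeSum O.tip E(subdivide G ℓ S) e (fun b => (O.dir e b : ℤ) • f) w =
        e.elim
          (fun e => atVertex (.inl (ℓ.tip e false)) (c e false) w +
            atVertex (.inl (ℓ.tip e true)) (c e true) w)
          (fun p => atVertex (.inl (ℓ.tip p.1 p.2)) (c p.1 p.2) w +
            atVertex (.inr p.1) (sg (- σ' (.inr p)) * c p.1 p.2) w) := by
    rintro (e | ⟨e, b⟩)
    · by_cases hm : Sum.inl e ∈ E(subdivide G ℓ S)
      · obtain ⟨he, hS⟩ := inl_mem_edgeSet_subdivide.1 hm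
        obtain ⟨f, hf, hsum⟩ := O.exists_value (subdivide_isLink_inl he hS) (c e false)
        refine ⟨f, fun _ => ⟨fun h => hc.zero e he false (hf h), fun w => ?_⟩⟩
        rw [hsum w, (hσ' e he).1 hS, ← hc.rel e he hS]
        rfl
      · exact ⟨0, fun h => (hm h).elim⟩
    · by_cases hm : Sum.inr (e, b) ∈ E(subdivide G ℓ S)
      · obtain ⟨he, hS⟩ := inr_mem_edgeSet_subdivide.1 hm
        obtain ⟨f, hf, hsum⟩ := O.exists_value (subdivide_isLink_inr he hS b) (c e b)
        exact ⟨f, fun _ => ⟨fun h => hc.zero e he b (hf h), hsum⟩⟩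
      · exact ⟨0, fun h => (hm h).elim⟩
  choose φ hφ using hφ
  have key := sum_subdivide (G := G) (ℓ := ℓ) (S := S) (c := c)
    (m := fun e b => sg (- σ' (.inr (e, b))) * c e b)
    (A := fun e w => edgeSum O.tip E(subdivide G ℓ S) e (fun b => (O.dir e b : ℤ) • φ e) w)
    (fun e w he => edgeSum_of_notMem he _ _)
    (fun e he hS w => (hφ _ (inl_mem_edgeSet_subdivide.2 ⟨he, hS⟩)).2 w)
    (fun e he hS b w => (hφ _ (inr_mem_edgeSet_subdivide.2 ⟨he, hS⟩)).2 w)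
  obtain ⟨hd1, hd2⟩ := degree_subdivide O
  refine ⟨φ, fun w hw => ?_, fun e he => (hφ e he).1⟩
  rw [boundary_eq_halfSum]
  rcases hw with ⟨v, hv, rfl⟩ | ⟨e, ⟨hS, he⟩, rfl⟩
  · rw [hd1 v, ← hc.boundary v hv]
    exact not_congr (Eq.congr (key.1 v) rfl)
  · rw [hd2 e he hS]
    -- The two summands are the values of the halves carried across to the subdividing vertex. Their
    -- sum vanishes only if `c e true` is `-σ e * c e false`, since the signs of the halves multiply
    -- to `σ e`; `rel_sub` excludes this.
    have hne : sg (- σ' (.inr (e, false))) * c e false + sg (- σ' (.inr (e, true))) * c e true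
        ≠ 0 := by
      intro h0
      apply hc.rel_sub e he hS
      rw [← (hσ' e he).2 hS, sg_neg, sg_mul]
      rw [sg_neg, sg_neg] at h0
      linear_combination - sg (σ' (.inr (e, true))) * h0 -
        c e true * sg_mul_self (σ' (.inr (e, true)))
    simp only [or_true, iff_true]
    exact fun h => hne ((key.2 e he hS).symm.trans h)

end Subdivide

end CycleSelection

open CycleSelection in
theorem lemma5p3 {α β : Type*} [Finite α] [Finite β] (G : Graph α β) (σ : β → ℤˣ)
    (hcubic : Cubic G) (hconn : EdgeConnected 3 G)
    (hneg : ∃ D₁ ≤ G, ∃ D₂ ≤ G, IsNegativeCycle σ D₁ ∧ IsNegativeCycle σ D₂ ∧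
      Disjoint V(D₁) V(D₂))
    (L : List (Graph α β × CycleType)) (hL : Returned σ G L)
    (S : Set β) (hS : IsSubdivisionChoice L S)
    (ℓ : EndLabelling G) (σ' : β ⊕ β × Bool → ℤˣ) (hσ' : IsSubdividedSignature G S σ σ')
    (O : Orientation (subdivide G ℓ S) σ') :
    ∃ φ : β ⊕ β × Bool → ZMod 3, IsPreflow O φ ∧
      ∀ e ∈ E(subdivide G ℓ S), φ e = 0 →
        ∃ C, ((C, CycleType.negativeSpecial) ∈ L ∧ parent e ∈ E(C)) ∨
          ((C, CycleType.positive) ∈ L ∧ parent e ∈ E(C)) ∨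
          ((C, CycleType.fish) ∈ L ∧ IsDistinguishedEdge C (parent e)) := by
  have := Fintype.ofFinite α
  have := Fintype.ofFinite β
  -- The end labelling that names the halves of the subdivided edges also names the half-edges of
  -- `G`, so the values on `G` transfer directly to the subdivision.
  obtain ⟨c, hc⟩ := hL.exists_halfPreflow (t := ℓ.tip) ℓ.isLink (fun v hv => (hcubic v hv).le) hS
  exact hc.exists_isPreflow hσ' O
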